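/- Let $0<\alpha<1$, $T>0$, $\lambda>0$, $y_0\in\mathbb R$, and let $y(t)=y_0E_{\alpha,1}(-\lambda t^\alpha)$ for $0<t<T$, where $E_{\alpha,1}(z)=\sum_{k\ge0}z^k/\Gamma(\alpha k+1)$. Put $\mu^{a,b}(t)=(T-t)^a t^b$ and let $S_k^{a,b}$ be the shifted Jacobi polynomials on $(0,T)$, $\mu^{a,b}S_k^{a,b}=\frac{(-1)^k}{T^kk!}\frac{d^k}{dt^k}\mu^{k+a,k+b}$, which are orthogonal in $L^2_{\mu^{a,b}}(0,T)$. For an integer $M\ge1$ let $$\Phi_M^{-\alpha,0}v=\sum_{k=0}^{M}v_kS_k^{-\alpha,0},\qquad v_k=\frac{2k+1-\alpha}{T^{1-\alpha}}\int_0^T v\,S_k^{-\alpha,0}\,\mu^{-\alpha,0}\,dt,$$ be the $L^2_{\mu^{-\alpha,0}}(0,T)$-orthogonal projection of $v$ onto the polynomials of degree at most $M$. For $0<s<1/2$ let $|w|_{H^{s}(0,T)}=\big(\int_{\mathbb R}|\xi|^{2s}|\mathcal F(w\chi_{(0,T)})(\xi)|^2\,d\xi\big)^{1/2}$, where $\mathcal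 F$ is the unitary Fourier transform on $L^2(\mathbb R)$ with kernel $(2\pi)^{-1/2}e^{-i\xi t}$. (i) For all $-1\le\theta\le1$ with $1+2\alpha\theta>\alpha$, $$\big|(I-\Phi_M^{-\alpha,0})y\big|_{H^{\alpha/2}(0,T)}\le C\,|y_0|\,\lambda^{\theta}M^{\alpha-1-2\alpha\theta}.$$ (ii) For all $-1\le\theta\le1$ with $1+2\alpha\theta>0$, $$\big\|(I-\Phi_M^{-\alpha,0})y\big\|_{L^2_{\mu^{-\alpha,0}}(0,T)}\le C\,|y_0|\,\lambda^{\theta}M^{-1-2\alpha\theta}.$$ In both parts $C$ depends only on $\alpha$ and $T$ (not on $\theta,\lambda,y_0,M$), except that in part (i) for $\alpha=1/3$, and in part (ii) for $\alpha=1/2$, $C$ may also depend on $\theta$. In particular the left-hand sides are finite. -/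

import Mathlib

open MeasureTheory
open scoped ENNReal FourierTransform

noncomputable section

/-- The Mittag-Leffler function `E_{α,β}(z) = ∑ z^k / Γ(α k + β)` at a real argument. -/
def mittagLeffler (α β z : ℝ) : ℝ := ∑' k : ℕ, z ^ k / Real.Gamma (α * k + β)

/-- The function `y(t) = y₀ E_{α,1}(-λ t^α)`, used for `0 < t < T`. -/
def relaxation (α lam y₀ t : ℝ) : ℝ := y₀ * mittagLeffler α 1 (-lam * t ^ α)

/-- The Jacobi weight `μ^{a,b}(t) = (T - t)^a t^b` on `(0,T)`. -/
def jacobiWeight (T a b t : ℝ) : ℝ := (T - t) ^ a * t ^ b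

/-- The measure `μ^{a,b}(t) dt` on `(0,T)`. -/
def jacobiMeasure (T a b : ℝ) : Measure ℝ :=
  (volume.restrict (Set.Ioo 0 T)).withDensity fun t => ENNReal.ofReal (jacobiWeight T a b t)

/-- The norm of `L²_{μ^{a,b}}(0,T)`, with value `∞` where the integral diverges. -/
def weightedL2Norm (T a b : ℝ) (v : ℝ → ℝ) : ℝ≥0∞ := eLpNorm v 2 (jacobiMeasure T a b)

/-- The shifted Jacobi polynomial `S_k^{a,b}` on `(0,T)`, by Rodrigues' formula
`μ^{a,b} S_k^{a,b} = (-1)^k / (T^k k!) (d/dt)^k μ^{k+a,k+b}`; only its values on `(0,T)` matter. -/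
def shiftedJacobi (T a b : ℝ) (k : ℕ) (t : ℝ) : ℝ :=
  (jacobiWeight T a b t)⁻¹ *
    ((-1) ^ k / (T ^ k * (k.factorial : ℝ)) *
      iteratedDeriv k (jacobiWeight T (k + a) (k + b)) t)

/-- `ξ_k^{a,b}`, the square of the weighted norm of `S_k^{a,b}`. -/
def jacobiNormSq (T a b : ℝ) (k : ℕ) : ℝ :=
  T ^ (a + b + 1) * Real.Gamma (k + a + 1) * Real.Gamma (k + b + 1) /
    ((2 * k + a + b + 1) * (k.factorial : ℝ) * Real.Gamma (k + a + b + 1))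

/-- The Jacobi coefficient `v_k = ⟨v, S_k^{a,b}⟩_{μ^{a,b}} / ξ_k^{a,b}`. -/
def jacobiCoeff (T a b : ℝ) (v : ℝ → ℝ) (k : ℕ) : ℝ :=
  (∫ t in Set.Ioo 0 T, v t * shiftedJacobi T a b k t * jacobiWeight T a b t) /
    jacobiNormSq T a b k

/-- The `L²_{μ^{a,b}}(0,T)`-orthogonal projection `Φ_M^{a,b}` onto the polynomials of degree at
most `M`: the truncated Jacobi expansion `∑_{k=0}^M v_k S_k^{a,b}`. -/
def jacobiProj (T a b : ℝ) (M : ℕ) (v : ℝ → ℝ) (t : ℝ) : ℝ :=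
  ∑ k ∈ Finset.range (M + 1), jacobiCoeff T a b v k * shiftedJacobi T a b k t

/-- The unitary Fourier transform `(2π)^{-1/2} ∫_0^T e^{-iξt} w(t) dt` of the extension by zero
of `w` from `(0,T)` to `ℝ`; Mathlib's `𝓕` has the kernel `e^{-2πiξt}`. -/
def fourierZeroExt (T : ℝ) (w : ℝ → ℝ) (ξ : ℝ) : ℂ :=
  (((Real.sqrt (2 * Real.pi))⁻¹ : ℝ) : ℂ) *
    𝓕 (fun t : ℝ => (((Set.Ioo 0 T).indicator w t : ℝ) : ℂ)) (ξ / (2 * Real.pi))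

/-- For `0 < γ < 1/2` and `w ∈ L²(0,T)`: the seminorm
`|w|_{H^γ(0,T)} = (∫_ℝ |ξ|^{2γ} |𝓕(w χ_{(0,T)})(ξ)|² dξ)^{1/2}`, with value `∞` when
`w ∉ H^γ(0,T)`. -/
def sobolevSeminorm (T γ : ℝ) (w : ℝ → ℝ) : ℝ≥0∞ :=
  (∫⁻ ξ : ℝ, ENNReal.ofReal (|ξ| ^ (2 * γ) * ‖fourierZeroExt T w ξ‖ ^ 2)) ^ (1 / 2 : ℝ)

end

/-! ### Beta and Gamma integrals. -/

noncomputable section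

open Set ProbabilityTheory

/-! The function `E_{α,1}(-λ t^α)` is completely monotone: it equals `∫_0^∞ K(r) e^{-rt} dr` with an
explicit density `K ≥ 0`. This is proved by computing the Stieltjes transform of `K` with a contour
integral (`lintegral_relaxKernel_div`), which is the Laplace transform of the right-hand side, and
comparing it with the termwise Laplace transform of the series (`relax_even_odd`,
`ae_eq_of_laplace_eq`).

The density satisfies `K(r) ≤ c λ r^{-α-1}` and `K(r) ≤ c λ⁻¹ r^{α-1}`. Rodrigues' formula and `k`
integrations by parts turn the pairing of `e^{-rt}` with `S_k` into an integral of `r^k e^{-rt}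
(T-t)^{k-α} t^k`. Integrating first in `r` and then in `t` leaves a Gamma factor times a Beta factor
(`abs_integral_relaxCont_mul_jacobiPoly_le`). With `X = λ T^α k^{-2α}`, the `k`-th coefficient is
therefore `O(k⁻¹ min(X, X⁻¹))`, which is `O(k⁻¹ X^θ)` for every `-1 ≤ θ ≤ 1`.

Part (ii) is then Parseval: the squared error is the tail of `v_k² ξ_k`, where `ξ_k` is of order
`1/k`. For part (i) the tail carries the additional weight `k^{2α}`. The reason is that the
Riemann–Liouville integral of order `α` maps `s^{-α} S_k(T-s)` to a multiple of `S_k`, the multiple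
being of order `k^{-α}` (`fracPoly_jacobiPoly`), and maps `L²(s^α ds)` boundedly into the Fourier
space of order `α/2` up to a Hardy term at `T`, which is the weighted `L²` norm itself
(`exists_fourier_le`). The functions `s^{-α} S_k(T-s)` are orthogonal in `L²(s^α ds)`, so the
seminorm of an expansion is controlled by its coefficients; Fatou's lemma extends this to the
remainder.

Both tails have the form `∑_{k>M} Λ^{2θ} k^{-3+2σ-4αθ}`, with `σ = α` or `σ = 0`. The direct bound
degenerates as `θ` decreases to `θ₀ = -(1-σ)/(2α)`. If `θ₀ < -1` this is out of reach. If `θ₀ > -1`,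
the coefficient bounds are available below `θ₀`, and splitting the sum where `X` crosses `1` gives a
uniform constant (`exists_sum_tail_le`). Only `θ₀ = -1` resists, that is `α = 1/3` for `σ = α` and
`α = 1/2` for `σ = 0`. -/

lemma lintegral_Ioo_scale {x : ℝ} (hx : 0 < x) (f : ℝ → ℝ≥0∞) :
    ∫⁻ t in Ioo 0 x, f t = ENNReal.ofReal x * ∫⁻ s in Ioo 0 1, f (x * s) := by
  have himg : (fun s : ℝ => x * s) '' Ioo 0 1 = Ioo 0 x := by
    rw [image_mul_left_Ioo hx]; simp
  rw [← himg, lintegral_image_eq_lintegral_abs_deriv_mul measurableSet_Ioo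
    (f' := fun _ => x) (fun s _ => by simpa using ((hasDerivAt_id s).const_mul x).hasDerivWithinAt)
    (fun a _ b _ h => mul_left_cancel₀ hx.ne' h)]
  rw [← lintegral_const_mul' _ _ ENNReal.ofReal_ne_top, abs_of_pos hx]

/-- Scaling to `(0,1)` reduces this to the normalisation of the Beta probability density. -/
lemma lintegral_beta {x a b : ℝ} (hx : 0 < x) (ha : 0 < a) (hb : 0 < b) :
    ∫⁻ t in Ioo 0 x, ENNReal.ofReal (t ^ (a - 1) * (x - t) ^ (b - 1)) =
      ENNReal.ofReal (x ^ (a + b - 1) * beta a b) := by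
  have hB := beta_pos ha hb
  have h1 := lintegral_betaPDF_eq_one ha hb
  rw [lintegral_betaPDF] at h1
  rw [lintegral_Ioo_scale hx]
  have : ∀ s ∈ Ioo (0 : ℝ) 1, ENNReal.ofReal ((x * s) ^ (a - 1) * (x - x * s) ^ (b - 1)) =
      ENNReal.ofReal (x ^ (a + b - 2) * beta a b) *
        ENNReal.ofReal (1 / beta a b * s ^ (a - 1) * (1 - s) ^ (b - 1)) := by
    intro s hs
    rw [← ENNReal.ofReal_mul (by positivity)]
    congr 1
    rw [show x - x * s = x * (1 - s) by ring, Real.mul_rpow hx.le hs.1.le,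
      Real.mul_rpow hx.le (by linarith [hs.2]), show a + b - 2 = (a - 1) + (b - 1) by ring,
      Real.rpow_add hx]
    field_simp
  rw [setLIntegral_congr_fun measurableSet_Ioo this, lintegral_const_mul' _ _ ENNReal.ofReal_ne_top,
    h1, mul_one, ← ENNReal.ofReal_mul hx.le]
  congr 1
  rw [← mul_assoc, show a + b - 1 = 1 + (a + b - 2) by ring, Real.rpow_add hx, Real.rpow_one]

lemma integrableOn_beta {x a b : ℝ} (hx : 0 < x) (ha : 0 < a) (hb : 0 < b) :
    IntegrableOn (fun t => t ^ (a - 1) * (x - t) ^ (b - 1)) (Ioo 0 x) := by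
  refine ⟨by fun_prop, ?_⟩
  rw [hasFiniteIntegral_iff_ofReal, lintegral_beta hx ha hb]
  · exact ENNReal.ofReal_lt_top
  · refine (ae_restrict_iff' measurableSet_Ioo).2 (.of_forall fun t ht => ?_)
    have := ht.1; have := sub_pos.2 ht.2
    simp only [Pi.zero_apply]; positivity

lemma integral_beta {x a b : ℝ} (hx : 0 < x) (ha : 0 < a) (hb : 0 < b) :
    ∫ t in Ioo 0 x, t ^ (a - 1) * (x - t) ^ (b - 1) = x ^ (a + b - 1) * beta a b := by
  have hB := beta_pos ha hb
  rw [integral_eq_lintegral_of_nonneg_ae, lintegral_beta hx ha hb, ENNReal.toReal_ofReal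
    (by positivity)]
  · refine (ae_restrict_iff' measurableSet_Ioo).2 (.of_forall fun t ht => ?_)
    have := ht.1; have := sub_pos.2 ht.2
    simp only [Pi.zero_apply]; positivity
  · fun_prop

lemma lintegral_Gamma {a r : ℝ} (ha : 0 < a) (hr : 0 < r) :
    ∫⁻ t in Ioi (0 : ℝ), ENNReal.ofReal (t ^ (a - 1) * Real.exp (-(r * t))) =
      ENNReal.ofReal ((1 / r) ^ a * Real.Gamma a) := by
  have hint : IntegrableOn (fun t : ℝ => t ^ (a - 1) * Real.exp (-(r * t))) (Ioi 0) := by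
    have := integrableOn_rpow_mul_exp_neg_mul_rpow (s := a - 1) (p := 1) (b := r)
      (by linarith) (by norm_num) hr
    simpa using this
  rw [← Real.integral_rpow_mul_exp_neg_mul_Ioi ha hr,
    ofReal_integral_eq_lintegral_ofReal hint]
  refine (ae_restrict_iff' measurableSet_Ioi).2 (.of_forall fun t (ht : 0 < t) => ?_)
  simp only [Pi.zero_apply]; positivity

/-! ### Bounds for ratios of Gamma functions -/

/-- Log-convexity of Gamma between `x` and `x + 1`. -/
lemma Gamma_add_le {x s : ℝ} (hx : 0 < x) (hs : 0 < s) (hs' : s < 1) :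
    Real.Gamma (x + s) ≤ x ^ s * Real.Gamma x := by
  have h := Real.Gamma_mul_add_mul_le_rpow_Gamma_mul_rpow_Gamma (s := x) (t := x + 1)
    (a := 1 - s) (b := s) hx (by linarith) (by linarith) hs (by ring)
  have hG := Real.Gamma_pos_of_pos hx
  calc _ = Real.Gamma ((1 - s) * x + s * (x + 1)) := by ring_nf
    _ ≤ _ := h
    _ = _ := by
      rw [Real.Gamma_add_one hx.ne', Real.mul_rpow hx.le hG.le, mul_left_comm,
        ← Real.rpow_add hG]
      simp

/-- The previous inequality started at `x + s` with step `1 - s`. -/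
lemma Gamma_le_Gamma_add {x s : ℝ} (hx : 0 < x) (hs : 0 < s) (hs' : s < 1) :
    Real.Gamma x ≤ (x + s) ^ (1 - s) / x * Real.Gamma (x + s) := by
  have h := Gamma_add_le (x := x + s) (s := 1 - s) (by linarith) (by linarith) (by linarith)
  rw [show x + s + (1 - s) = x + 1 by ring, Real.Gamma_add_one hx.ne'] at h
  rw [div_mul_eq_mul_div, le_div_iff₀ hx]
  linarith

end

/-! ### Rodrigues' formula and repeated integration by parts. -/

noncomputable section

open Set ProbabilityTheory Polynomial

/-- The polynomials `Q_j` with `(d/dt)^j ((T-t)^c t^d) = (T-t)^(c-j) t^(d-j) Q_j(t)`. -/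
def rodriguesPoly (T c d : ℝ) : ℕ → ℝ[X]
  | 0 => 1
  | j + 1 => C (-(c - j)) * (X * rodriguesPoly T c d j) +
      C (d - j) * ((C T - X) * rodriguesPoly T c d j) +
      X * (C T - X) * derivative (rodriguesPoly T c d j)

/-- `(T-t)^(c-j) t^(d-j) Q_j(t)`, the `j`-th derivative of `(T-t)^c t^d` on `(0,T)`. -/
def rodriguesDeriv (T c d : ℝ) (j : ℕ) (t : ℝ) : ℝ :=
  (T - t) ^ (c - j) * t ^ (d - j) * (rodriguesPoly T c d j).eval t

lemma hasDerivAt_rodriguesDeriv {T c d : ℝ} (j : ℕ) {t : ℝ} (ht : t ∈ Ioo 0 T) :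
    HasDerivAt (rodriguesDeriv T c d j) (rodriguesDeriv T c d (j + 1) t) t := by
  have h0 : 0 < t := ht.1
  have h1 : 0 < T - t := sub_pos.2 ht.2
  have hA : HasDerivAt (fun t : ℝ => (T - t) ^ (c - j)) (-1 * (c - j) * (T - t) ^ (c - j - 1)) t :=
    ((hasDerivAt_id t).const_sub T).rpow_const (Or.inl h1.ne')
  have hB : HasDerivAt (fun t : ℝ => t ^ (d - j)) (1 * (d - j) * t ^ (d - j - 1)) t :=
    (hasDerivAt_id t).rpow_const (Or.inl h0.ne')
  have hC := (rodriguesPoly T c d j).hasDerivAt t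
  convert! (hA.mul hB).mul hC using 1
  simp only [rodriguesDeriv, rodriguesPoly, eval_add, eval_mul, eval_C, eval_X, eval_sub]
  push_cast
  have e1 : (T - t) ^ (c - j) = (T - t) ^ (c - (j + 1)) * (T - t) := by
    rw [← Real.rpow_add_one h1.ne']; ring_nf
  have e2 : t ^ (d - j) = t ^ (d - (j + 1)) * t := by
    rw [← Real.rpow_add_one h0.ne']; ring_nf
  simp only [Pi.mul_apply]
  rw [e1, e2, show c - (j : ℝ) - 1 = c - (j + 1) by ring, show d - (j : ℝ) - 1 = d - (j + 1) by ring]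
  ring

lemma iteratedDeriv_eq_rodriguesDeriv {T c d : ℝ} (j : ℕ) {t : ℝ} (ht : t ∈ Ioo 0 T) :
    iteratedDeriv j (fun t : ℝ => (T - t) ^ c * t ^ d) t = rodriguesDeriv T c d j t := by
  induction j generalizing t with
  | zero => simp [rodriguesDeriv, rodriguesPoly]
  | succ j ih =>
    rw [iteratedDeriv_succ]
    have : iteratedDeriv j (fun t : ℝ => (T - t) ^ c * t ^ d) =ᶠ[nhds t] rodriguesDeriv T c d j :=
      Filter.eventuallyEq_of_mem (Ioo_mem_nhds ht.1 ht.2) fun s hs => ih hs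
    rw [this.deriv_eq, (hasDerivAt_rodriguesDeriv j ht).deriv]

lemma coeff_rodriguesPoly (T c d : ℝ) (j : ℕ) :
    (rodriguesPoly T c d j).natDegree ≤ j ∧
      (rodriguesPoly T c d j).coeff j = (-1) ^ j * ∏ i ∈ Finset.range j, (c + d - i) := by
  induction j with
  | zero => simp [rodriguesPoly]
  | succ j ih =>
    obtain ⟨hd, hc⟩ := ih
    set Q := rodriguesPoly T c d j with hQ
    have hd' : (derivative Q).natDegree ≤ j - 1 := (natDegree_derivative_le Q).trans (by omega)
    have hX : (C T - X : ℝ[X]).natDegree ≤ 1 := by compute_degree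
    -- Sorted by growth of degree: the new leading coefficient is the old one times `-(c-j) - (d-j)
    -- - j = -(c+d-j)`.
    have hs : rodriguesPoly T c d (j + 1) = C (-(c - j) - (d - j)) * (X * Q) +
        C ((d - j) * T) * Q + (C T * (X * derivative Q) - X * (X * derivative Q)) := by
      rw [rodriguesPoly, ← hQ]
      simp only [map_sub, map_neg, map_mul]
      ring
    have hQ1 : Q.coeff (j + 1) = 0 := coeff_eq_zero_of_natDegree_lt (by omega)
    constructor
    · rw [natDegree_le_iff_coeff_eq_zero]
      intro N hN
      obtain ⟨N, rfl⟩ : ∃ n, N = n + 2 := ⟨N - 2, by omega⟩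
      have z1 : Q.coeff (N + 1) = 0 := coeff_eq_zero_of_natDegree_lt (by omega)
      have z2 : Q.coeff (N + 2) = 0 := coeff_eq_zero_of_natDegree_lt (by omega)
      rw [hs]
      simp only [coeff_add, coeff_sub, coeff_C_mul, coeff_X_mul, z1, z2, coeff_derivative]
      ring
    · rw [hs, Finset.prod_range_succ, pow_succ]
      rcases j with _ | j
      · simp [hQ, rodriguesPoly]; ring
      · simp only [coeff_add, coeff_sub, coeff_C_mul, coeff_X_mul, hQ1, hc, coeff_derivative]
        push_cast
        ring

lemma integrableOn_rodriguesDeriv {T c d : ℝ} (hT : 0 < T) (j : ℕ) (hc : (j : ℝ) < c + 1)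
    (hd : (j : ℝ) < d + 1) : IntegrableOn (rodriguesDeriv T c d j) (Ioo 0 T) := by
  have h := integrableOn_beta (a := d - j + 1) (b := c - j + 1) hT (by linarith) (by linarith)
  have hp := h.mul_continuousOn_of_subset (g' := fun t => (rodriguesPoly T c d j).eval t)
    (rodriguesPoly T c d j).continuous.continuousOn measurableSet_Ioo isCompact_Icc
    Ioo_subset_Icc_self
  refine hp.congr_fun (fun t _ => ?_) measurableSet_Ioo
  simp only [rodriguesDeriv, add_sub_cancel_right]; ring

lemma continuous_rodriguesDeriv {T c d : ℝ} (j : ℕ) (hc : (j : ℝ) < c) (hd : (j : ℝ) < d) :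
    Continuous (rodriguesDeriv T c d j) := by
  unfold rodriguesDeriv
  refine ((continuous_const.sub continuous_id).rpow_const fun _ => Or.inr ?_).mul
    (continuous_id.rpow_const fun _ => Or.inr ?_) |>.mul (rodriguesPoly T c d j).continuous <;>
  linarith

/-- At each integration by parts the antiderivative still has positive powers at both end points, so
it is continuous and the boundary terms vanish. Only the top derivative may be unbounded, and the
hypotheses keep it integrable. -/
lemma integral_mul_rodriguesDeriv {T c d : ℝ} (hT : 0 < T) {q : ℝ → ℝ} (hq : ContDiff ℝ (⊤ : ℕ∞) q)
    (j : ℕ) (hc : (j : ℝ) < c + 1) (hd : (j : ℝ) < d + 1) :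
    ∫ t in Ioo 0 T, q t * rodriguesDeriv T c d j t =
      (-1) ^ j * ∫ t in Ioo 0 T, iteratedDeriv j q t * ((T - t) ^ c * t ^ d) := by
  induction j generalizing q with
  | zero => simp [rodriguesDeriv, rodriguesPoly]
  | succ j ih =>
    push_cast at hc hd
    have hq' : ContDiff ℝ (⊤ : ℕ∞) (deriv q) := hq.iterate_deriv 1
    have hcont := continuous_rodriguesDeriv (T := T) j (c := c) (d := d) (by linarith) (by linarith)
    have hint := integrableOn_rodriguesDeriv (c := c) (d := d) hT (j + 1)
      (by push_cast; linarith) (by push_cast; linarith)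
    have h := intervalIntegral.integral_mul_deriv_eq_deriv_mul_of_hasDerivAt (a := 0) (b := T)
      (u := q) (v := rodriguesDeriv T c d j) (u' := deriv q) (v' := rodriguesDeriv T c d (j + 1))
      hq.continuous.continuousOn hcont.continuousOn
      (fun t _ => (hq.differentiable (by simp) t).hasDerivAt)
      (fun t ht => hasDerivAt_rodriguesDeriv j (by simpa [hT.le] using ht))
      (hq'.continuous.intervalIntegrable _ _)
      ((intervalIntegrable_iff_integrableOn_Ioo_of_le hT.le).2 hint)
    have hT0 : rodriguesDeriv T c d j T = 0 := by
      simp [rodriguesDeriv, Real.zero_rpow (show c - j ≠ 0 by linarith)]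
    have h00 : rodriguesDeriv T c d j 0 = 0 := by
      simp [rodriguesDeriv, Real.zero_rpow (show d - j ≠ 0 by linarith)]
    rw [hT0, h00, intervalIntegral.integral_of_le hT.le, intervalIntegral.integral_of_le hT.le,
      integral_Ioc_eq_integral_Ioo, integral_Ioc_eq_integral_Ioo] at h
    rw [h, ih hq' (by linarith) (by linarith), pow_succ]
    simp only [iteratedDeriv_succ']
    ring

/-! ### The shifted Jacobi polynomials for the weight `(T - t)^(-α)` -/

/-- The polynomial which `S_k^{-α,0}` is on `(0,T)`. -/
def jacobiPoly (α T : ℝ) (k : ℕ) : ℝ[X] :=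
  C ((-1) ^ k / (T ^ k * (k.factorial : ℝ))) * rodriguesPoly T (k - α) k k

variable {α T : ℝ}

lemma shiftedJacobi_eq (k : ℕ) {t : ℝ} (ht : t ∈ Ioo 0 T) :
    shiftedJacobi T (-α) 0 k t = (jacobiPoly α T k).eval t := by
  have h1 : 0 < T - t := sub_pos.2 ht.2
  have : jacobiWeight T (k + -α) (k + 0) = fun t : ℝ => (T - t) ^ (k - α) * t ^ (k : ℝ) := by
    ext t; simp [jacobiWeight, sub_eq_add_neg]
  rw [shiftedJacobi, this, iteratedDeriv_eq_rodriguesDeriv k ht]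
  simp only [jacobiWeight, rodriguesDeriv, jacobiPoly, eval_mul, eval_C, Real.rpow_zero, sub_self,
    show (k : ℝ) - α - k = -α by ring]
  have := Real.rpow_pos_of_pos h1 (-α)
  field_simp

lemma natDegree_jacobiPoly (k : ℕ) : (jacobiPoly α T k).natDegree ≤ k :=
  (natDegree_C_mul_le _ _).trans (coeff_rodriguesPoly _ _ _ _).1

lemma prod_range_sub_eq_Gamma {x : ℝ} (k : ℕ) (hx : (k : ℝ) < x + 1) :
    (∏ i ∈ Finset.range k, (x - i)) * Real.Gamma (x + 1 - k) = Real.Gamma (x + 1) := by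
  induction k with
  | zero => simp
  | succ k ih =>
    push_cast at hx
    rw [← ih (by linarith), Finset.prod_range_succ, mul_assoc]
    congr 1
    push_cast
    rw [show x + 1 - (k : ℝ) = (x - k) + 1 by ring, Real.Gamma_add_one (by linarith)]
    ring_nf

lemma coeff_jacobiPoly (hα : α < 1) (k : ℕ) :
    (jacobiPoly α T k).coeff k =
      Real.Gamma (2 * k + 1 - α) / (T ^ k * k.factorial * Real.Gamma (k + 1 - α)) := by
  have hk : (0 : ℝ) ≤ k := k.cast_nonneg
  have h := prod_range_sub_eq_Gamma (x := 2 * k - α) k (by linarith)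
  rw [jacobiPoly, coeff_C_mul, (coeff_rodriguesPoly _ _ _ _).2]
  rw [show (2 * (k : ℝ) - α + 1 - k) = k + 1 - α by ring,
    show (2 * (k : ℝ) - α + 1) = 2 * k + 1 - α by ring] at h
  have hG : Real.Gamma (k + 1 - α) ≠ 0 := (Real.Gamma_pos_of_pos (by linarith)).ne'
  rw [← h, show (k : ℝ) - α + k = 2 * k - α by ring]
  have : ((-1 : ℝ) ^ k) * (-1) ^ k = 1 := by rw [← mul_pow]; simp
  rw [div_mul_eq_mul_div, ← mul_assoc, this, one_mul, mul_div_mul_right _ _ hG]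

lemma coeff_jacobiPoly_ne_zero (hα : α < 1) (hT : 0 < T) (k : ℕ) :
    (jacobiPoly α T k).coeff k ≠ 0 := by
  have hk : (0 : ℝ) ≤ k := k.cast_nonneg
  rw [coeff_jacobiPoly hα]
  have h1 := Real.Gamma_pos_of_pos (show 0 < 2 * (k : ℝ) + 1 - α by linarith)
  have h2 := Real.Gamma_pos_of_pos (show 0 < (k : ℝ) + 1 - α by linarith)
  positivity

/-- The weight `(T-t)^(-α)` completes `jacobiPoly` to the `k`-th derivative in Rodrigues' formula,
so all derivatives can be moved to `q`. Orthogonality (with `q` a polynomial) and the decay of the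
coefficients (with `q` an exponential) both come from this identity. -/
lemma integral_mul_jacobiPoly (hα : α < 1) (hT : 0 < T) {q : ℝ → ℝ}
    (hq : ContDiff ℝ (⊤ : ℕ∞) q) (k : ℕ) :
    ∫ t in Ioo 0 T, q t * (jacobiPoly α T k).eval t * (T - t) ^ (-α) =
      (1 / (T ^ k * k.factorial)) *
        ∫ t in Ioo 0 T, iteratedDeriv k q t * ((T - t) ^ (k - α) * t ^ (k : ℝ)) := by
  have hk : (0 : ℝ) ≤ k := k.cast_nonneg
  have h := integral_mul_rodriguesDeriv (c := k - α) (d := k) hT hq k (by linarith) (by linarith)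
  have e : ∀ t ∈ Ioo 0 T, q t * (jacobiPoly α T k).eval t * (T - t) ^ (-α) =
      ((-1) ^ k / (T ^ k * (k.factorial : ℝ))) * (q t * rodriguesDeriv T (k - α) k k t) := by
    intro t _
    simp only [rodriguesDeriv, jacobiPoly, eval_mul, eval_C, Real.rpow_zero, sub_self,
      show (k : ℝ) - α - k = -α by ring]
    ring
  rw [setIntegral_congr_fun measurableSet_Ioo e, integral_const_mul, h, ← mul_assoc]
  congr 1
  have : ((-1 : ℝ) ^ k) * (-1) ^ k = 1 := by rw [← mul_pow]; simp
  field_simp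
  linear_combination this

lemma iteratedDeriv_eval (p : ℝ[X]) (k : ℕ) :
    iteratedDeriv k (fun t => p.eval t) = fun t => ((derivative^[k] p).eval t) := by
  induction k with
  | zero => simp
  | succ k ih =>
    rw [iteratedDeriv_succ, ih, Function.iterate_succ_apply']
    ext t; simp

lemma contDiff_eval (p : ℝ[X]) : ContDiff ℝ (⊤ : ℕ∞) (fun t => p.eval t) := by
  simpa using Polynomial.contDiff_aeval (𝕜 := ℝ) p (⊤ : ℕ∞)

/-- The `k`-th derivative of a polynomial of degree at most `k` is constant, and what remains is a
Beta integral. -/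
lemma integral_poly_mul_jacobiPoly (hα : α < 1) (hT : 0 < T) {p : ℝ[X]} {k : ℕ}
    (hp : p.natDegree ≤ k) :
    ∫ t in Ioo 0 T, p.eval t * (jacobiPoly α T k).eval t * (T - t) ^ (-α) =
      p.coeff k * (T ^ (k + 1 - α) * beta (k + 1) (k + 1 - α)) := by
  have hk : (0 : ℝ) ≤ k := k.cast_nonneg
  rw [integral_mul_jacobiPoly hα hT (contDiff_eval p), iteratedDeriv_eval]
  have hd : derivative^[k] p = C (p.coeff k * k.factorial) := by
    ext n
    rw [coeff_iterate_derivative, coeff_C]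
    rcases Nat.eq_zero_or_pos n with rfl | hn
    · simp [Nat.descFactorial_self, mul_comm]
    · rw [coeff_eq_zero_of_natDegree_lt (by omega), if_neg hn.ne', smul_zero]
  have hb := integral_beta (a := k + 1) (b := k + 1 - α) hT (by linarith) (by linarith)
  simp only [hd, eval_C, integral_const_mul]
  have e : ∀ t ∈ Ioo 0 T, (T - t) ^ (k - α) * t ^ (k : ℝ) =
      t ^ ((k : ℝ) + 1 - 1) * (T - t) ^ ((k : ℝ) + 1 - α - 1) := by
    intro t _
    rw [mul_comm]; ring_nf
  rw [setIntegral_congr_fun measurableSet_Ioo e, hb,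
    show (k : ℝ) + 1 + (k + 1 - α) - 1 = (k + 1 - α) + k by ring, Real.rpow_add hT,
    Real.rpow_natCast]
  field_simp

lemma integral_jacobiPoly_mul_self (hα : α < 1) (hT : 0 < T) (k : ℕ) :
    ∫ t in Ioo 0 T, (jacobiPoly α T k).eval t * (jacobiPoly α T k).eval t * (T - t) ^ (-α) =
      T ^ (1 - α) / (2 * k + 1 - α) := by
  have hk : (0 : ℝ) ≤ k := k.cast_nonneg
  rw [integral_poly_mul_jacobiPoly hα hT (natDegree_jacobiPoly k), coeff_jacobiPoly hα, beta,
    show (k : ℝ) + 1 + (k + 1 - α) = (2 * k + 1 - α) + 1 by ring,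
    Real.Gamma_add_one (s := 2 * (k : ℝ) + 1 - α) (by linarith), Real.Gamma_nat_eq_factorial,
    show (k : ℝ) + 1 - α = (1 - α) + k by ring, Real.rpow_add hT, Real.rpow_natCast]
  have h1 := Real.Gamma_pos_of_pos (show 0 < 2 * (k : ℝ) + 1 - α by linarith)
  have h2 := Real.Gamma_pos_of_pos (show 0 < (1 - α) + (k : ℝ) by linarith)
  have h3 : 0 < 2 * (k : ℝ) + 1 - α := by linarith
  field_simp

lemma jacobiNormSq_eq (hα : α < 1) (k : ℕ) :
    jacobiNormSq T (-α) 0 k = T ^ (1 - α) / (2 * k + 1 - α) := by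
  have hk : (0 : ℝ) ≤ k := k.cast_nonneg
  have h2 := Real.Gamma_pos_of_pos (show 0 < (k : ℝ) + -α + 1 by linarith)
  have h3 : 0 < 2 * (k : ℝ) + 1 - α := by linarith
  rw [jacobiNormSq]
  simp only [add_zero]
  rw [Real.Gamma_nat_eq_factorial, show -α + 1 = 1 - α by ring,
    show 2 * (k : ℝ) + -α + 1 = 2 * k + 1 - α by ring]
  field_simp

lemma integral_jacobiPoly_mul_eq_zero (hα : α < 1) (hT : 0 < T) {p : ℝ[X]} {k : ℕ}
    (hp : p.natDegree < k) :
    ∫ t in Ioo 0 T, p.eval t * (jacobiPoly α T k).eval t * (T - t) ^ (-α) = 0 := by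
  rw [integral_poly_mul_jacobiPoly hα hT hp.le, coeff_eq_zero_of_natDegree_lt hp, zero_mul]

lemma integral_jacobiPoly_mul (hα : α < 1) (hT : 0 < T) (j k : ℕ) :
    ∫ t in Ioo 0 T, (jacobiPoly α T j).eval t * (jacobiPoly α T k).eval t * (T - t) ^ (-α) =
      if j = k then T ^ (1 - α) / (2 * k + 1 - α) else 0 := by
  split_ifs with h
  · subst h; exact integral_jacobiPoly_mul_self hα hT j
  · rcases lt_or_gt_of_ne h with h | h
    · exact integral_jacobiPoly_mul_eq_zero hα hT ((natDegree_jacobiPoly j).trans_lt h)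
    · have := integral_jacobiPoly_mul_eq_zero hα hT ((natDegree_jacobiPoly (α := α) (T := T) k).trans_lt h)
      simpa only [mul_comm] using this

lemma exists_eq_sum_jacobiPoly (hα : α < 1) (hT : 0 < T) (N : ℕ) (p : ℝ[X])
    (hp : p.natDegree < N) :
    ∃ a : ℕ → ℝ, p = ∑ k ∈ Finset.range N, C (a k) * jacobiPoly α T k := by
  induction N generalizing p with
  | zero => omega
  | succ N ih =>
    set c := p.coeff N / (jacobiPoly α T N).coeff N
    have hr : (p - C c * jacobiPoly α T N).natDegree ≤ N :=
      (natDegree_sub_le _ _).trans (max_le (by omega)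
        ((natDegree_C_mul_le _ _).trans (natDegree_jacobiPoly N)))
    have hr0 : (p - C c * jacobiPoly α T N).coeff N = 0 := by
      rw [coeff_sub, coeff_C_mul, div_mul_cancel₀ _ (coeff_jacobiPoly_ne_zero hα hT N), sub_self]
    -- For `N = 0` the remainder is the zero polynomial, whose `natDegree` is not below `0`; the
    -- induction hypothesis does not apply.
    rcases Nat.eq_zero_or_pos N with rfl | hN
    · refine ⟨fun _ => c, ?_⟩
      have h0 := eq_C_of_natDegree_le_zero hr
      rw [hr0, map_zero, sub_eq_zero] at h0
      simpa using h0
    · obtain ⟨a, ha⟩ := ih (p - C c * jacobiPoly α T N) (by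
        refine lt_of_le_of_ne hr fun h => ?_
        have : (p - C c * jacobiPoly α T N).leadingCoeff = 0 := by rw [leadingCoeff, h, hr0]
        rw [leadingCoeff_eq_zero.1 this] at h
        simp at h; omega)
      refine ⟨fun k => if k = N then c else a k, ?_⟩
      simp only [Finset.sum_range_succ, ← sub_eq_iff_eq_add, if_true, ha]
      exact Finset.sum_congr rfl fun k hk => by rw [if_neg (Finset.mem_range.1 hk).ne]

end

/-! ### Orthogonal projection and Parseval's identity in the weighted space. -/

noncomputable section

open Set ProbabilityTheory Polynomial

variable {α T : ℝ}

lemma integral_jacobiMeasure (f : ℝ → ℝ) :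
    ∫ t, f t ∂(jacobiMeasure T (-α) 0) = ∫ t in Ioo 0 T, f t * (T - t) ^ (-α) := by
  rw [jacobiMeasure, integral_withDensity_eq_integral_toReal_smul₀ (by unfold jacobiWeight; fun_prop)
    (.of_forall fun _ => ENNReal.ofReal_lt_top)]
  refine setIntegral_congr_fun measurableSet_Ioo fun t ht => ?_
  have : 0 < T - t := sub_pos.2 ht.2
  simp only [jacobiWeight, Real.rpow_zero, mul_one, smul_eq_mul]
  rw [ENNReal.toReal_ofReal (by positivity), mul_comm]

lemma lintegral_jacobiMeasure (f : ℝ → ℝ≥0∞) :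
    ∫⁻ t, f t ∂(jacobiMeasure T (-α) 0) =
      ∫⁻ t in Ioo 0 T, ENNReal.ofReal ((T - t) ^ (-α)) * f t := by
  rw [jacobiMeasure, lintegral_withDensity_eq_lintegral_mul_non_measurable _
    (by unfold jacobiWeight; fun_prop) (.of_forall fun _ => ENNReal.ofReal_lt_top)]
  simp [jacobiWeight]

lemma jacobiMeasure_absolutelyContinuous (a b : ℝ) :
    jacobiMeasure T a b ≪ volume.restrict (Ioo 0 T) := withDensity_absolutelyContinuous _ _

lemma isFiniteMeasure_jacobiMeasure (hα : α < 1) (hT : 0 < T) :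
    IsFiniteMeasure (jacobiMeasure T (-α) 0) := by
  refine ⟨?_⟩
  have h := lintegral_beta (a := 1) (b := 1 - α) hT one_pos (by linarith)
  rw [← lintegral_one, lintegral_jacobiMeasure]
  simp only [sub_self, Real.rpow_zero, one_mul, show 1 - α - 1 = -α by ring] at h
  simp only [mul_one, h]
  exact ENNReal.ofReal_lt_top

lemma integrable_jacobiMeasure (hα : α < 1) (hT : 0 < T) {f : ℝ → ℝ} (hf : Continuous f) :
    Integrable f (jacobiMeasure T (-α) 0) := by
  have := isFiniteMeasure_jacobiMeasure hα hT
  obtain ⟨C, hC⟩ := (isCompact_Icc (a := (0 : ℝ)) (b := T)).exists_bound_of_continuousOn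
    hf.continuousOn
  refine (integrable_const C).mono' hf.aestronglyMeasurable ?_
  exact (jacobiMeasure_absolutelyContinuous _ _).ae_le
    ((ae_restrict_iff' measurableSet_Ioo).2 (.of_forall fun t ht => hC t (Ioo_subset_Icc_self ht)))

lemma jacobiNormSq_pos (hα : α < 1) (hT : 0 < T) (k : ℕ) : 0 < jacobiNormSq T (-α) 0 k := by
  have hk : (0 : ℝ) ≤ k := k.cast_nonneg
  rw [jacobiNormSq_eq hα]
  have : 0 < 2 * (k : ℝ) + 1 - α := by linarith
  positivity

lemma jacobiCoeff_eq (v : ℝ → ℝ) (k : ℕ) :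
    jacobiCoeff T (-α) 0 v k = (∫ t in Ioo 0 T, v t * (jacobiPoly α T k).eval t * (T - t) ^ (-α)) /
      jacobiNormSq T (-α) 0 k := by
  rw [jacobiCoeff]
  congr 1
  refine setIntegral_congr_fun measurableSet_Ioo fun t ht => ?_
  simp [jacobiWeight, shiftedJacobi_eq k ht]

lemma integral_mul_jacobiPoly_eq_coeff (hα : α < 1) (hT : 0 < T) (v : ℝ → ℝ) (k : ℕ) :
    ∫ t, v t * (jacobiPoly α T k).eval t ∂(jacobiMeasure T (-α) 0) =
      jacobiCoeff T (-α) 0 v k * jacobiNormSq T (-α) 0 k := by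
  rw [jacobiCoeff_eq, div_mul_cancel₀ _ (jacobiNormSq_pos hα hT k).ne', integral_jacobiMeasure]

lemma integral_sum_jacobiPoly_sq (hα : α < 1) (hT : 0 < T) (s : Finset ℕ) (a : ℕ → ℝ) :
    ∫ t, (∑ k ∈ s, a k * (jacobiPoly α T k).eval t) ^ 2 ∂(jacobiMeasure T (-α) 0) =
      ∑ k ∈ s, a k ^ 2 * jacobiNormSq T (-α) 0 k := by
  have e : ∀ t : ℝ, (∑ k ∈ s, a k * (jacobiPoly α T k).eval t) ^ 2 =
      ∑ j ∈ s, ∑ k ∈ s, (a j * a k) * ((jacobiPoly α T j).eval t * (jacobiPoly α T k).eval t) := by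
    intro t
    rw [sq, Finset.sum_mul_sum]
    exact Finset.sum_congr rfl fun j _ => Finset.sum_congr rfl fun k _ => by ring
  simp_rw [e]
  rw [integral_finsetSum _ fun j _ => integrable_jacobiMeasure hα hT (by fun_prop)]
  refine Finset.sum_congr rfl fun j hj => ?_
  rw [integral_finsetSum _ fun k _ => integrable_jacobiMeasure hα hT (by fun_prop)]
  simp_rw [integral_const_mul, integral_jacobiMeasure, integral_jacobiPoly_mul hα hT,
    ← jacobiNormSq_eq hα]
  simp [hj, sq]

/-- Keeping the coefficients `a` arbitrary lets both the best approximation property and Bessel's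
identity be read off from one expansion of the square. -/
lemma integral_sub_sum_jacobiPoly_sq (hα : α < 1) (hT : 0 < T) {v : ℝ → ℝ} (hv : Continuous v)
    (s : Finset ℕ) (a : ℕ → ℝ) :
    ∫ t, (v t - ∑ k ∈ s, a k * (jacobiPoly α T k).eval t) ^ 2 ∂(jacobiMeasure T (-α) 0) =
      ∫ t, v t ^ 2 ∂(jacobiMeasure T (-α) 0) +
      ∑ k ∈ s, (a k ^ 2 - 2 * a k * jacobiCoeff T (-α) 0 v k) * jacobiNormSq T (-α) 0 k := by
  have e : ∀ t : ℝ, (v t - ∑ k ∈ s, a k * (jacobiPoly α T k).eval t) ^ 2 =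
      v t ^ 2 + (∑ k ∈ s, a k * (jacobiPoly α T k).eval t) ^ 2 -
        ∑ k ∈ s, (2 * a k) * (v t * (jacobiPoly α T k).eval t) := by
    intro t
    have : ∑ k ∈ s, (2 * a k) * (v t * (jacobiPoly α T k).eval t) =
        2 * v t * ∑ k ∈ s, a k * (jacobiPoly α T k).eval t := by
      rw [Finset.mul_sum]; exact Finset.sum_congr rfl fun k _ => by ring
    rw [this]; ring
  simp_rw [e]
  rw [integral_sub, integral_add, integral_sum_jacobiPoly_sq hα hT,
    integral_finsetSum _ fun k _ => integrable_jacobiMeasure hα hT (by fun_prop)]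
  · simp_rw [integral_const_mul, integral_mul_jacobiPoly_eq_coeff hα hT]
    rw [add_sub_assoc, ← Finset.sum_sub_distrib]
    congr 1
    exact Finset.sum_congr rfl fun k _ => by ring
  all_goals exact integrable_jacobiMeasure hα hT (by fun_prop)

/-- The polynomial which `Φ_M v` is on `(0,T)`. -/
def jacobiExpansion (α T : ℝ) (M : ℕ) (v : ℝ → ℝ) (t : ℝ) : ℝ :=
  ∑ k ∈ Finset.range (M + 1), jacobiCoeff T (-α) 0 v k * (jacobiPoly α T k).eval t

lemma jacobiProj_eq (M : ℕ) (v : ℝ → ℝ) {t : ℝ} (ht : t ∈ Ioo 0 T) :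
    jacobiProj T (-α) 0 M v t = jacobiExpansion α T M v t :=
  Finset.sum_congr rfl fun k _ => by rw [shiftedJacobi_eq k ht]

lemma continuous_jacobiExpansion (M : ℕ) (v : ℝ → ℝ) : Continuous (jacobiExpansion α T M v) := by
  unfold jacobiExpansion; fun_prop

lemma integral_sub_jacobiExpansion_sq_le (hα : α < 1) (hT : 0 < T) {v : ℝ → ℝ} (hv : Continuous v)
    (N : ℕ) {p : ℝ[X]} (hp : p.natDegree ≤ N) :
    ∫ t, (v t - jacobiExpansion α T N v t) ^ 2 ∂(jacobiMeasure T (-α) 0) ≤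
      ∫ t, (v t - p.eval t) ^ 2 ∂(jacobiMeasure T (-α) 0) := by
  obtain ⟨a, rfl⟩ := exists_eq_sum_jacobiPoly hα hT (N + 1) p (by omega)
  simp only [eval_finsetSum, eval_mul, eval_C, jacobiExpansion]
  rw [integral_sub_sum_jacobiPoly_sq hα hT hv, integral_sub_sum_jacobiPoly_sq hα hT hv]
  gcongr _ + ∑ k ∈ _, ?_ * _ with k
  · exact (jacobiNormSq_pos hα hT k).le
  · nlinarith [sq_nonneg (a k - jacobiCoeff T (-α) 0 v k)]

/-- Weierstrass approximation supplies a uniformly close polynomial, and the projection does at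
least as well in the weighted norm. -/
lemma tendsto_integral_sub_jacobiExpansion_sq (hα : α < 1) (hT : 0 < T) {v : ℝ → ℝ}
    (hv : Continuous v) :
    Filter.Tendsto (fun N => ∫ t, (v t - jacobiExpansion α T N v t) ^ 2 ∂(jacobiMeasure T (-α) 0))
      Filter.atTop (nhds 0) := by
  have := isFiniteMeasure_jacobiMeasure hα hT
  set A := (jacobiMeasure T (-α) 0).real univ
  have hA : 0 ≤ A := measureReal_nonneg
  rw [Metric.tendsto_atTop]
  intro ε hε
  obtain ⟨δ, hδ, hδε⟩ : ∃ δ : ℝ, 0 < δ ∧ δ ^ 2 * A < ε := by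
    refine ⟨Real.sqrt (ε / (A + 1)), by positivity, ?_⟩
    rw [Real.sq_sqrt (by positivity), div_mul_eq_mul_div, div_lt_iff₀ (by positivity)]
    linarith
  obtain ⟨p, hp⟩ := exists_polynomial_near_of_continuousOn 0 T v hv.continuousOn δ hδ
  refine ⟨p.natDegree, fun N hN => ?_⟩
  rw [Real.dist_0_eq_abs, abs_of_nonneg (integral_nonneg fun t => sq_nonneg _)]
  refine ((integral_sub_jacobiExpansion_sq_le hα hT hv N hN).trans ?_).trans_lt hδε
  have hle : ∀ᵐ t ∂(jacobiMeasure T (-α) 0), (v t - p.eval t) ^ 2 ≤ δ ^ 2 := by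
    refine (jacobiMeasure_absolutelyContinuous _ _).ae_le
      ((ae_restrict_iff' measurableSet_Ioo).2 (.of_forall fun t ht => ?_))
    have := hp t (Ioo_subset_Icc_self ht)
    rw [abs_sub_comm] at this
    exact sq_le_sq' (by linarith [(abs_lt.1 this).1]) (abs_lt.1 this).2.le
  refine (integral_mono_ae (integrable_jacobiMeasure hα hT (by fun_prop))
    (integrable_const _) hle).trans ?_
  rw [integral_const, smul_eq_mul, mul_comm]

lemma integral_sub_jacobiExpansion_sq (hα : α < 1) (hT : 0 < T) {v : ℝ → ℝ} (hv : Continuous v)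
    (N : ℕ) :
    ∫ t, (v t - jacobiExpansion α T N v t) ^ 2 ∂(jacobiMeasure T (-α) 0) =
      ∫ t, v t ^ 2 ∂(jacobiMeasure T (-α) 0) -
      ∑ k ∈ Finset.range (N + 1), jacobiCoeff T (-α) 0 v k ^ 2 * jacobiNormSq T (-α) 0 k := by
  simp only [jacobiExpansion]
  rw [integral_sub_sum_jacobiPoly_sq hα hT hv, sub_eq_add_neg, ← Finset.sum_neg_distrib]
  congr 1
  exact Finset.sum_congr rfl fun k _ => by ring

/-- Parseval's inequality for the tail of the Jacobi expansion. -/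
lemma integral_sub_jacobiExpansion_sq_le_of_tail (hα : α < 1) (hT : 0 < T) {v : ℝ → ℝ}
    (hv : Continuous v) (M : ℕ) {B : ℝ}
    (hB : ∀ N, ∑ k ∈ Finset.Ico (M + 1) (N + 1),
      jacobiCoeff T (-α) 0 v k ^ 2 * jacobiNormSq T (-α) 0 k ≤ B) :
    ∫ t, (v t - jacobiExpansion α T M v t) ^ 2 ∂(jacobiMeasure T (-α) 0) ≤ B := by
  -- For `N ≥ M` the error at `M` is the error at `N` plus a partial sum bounded by `B`; the former
  -- tends to `0`.
  have h := (tendsto_integral_sub_jacobiExpansion_sq hα hT hv).add_const B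
  rw [zero_add] at h
  refine ge_of_tendsto h (Filter.eventually_atTop.2 ⟨M, fun N hN => ?_⟩)
  have := hB N
  rw [Finset.sum_Ico_eq_sub _ (by omega : M + 1 ≤ N + 1)] at this
  rw [integral_sub_jacobiExpansion_sq hα hT hv, integral_sub_jacobiExpansion_sq hα hT hv]
  linarith

end

noncomputable section

open Set Filter Topology

/-! ### The spectral density of the Mittag-Leffler relaxation -/

/-- The density `K` with `E_{α,1}(-λ t^α) = ∫_0^∞ K(r) e^{-rt} dr`. -/
def relaxKernel (α lam r : ℝ) : ℝ :=
  Real.sin (α * Real.pi) / Real.pi *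
    (lam * r ^ (α - 1) / ((r ^ α) ^ 2 + 2 * lam * r ^ α * Real.cos (α * Real.pi) + lam ^ 2))

/-- `φ(w) = e^{αw} / (e^{αw} + λ)`. -/
def relaxSymbol (α lam : ℝ) (w : ℂ) : ℂ :=
  Complex.exp (α * w) / (Complex.exp (α * w) + lam)

/-- `(φ(w) - φ(L)) / (e^w - e^L)`, extended to `w = L`. -/
def relaxQuotient (α lam L : ℝ) (w : ℂ) : ℂ :=
  dslope (relaxSymbol α lam) L w / dslope Complex.exp L w

variable {α lam : ℝ}

lemma sin_mul_pi_pos (hα₀ : 0 < α) (hα₁ : α < 1) : 0 < Real.sin (α * Real.pi) :=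
  Real.sin_pos_of_pos_of_lt_pi (by positivity) (by nlinarith [Real.pi_pos])

/-- Since `α < 1`, the argument `α Im w` stays strictly between `-π` and `π`, so `e^{αw}` never
meets the negative real axis. Hence `relaxSymbol` has no pole in the closed strip. -/
lemma exp_mul_add_ne_zero (hα₀ : 0 < α) (hα₁ : α < 1) (hl : 0 < lam) {w : ℂ}
    (hw : |w.im| ≤ Real.pi) : Complex.exp (α * w) + lam ≠ 0 := by
  intro h
  have hw' := abs_le.1 hw
  have hre := congrArg Complex.re h
  have him := congrArg Complex.im h
  simp only [Complex.add_re, Complex.add_im, Complex.exp_re, Complex.exp_im, Complex.ofReal_re,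
    Complex.ofReal_im, Complex.mul_re, Complex.mul_im, zero_mul, sub_zero, add_zero,
    Complex.zero_re, Complex.zero_im] at hre him
  have hE := Real.exp_pos (α * w.re)
  have hs : Real.sin (α * w.im) = 0 := by
    rcases mul_eq_zero.1 him with h | h
    · exact absurd h hE.ne'
    · exact h
  have hz : α * w.im = 0 := (Real.sin_eq_zero_iff_of_lt_of_lt
    (by nlinarith [Real.pi_pos]) (by nlinarith [Real.pi_pos])).1 hs
  rw [hz, Real.cos_zero] at hre
  linarith

/-- The other preimages of `e^L` have imaginary part at least `2π` in absolute value. So `L` is the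
only zero of the denominator of `relaxQuotient` in the strip, and subtracting `φ(L)` in the
numerator makes it removable. -/
lemma exp_sub_exp_ne_zero {L : ℝ} {w : ℂ} (hw : |w.im| ≤ Real.pi) (hL : w ≠ L) :
    Complex.exp w - Complex.exp L ≠ 0 := by
  intro h
  obtain ⟨n, hn⟩ := Complex.exp_eq_exp_iff_exists_int.1 (sub_eq_zero.1 h)
  have him := congrArg Complex.im hn
  simp at him
  rw [him] at hw
  have hn0 : n = 0 := by
    by_contra hne
    have h1 : (1 : ℝ) ≤ |(n : ℝ)| := by exact_mod_cast Int.one_le_abs hne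
    rw [abs_mul, abs_of_pos (by positivity : (0 : ℝ) < 2 * Real.pi)] at hw
    nlinarith [Real.pi_pos]
  subst hn0
  simp at hn
  exact hL hn

lemma differentiableAt_relaxSymbol (hα₀ : 0 < α) (hα₁ : α < 1) (hl : 0 < lam) {w : ℂ}
    (hw : |w.im| ≤ Real.pi) : DifferentiableAt ℂ (relaxSymbol α lam) w := by
  unfold relaxSymbol
  exact DifferentiableAt.div (by fun_prop) (by fun_prop) (exp_mul_add_ne_zero hα₀ hα₁ hl hw)

lemma dslope_exp_ne_zero {L : ℝ} {w : ℂ} (hw : |w.im| ≤ Real.pi) :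
    dslope Complex.exp L w ≠ 0 := by
  rcases eq_or_ne w L with rfl | h
  · simp [dslope_same, Complex.exp_ne_zero]
  · rw [dslope_of_ne _ h, slope_def_field]
    exact div_ne_zero (exp_sub_exp_ne_zero hw h) (sub_ne_zero.2 h)

lemma relaxQuotient_of_ne {L : ℝ} {w : ℂ} (h : w ≠ L) : relaxQuotient α lam L w =
    (relaxSymbol α lam w - relaxSymbol α lam L) / (Complex.exp w - Complex.exp L) := by
  rw [relaxQuotient, dslope_of_ne _ h, dslope_of_ne _ h, slope_def_field, slope_def_field,
    div_div_div_cancel_right₀ (sub_ne_zero.2 h)]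

lemma continuousAt_relaxQuotient (hα₀ : 0 < α) (hα₁ : α < 1) (hl : 0 < lam) {L : ℝ} {w : ℂ}
    (hw : |w.im| ≤ Real.pi) : ContinuousAt (relaxQuotient α lam L) w := by
  refine ContinuousAt.div ?_ ?_ (dslope_exp_ne_zero hw)
  · rcases eq_or_ne w L with rfl | h
    · exact continuousAt_dslope_same.2 (differentiableAt_relaxSymbol hα₀ hα₁ hl hw)
    · exact (continuousAt_dslope_of_ne h).2
        (differentiableAt_relaxSymbol hα₀ hα₁ hl hw).continuousAt
  · rcases eq_or_ne w L with rfl | h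
    · exact continuousAt_dslope_same.2 (Complex.differentiable_exp _)
    · exact (continuousAt_dslope_of_ne h).2 Complex.continuous_exp.continuousAt

lemma differentiableAt_relaxQuotient (hα₀ : 0 < α) (hα₁ : α < 1) (hl : 0 < lam) {L : ℝ} {w : ℂ}
    (hw : |w.im| ≤ Real.pi) (h : w ≠ L) : DifferentiableAt ℂ (relaxQuotient α lam L) w :=
  DifferentiableAt.div
    ((differentiableAt_dslope_of_ne h).2 (differentiableAt_relaxSymbol hα₀ hα₁ hl hw))
    ((differentiableAt_dslope_of_ne h).2 Complex.differentiableAt_exp) (dslope_exp_ne_zero hw)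

/-- The quadratic form is `|x + λ e^{iαπ}|²`, and `sin(απ) > 0`. -/
lemma relaxKernel_den_pos (hα₀ : 0 < α) (hα₁ : α < 1) (hl : 0 < lam) (x : ℝ) :
    0 < x ^ 2 + 2 * lam * x * Real.cos (α * Real.pi) + lam ^ 2 := by
  have hs := sin_mul_pi_pos hα₀ hα₁
  have := Real.sin_sq_add_cos_sq (α * Real.pi)
  have h : x ^ 2 + 2 * lam * x * Real.cos (α * Real.pi) + lam ^ 2 =
      (x + lam * Real.cos (α * Real.pi)) ^ 2 + (lam * Real.sin (α * Real.pi)) ^ 2 := by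
    linear_combination (-lam ^ 2) * this
  rw [h]
  positivity

lemma relaxKernel_nonneg (hα₀ : 0 < α) (hα₁ : α < 1) (hl : 0 < lam) {r : ℝ} (hr : 0 < r) :
    0 ≤ relaxKernel α lam r := by
  have := sin_mul_pi_pos hα₀ hα₁
  have := relaxKernel_den_pos hα₀ hα₁ hl (r ^ α)
  unfold relaxKernel
  positivity

/-- On both lines `Im w = ±π` one has `e^w = -e^x`. The denominators agree and `φ(L)` cancels, so
only the jump of `φ` across the cut of `r^α` is left; this jump is where the density `K` comes from.
-/
lemma relaxQuotient_sub (hα₀ : 0 < α) (hα₁ : α < 1) (hl : 0 < lam) (L x : ℝ) :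
    relaxQuotient α lam L (x + (-Real.pi : ℝ) * Complex.I) -
      relaxQuotient α lam L (x + Real.pi * Complex.I) =
    2 * Real.pi * Complex.I *
      ((relaxKernel α lam (Real.exp x) * Real.exp x / (Real.exp x + Real.exp L) : ℝ) : ℂ) := by
  have hpi := Real.pi_pos
  have hs := sin_mul_pi_pos hα₀ hα₁
  have him₁ : ((x : ℂ) + (-Real.pi : ℝ) * Complex.I).im = -Real.pi := by simp
  have him₂ : ((x : ℂ) + (Real.pi : ℝ) * Complex.I).im = Real.pi := by simp
  have hne₁ : ((x : ℂ) + (-Real.pi : ℝ) * Complex.I) ≠ L := fun h => by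
    have := congrArg Complex.im h; simp at this; 
  have hne₂ : ((x : ℂ) + (Real.pi : ℝ) * Complex.I) ≠ L := fun h => by
    have := congrArg Complex.im h; simp at this; 
  have hd₁ := exp_mul_add_ne_zero hα₀ hα₁ hl (w := (x : ℂ) + (-Real.pi : ℝ) * Complex.I)
    (by rw [him₁, abs_neg, abs_of_pos hpi])
  have hd₂ := exp_mul_add_ne_zero hα₀ hα₁ hl (w := (x : ℂ) + (Real.pi : ℝ) * Complex.I)
    (by rw [him₂, abs_of_pos hpi])
  have he₁ : Complex.exp ((x : ℂ) + (-Real.pi : ℝ) * Complex.I) = -(Real.exp x : ℝ) := by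
    rw [Complex.exp_add, Complex.ofReal_neg, neg_mul, Complex.exp_neg, Complex.exp_pi_mul_I]
    simp
  have he₂ : Complex.exp ((x : ℂ) + (Real.pi : ℝ) * Complex.I) = -(Real.exp x : ℝ) := by
    rw [Complex.exp_add, Complex.exp_pi_mul_I]; simp
  set a : ℝ := Real.exp (α * x) with ha
  have ha0 : 0 < a := Real.exp_pos _
  have hf₁ : Complex.exp (α * ((x : ℂ) + (-Real.pi : ℝ) * Complex.I)) =
      a * (Real.cos (α * Real.pi) - Real.sin (α * Real.pi) * Complex.I) := by
    rw [mul_add, Complex.exp_add, show (α : ℂ) * ((-Real.pi : ℝ) * Complex.I) =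
      ((-(α * Real.pi) : ℝ) : ℂ) * Complex.I by push_cast; ring, Complex.exp_mul_I,
      ← Complex.ofReal_cos, ← Complex.ofReal_sin, Real.cos_neg, Real.sin_neg]
    push_cast [ha]; ring
  have hf₂ : Complex.exp (α * ((x : ℂ) + (Real.pi : ℝ) * Complex.I)) =
      a * (Real.cos (α * Real.pi) + Real.sin (α * Real.pi) * Complex.I) := by
    rw [mul_add, Complex.exp_add, show (α : ℂ) * ((Real.pi : ℝ) * Complex.I) =
      (((α * Real.pi) : ℝ) : ℂ) * Complex.I by push_cast; ring, Complex.exp_mul_I,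
      ← Complex.ofReal_cos, ← Complex.ofReal_sin]
    push_cast [ha]; ring
  rw [hf₁] at hd₁
  rw [hf₂] at hd₂
  have hE : ((Real.exp x : ℝ) : ℂ) + (Real.exp L : ℝ) ≠ 0 := by
    exact_mod_cast (add_pos (Real.exp_pos x) (Real.exp_pos L)).ne'
  have hden := relaxKernel_den_pos hα₀ hα₁ hl a
  have hden' : ((a : ℂ) ^ 2 + 2 * lam * a * (Real.cos (α * Real.pi) : ℝ) + lam ^ 2) ≠ 0 := by
    exact_mod_cast hden.ne'
  have hxa : Real.exp x ^ α = a := by rw [← Real.exp_mul, mul_comm, ha]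
  have hxa' : Real.exp x ^ (α - 1) * Real.exp x = a := by
    rw [← Real.rpow_add_one (Real.exp_pos x).ne', sub_add_cancel, hxa]
  have hker : relaxKernel α lam (Real.exp x) * Real.exp x =
      Real.sin (α * Real.pi) / Real.pi *
        (lam * a / (a ^ 2 + 2 * lam * a * Real.cos (α * Real.pi) + lam ^ 2)) := by
    rw [relaxKernel, hxa, ← hxa']; ring
  rw [relaxQuotient_of_ne hne₁, relaxQuotient_of_ne hne₂, he₁, he₂, hker, ← Complex.ofReal_exp,
    ← sub_div, sub_sub_sub_cancel_right, relaxSymbol, relaxSymbol, hf₁, hf₂]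
  have hsq : ((Real.sin (α * Real.pi) : ℝ) : ℂ) ^ 2 + (Real.cos (α * Real.pi) : ℝ) ^ 2 = 1 := by
    exact_mod_cast Real.sin_sq_add_cos_sq (α * Real.pi)
  have hprod : ((a : ℂ) * (Real.cos (α * Real.pi) - Real.sin (α * Real.pi) * Complex.I) + lam) *
      ((a : ℂ) * (Real.cos (α * Real.pi) + Real.sin (α * Real.pi) * Complex.I) + lam) =
      (a : ℂ) ^ 2 + 2 * lam * a * (Real.cos (α * Real.pi) : ℝ) + lam ^ 2 := by
    linear_combination (a : ℂ) ^ 2 * hsq -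
      (a : ℂ) ^ 2 * (Real.sin (α * Real.pi) : ℝ) ^ 2 * Complex.I_sq
  have hpiC : (Real.pi : ℂ) ≠ 0 := by exact_mod_cast hpi.ne'
  have hEE : -((Real.exp x : ℝ) : ℂ) - (Real.exp L : ℝ) ≠ 0 := by
    rw [← neg_add']; exact neg_ne_zero.2 hE
  rw [div_sub_div _ _ hd₁ hd₂, hprod, Complex.ofReal_div, Complex.ofReal_add, Complex.ofReal_mul,
    Complex.ofReal_div, Complex.ofReal_div, Complex.ofReal_mul]
  push_cast only [Complex.ofReal_add, Complex.ofReal_mul, Complex.ofReal_pow, Complex.ofReal_ofNat]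
  field_simp
  ring

lemma norm_relaxSymbol_le_two (hl : 0 < lam) {w : ℂ} (hw : 2 * lam ≤ Real.exp (α * w.re)) :
    ‖relaxSymbol α lam w‖ ≤ 2 := by
  have hn : ‖Complex.exp (α * w)‖ = Real.exp (α * w.re) := by simp [Complex.norm_exp]
  have h1 : Real.exp (α * w.re) - lam ≤ ‖Complex.exp (α * w) + lam‖ := by
    have := norm_sub_le_norm_add (Complex.exp (α * w)) (lam : ℂ)
    rwa [hn, Complex.norm_of_nonneg hl.le] at this
  rw [relaxSymbol, norm_div, hn, div_le_iff₀ (by linarith)]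
  linarith

lemma norm_relaxSymbol_le (hl : 0 < lam) {w : ℂ} (hw : 2 * Real.exp (α * w.re) ≤ lam) :
    ‖relaxSymbol α lam w‖ ≤ 2 / lam * Real.exp (α * w.re) := by
  have hn : ‖Complex.exp (α * w)‖ = Real.exp (α * w.re) := by simp [Complex.norm_exp]
  have hE := Real.exp_pos (α * w.re)
  have h1 : lam - Real.exp (α * w.re) ≤ ‖Complex.exp (α * w) + lam‖ := by
    have := norm_sub_le_norm_add (lam : ℂ) (Complex.exp (α * w))
    rwa [hn, Complex.norm_of_nonneg hl.le, add_comm] at this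
  rw [relaxSymbol, norm_div, hn, div_le_iff₀ (by linarith), div_mul_eq_mul_div, div_mul_eq_mul_div,
    le_div_iff₀ hl]
  nlinarith

/-- Far to the right `φ` is bounded while `|e^w - e^L|` tends to infinity. -/
lemma tendsto_integral_relaxQuotient_right (hα₀ : 0 < α) (hl : 0 < lam) (L : ℝ) :
    Tendsto (fun R : ℝ => ∫ y in (-Real.pi)..Real.pi,
      relaxQuotient α lam L ((R : ℂ) + (y : ℝ) * Complex.I)) atTop (𝓝 0) := by
  have hlim : Tendsto (fun R : ℝ => (2 + ‖relaxSymbol α lam L‖) / (Real.exp R - Real.exp L) *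
      |Real.pi - -Real.pi|) atTop (𝓝 0) := by
    rw [← zero_mul (|Real.pi - -Real.pi|)]
    exact (Tendsto.const_div_atTop
      (tendsto_atTop_add_const_right _ _ Real.tendsto_exp_atTop) _).mul_const _
  refine squeeze_zero_norm' ?_ hlim
  have hexp : Tendsto (fun R : ℝ => Real.exp (α * R)) atTop atTop :=
    Real.tendsto_exp_atTop.comp (tendsto_id.const_mul_atTop hα₀)
  filter_upwards [hexp.eventually_ge_atTop (2 * lam), eventually_gt_atTop L] with R hR hRL
  refine intervalIntegral.norm_integral_le_of_norm_le_const fun y _ => ?_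
  have hne : ((R : ℂ) + (y : ℝ) * Complex.I) ≠ L := fun h => by
    have := congrArg Complex.re h; simp at this; exact hRL.ne' this
  have hE : Real.exp L < Real.exp R := Real.exp_lt_exp.2 hRL
  rw [relaxQuotient_of_ne hne, norm_div]
  have h1 : Real.exp R - Real.exp L ≤
      ‖Complex.exp ((R : ℂ) + (y : ℝ) * Complex.I) - Complex.exp L‖ := by
    have := norm_sub_norm_le (Complex.exp ((R : ℂ) + (y : ℝ) * Complex.I)) (Complex.exp L)
    simpa [Complex.norm_exp] using this
  have h2 : ‖relaxSymbol α lam (R + (y : ℝ) * Complex.I) - relaxSymbol α lam L‖ ≤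
      2 + ‖relaxSymbol α lam L‖ := (norm_sub_le _ _).trans (by
    gcongr; exact norm_relaxSymbol_le_two hl (by simpa using hR))
  exact div_le_div₀ (by positivity) h2 (by linarith) h1

/-- Far to the left both `φ(w)` and `e^w` tend to `0`, so the quotient converges uniformly to `φ(L)
/ e^L` on a segment of length `2π`. This end of the contour produces the value of the Stieltjes
transform. -/
lemma tendsto_integral_relaxQuotient_left (hα₀ : 0 < α) (hα₁ : α < 1) (hl : 0 < lam) (L : ℝ) :
    Tendsto (fun R : ℝ => ∫ y in (-Real.pi)..Real.pi,
      relaxQuotient α lam L (((-R : ℝ) : ℂ) + (y : ℝ) * Complex.I)) atTop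
      (𝓝 (2 * Real.pi * (relaxSymbol α lam L / Complex.exp L))) := by
  set F := ‖relaxSymbol α lam L‖ with hF
  set p := Real.exp L with hp
  have hp0 : 0 < p := Real.exp_pos _
  have hpC : Complex.exp L = (p : ℂ) := by simp [hp]
  have hpC0 : (p : ℂ) ≠ 0 := by exact_mod_cast hp0.ne'
  have hexpR : Tendsto (fun R : ℝ => Real.exp (-R)) atTop (𝓝 0) := Real.tendsto_exp_neg_atTop_nhds_zero
  have hexp : Tendsto (fun R : ℝ => Real.exp (α * -R)) atTop (𝓝 0) := by
    have := Real.tendsto_exp_neg_atTop_nhds_zero.comp (tendsto_id.const_mul_atTop hα₀)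
    refine this.congr fun R => ?_
    simp
  have hlim : Tendsto (fun R : ℝ => (p * (2 / lam * Real.exp (α * -R)) + F * Real.exp (-R)) /
      (p * (p / 2)) * |Real.pi - -Real.pi|) atTop (𝓝 0) := by
    have := (((hexp.const_mul (2 / lam)).const_mul p).add (hexpR.const_mul F)).div_const
      (p * (p / 2)) |>.mul_const |Real.pi - -Real.pi|
    simpa using this
  rw [tendsto_iff_norm_sub_tendsto_zero]
  refine squeeze_zero' (.of_forall fun _ => norm_nonneg _) ?_ hlim
  filter_upwards [hexp.eventually_le_const (u := lam / 2) (by positivity),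
    hexpR.eventually_le_const (u := p / 2) (by positivity), eventually_gt_atTop (-L)]
    with R hR1 hR2 hRL
  have hconst : (2 * Real.pi * (relaxSymbol α lam L / Complex.exp L) : ℂ) =
      ∫ y in (-Real.pi)..Real.pi, relaxSymbol α lam L / Complex.exp L := by
    rw [intervalIntegral.integral_const, Complex.real_smul]; push_cast; ring
  rw [hconst, ← intervalIntegral.integral_sub _ (by simp)]
  · refine intervalIntegral.norm_integral_le_of_norm_le_const fun y _ => ?_
    set w := ((-R : ℝ) : ℂ) + (y : ℝ) * Complex.I with hw
    have hne : w ≠ L := fun h => by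
      have := congrArg Complex.re h; simp [hw] at this; linarith
    have hwn : ‖Complex.exp w‖ = Real.exp (-R) := by simp [hw, Complex.norm_exp]
    have h1 : p / 2 ≤ ‖Complex.exp w - p‖ := by
      have := norm_sub_norm_le (p : ℂ) (Complex.exp w)
      rw [norm_sub_rev, hwn, Complex.norm_of_nonneg hp0.le] at this
      linarith
    have hwp : Complex.exp w - p ≠ 0 := by
      rw [← norm_pos_iff]; linarith
    have hS : ‖relaxSymbol α lam w‖ ≤ 2 / lam * Real.exp (α * -R) := by
      have := norm_relaxSymbol_le (α := α) hl (w := w) (by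
        have hre : w.re = -R := by simp [hw]
        rw [hre]; linarith)
      simpa [hw] using this
    have heq : relaxQuotient α lam L w - relaxSymbol α lam L / Complex.exp L =
        (p * relaxSymbol α lam w - relaxSymbol α lam L * Complex.exp w) /
          (p * (Complex.exp w - p)) := by
      rw [relaxQuotient_of_ne hne, hpC]
      field_simp
      ring
    rw [heq, norm_div, norm_mul, Complex.norm_of_nonneg hp0.le]
    gcongr
    refine (norm_sub_le _ _).trans ?_
    rw [norm_mul, norm_mul, hwn, Complex.norm_of_nonneg hp0.le]
    gcongr
  · refine ContinuousOn.intervalIntegrable fun y hy => ContinuousAt.continuousWithinAt ?_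
    rw [uIcc_of_le (by linarith [Real.pi_pos])] at hy
    exact ContinuousAt.comp (g := relaxQuotient α lam L)
      (continuousAt_relaxQuotient hα₀ hα₁ hl (by simpa using abs_le.2 ⟨hy.1, hy.2⟩)) (by fun_prop)

/-- Cauchy's theorem on the rectangle `|Re w| ≤ R`, `|Im w| ≤ π`. The point `L` is admitted as an
exceptional point at which continuity suffices. -/
lemma integral_relaxQuotient_rect (hα₀ : 0 < α) (hα₁ : α < 1) (hl : 0 < lam) (L R : ℝ) :
    2 * Real.pi * ((∫ x in (-R)..R, relaxKernel α lam (Real.exp x) * Real.exp x /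
        (Real.exp x + Real.exp L) : ℝ) : ℂ) =
      (∫ y in (-Real.pi)..Real.pi, relaxQuotient α lam L (((-R : ℝ) : ℂ) + (y : ℝ) * Complex.I)) -
      ∫ y in (-Real.pi)..Real.pi, relaxQuotient α lam L ((R : ℂ) + (y : ℝ) * Complex.I) := by
  have hpi := Real.pi_pos
  have hcont : ∀ w : ℂ, |w.im| ≤ Real.pi → ContinuousAt (relaxQuotient α lam L) w :=
    fun w hw => continuousAt_relaxQuotient hα₀ hα₁ hl hw
  have h := Complex.integral_boundary_rect_eq_zero_of_differentiable_on_off_countable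
    (relaxQuotient α lam L) (⟨-R, -Real.pi⟩ : ℂ) (⟨R, Real.pi⟩ : ℂ) {(L : ℂ)}
    (countable_singleton _)
    (fun w hw => (hcont w (by
      have := hw.2
      simp only [mem_preimage] at this
      rw [uIcc_of_le (by linarith)] at this
      exact abs_le.2 ⟨this.1, this.2⟩)).continuousWithinAt)
    (fun w hw => differentiableAt_relaxQuotient hα₀ hα₁ hl (by
      have := hw.1.2
      simp only [mem_preimage] at this
      rw [min_eq_left (by linarith), max_eq_right (by linarith)] at this
      exact abs_le.2 ⟨this.1.le, this.2.le⟩) hw.2)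
  simp only at h
  have hhor : ∀ s : ℝ, |s| ≤ Real.pi → IntervalIntegrable
      (fun x : ℝ => relaxQuotient α lam L ((x : ℂ) + (s : ℝ) * Complex.I)) volume (-R) R := by
    intro s hs
    refine Continuous.intervalIntegrable (continuous_iff_continuousAt.2 fun x => ?_) _ _
    exact ContinuousAt.comp (g := relaxQuotient α lam L) (hcont _ (by simpa using hs))
      (by fun_prop)
  rw [← intervalIntegral.integral_sub (hhor _ (by rw [abs_neg, abs_of_pos hpi]))
    (hhor _ (by rw [abs_of_pos hpi]))] at h
  simp_rw [relaxQuotient_sub hα₀ hα₁ hl, intervalIntegral.integral_const_mul,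
    intervalIntegral.integral_ofReal, smul_eq_mul] at h
  have hI := Complex.I_mul_I
  linear_combination (-Complex.I) * h + (2 * Real.pi * ((∫ x in (-R)..R,
    relaxKernel α lam (Real.exp x) * Real.exp x / (Real.exp x + Real.exp L) : ℝ) : ℂ) +
    (∫ y in (-Real.pi)..Real.pi, relaxQuotient α lam L ((R : ℂ) + (y : ℝ) * Complex.I)) -
    (∫ y in (-Real.pi)..Real.pi, relaxQuotient α lam L (((-R : ℝ) : ℂ) + (y : ℝ) * Complex.I)))
     * hI

lemma lintegral_Ioi_exp (f : ℝ → ℝ≥0∞) :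
    ∫⁻ r in Ioi 0, f r = ∫⁻ x : ℝ, ENNReal.ofReal (Real.exp x) * f (Real.exp x) := by
  have := lintegral_image_eq_lintegral_abs_deriv_mul (s := univ) MeasurableSet.univ
    (f := Real.exp) (f' := Real.exp) (fun x _ => (Real.hasDerivAt_exp x).hasDerivWithinAt)
    Real.exp_injective.injOn f
  simpa [image_univ, Real.range_exp] using this

/-- The Stieltjes transform of the spectral density. -/
lemma lintegral_relaxKernel_div (hα₀ : 0 < α) (hα₁ : α < 1) (hl : 0 < lam) {p : ℝ} (hp : 0 < p) :
    ∫⁻ r in Ioi 0, ENNReal.ofReal (relaxKernel α lam r / (r + p)) =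
      ENNReal.ofReal (p ^ (α - 1) / (p ^ α + lam)) := by
  set L := Real.log p with hL
  have hpL : Real.exp L = p := Real.exp_log hp
  set g : ℝ → ℝ := fun x => relaxKernel α lam (Real.exp x) * Real.exp x /
    (Real.exp x + Real.exp L) with hg
  have hg0 : ∀ x, 0 ≤ g x := fun x => by
    have := relaxKernel_nonneg hα₀ hα₁ hl (Real.exp_pos x); positivity
  have hgc : Continuous g := by
    have hk : Continuous fun x => relaxKernel α lam (Real.exp x) := by
      unfold relaxKernel
      refine Continuous.mul continuous_const (Continuous.div ?_ ?_
        fun x => (relaxKernel_den_pos hα₀ hα₁ hl _).ne')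
      · exact continuous_const.mul (Real.continuous_exp.rpow_const fun x => Or.inl (Real.exp_pos x).ne')
      · have : Continuous fun x => Real.exp x ^ α :=
          Real.continuous_exp.rpow_const fun x => Or.inl (Real.exp_pos x).ne'
        fun_prop
    exact (hk.mul Real.continuous_exp).div (by fun_prop)
      fun x => (add_pos (Real.exp_pos x) (Real.exp_pos L)).ne'
  have hval : relaxSymbol α lam L / Complex.exp L = ((p ^ (α - 1) / (p ^ α + lam) : ℝ) : ℂ) := by
    have h1 : Complex.exp (α * L) = ((p ^ α : ℝ) : ℂ) := by
      rw [Real.rpow_def_of_pos hp, mul_comm]; push_cast; rfl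
    rw [relaxSymbol, h1, ← Complex.ofReal_exp, hpL, Real.rpow_sub_one hp.ne']
    push_cast
    field_simp
  have hlim : Tendsto (fun R : ℝ => ∫ x in (-R)..R, g x) atTop
      (𝓝 (p ^ (α - 1) / (p ^ α + lam))) := by
    have h := (tendsto_integral_relaxQuotient_left hα₀ hα₁ hl L).sub
      (tendsto_integral_relaxQuotient_right hα₀ hl L)
    simp_rw [← integral_relaxQuotient_rect hα₀ hα₁ hl L, sub_zero, hval] at h
    have hpi : (2 * Real.pi : ℂ) ≠ 0 := by
      exact_mod_cast (by positivity : (2 * Real.pi : ℝ) ≠ 0)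
    have h2 := h.const_mul (2 * Real.pi : ℂ)⁻¹
    simp_rw [inv_mul_cancel_left₀ hpi] at h2
    exact_mod_cast (Complex.continuous_re.tendsto _).comp h2
  -- As `g ≥ 0`, convergence of its integrals over `[-R, R]` already gives integrability.
  have hint : Integrable g := by
    refine integrable_of_intervalIntegral_norm_tendsto _ (a := fun R : ℝ => -R) (b := fun R => R)
      (l := atTop) (fun R => (hgc.intervalIntegrable _ _).1) tendsto_neg_atTop_atBot tendsto_id
      (hlim.congr fun R => ?_)
    simp_rw [Real.norm_of_nonneg (hg0 _)]
  have hI : ∫ x, g x = p ^ (α - 1) / (p ^ α + lam) :=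
    tendsto_nhds_unique (intervalIntegral_tendsto_integral hint tendsto_neg_atTop_atBot tendsto_id)
      hlim
  rw [lintegral_Ioi_exp, ← hI, ofReal_integral_eq_lintegral_ofReal hint (.of_forall hg0)]
  refine lintegral_congr fun x => ?_
  rw [← ENNReal.ofReal_mul (Real.exp_pos x).le, hg, hpL]
  congr 1
  ring

end

/-! ### Uniqueness for Laplace transforms. -/

noncomputable section

open Set Filter Topology ProbabilityTheory

/-- Injectivity of the Laplace transform on nonnegative functions. -/
lemma ae_eq_of_laplace_eq {ν : Measure ℝ} [SigmaFinite ν] {F G : ℝ → ℝ≥0∞} (hF : Measurable F) (hG : Measurable G)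
    (h : ∀ p : ℝ, ∫⁻ t, F t * ENNReal.ofReal (Real.exp (-(p * t))) ∂ν =
      ∫⁻ t, G t * ENNReal.ofReal (Real.exp (-(p * t))) ∂ν)
    {c : ℝ} (hc : ∀ p, c < p → ∫⁻ t, F t * ENNReal.ofReal (Real.exp (-(p * t))) ∂ν ≠ ⊤) :
    F =ᵐ[ν] G := by
  -- Tilting by `c + 1` puts `0` inside the domain of finiteness, which becomes at least `s < 1`.
  -- The tilted measures are then finite with a moment generating function near `0`.
  set w : ℝ → ℝ≥0∞ := fun t => ENNReal.ofReal (Real.exp (-((c + 1) * t))) with hw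
  have hwm : Measurable w := by fun_prop
  set μ₁ := ν.withDensity (F * w) with hμ₁
  set μ₂ := ν.withDensity (G * w) with hμ₂
  have key : ∀ (H : ℝ → ℝ≥0∞), Measurable H → ∀ s : ℝ,
      ∫⁻ t, ENNReal.ofReal (Real.exp (s * t)) ∂(ν.withDensity (H * w)) =
        ∫⁻ t, H t * ENNReal.ofReal (Real.exp (-((c + 1 - s) * t))) ∂ν := by
    intro H hH s
    rw [lintegral_withDensity_eq_lintegral_mul _ (hH.mul hwm) (by fun_prop)]
    refine lintegral_congr fun t => ?_
    simp only [Pi.mul_apply, hw]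
    rw [mul_assoc, ← ENNReal.ofReal_mul (Real.exp_pos _).le, ← Real.exp_add]
    ring_nf
  have hmgf : ∀ μ : Measure ℝ, ∀ s : ℝ,
      mgf id μ s = (∫⁻ t, ENNReal.ofReal (Real.exp (s * t)) ∂μ).toReal := by
    intro μ s
    rw [mgf, integral_eq_lintegral_of_nonneg_ae (.of_forall fun t => (Real.exp_pos _).le)
      (by fun_prop)]
    rfl
  have hmeq : mgf id μ₁ = mgf id μ₂ := by
    ext s
    rw [hmgf, hmgf, key F hF, key G hG, h]
  have hfin : ∀ s < 1, ∫⁻ t, ENNReal.ofReal (Real.exp (s * t)) ∂μ₁ ≠ ⊤ := by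
    intro s hs
    rw [key F hF]
    exact hc _ (by linarith)
  have huniv : ∀ μ : Measure ℝ, μ univ = ∫⁻ t, ENNReal.ofReal (Real.exp (0 * t)) ∂μ := by
    intro μ; simp
  have hmass : μ₁ univ = μ₂ univ := by
    rw [huniv, huniv, key F hF, key G hG, h]
  have hf₁ : IsFiniteMeasure μ₁ := ⟨by
    rw [huniv]; exact (hfin 0 one_pos).lt_top⟩
  have hf₂ : IsFiniteMeasure μ₂ := ⟨by rw [← hmass]; exact measure_lt_top _ _⟩
  have h0 : (0 : ℝ) ∈ interior (integrableExpSet id μ₁) := by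
    rw [mem_interior]
    refine ⟨Iio 1, fun s hs => ?_, isOpen_Iio, zero_lt_one' ℝ⟩
    refine ⟨by fun_prop, ?_⟩
    rw [hasFiniteIntegral_iff_ofReal (.of_forall fun t => (Real.exp_pos _).le)]
    exact (hfin s hs).lt_top
  -- Equality of the moment generating functions extends analytically to a vertical strip around
  -- `0`, and on the imaginary axis it is equality of characteristic functions.
  have hE := eqOn_complexMGF_of_mgf' hmeq (by
    rw [← Measure.measure_univ_eq_zero, ← Measure.measure_univ_eq_zero, hmass])
  have hμ : μ₁ = μ₂ := by
    refine Measure.ext_of_charFun (funext fun t => ?_)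
    rw [← complexMGF_id_mul_I, ← complexMGF_id_mul_I]
    exact hE (by simpa using h0)
  have := (withDensity_eq_iff_of_sigmaFinite (hF.mul hwm).aemeasurable
    (hG.mul hwm).aemeasurable).1 hμ
  filter_upwards [this] with t ht
  simp only [Pi.mul_apply, hw] at ht
  exact (ENNReal.mul_left_inj (by simp [Real.exp_pos]) ENNReal.ofReal_ne_top).1 ht

/-! ### The Mittag-Leffler function as a Laplace transform -/

variable {α lam : ℝ}

/-- The absolute value of the `n`-th term of `E_{α,1}(-λ t^α)`. -/
def relaxTerm (α lam : ℝ) (n : ℕ) (t : ℝ) : ℝ := lam ^ n * t ^ (α * n) / Real.Gamma (α * n + 1)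

lemma relaxTerm_nonneg (hα₀ : 0 < α) (hl : 0 < lam) (n : ℕ) {t : ℝ} (ht : 0 < t) :
    0 ≤ relaxTerm α lam n t := by
  have := Real.Gamma_pos_of_pos (show 0 < α * n + 1 by positivity)
  unfold relaxTerm; positivity

lemma lintegral_relaxTerm (hα₀ : 0 < α) (hl : 0 < lam) (n : ℕ) {p : ℝ} (hp : 0 < p) :
    ∫⁻ t in Ioi 0, ENNReal.ofReal (relaxTerm α lam n t) * ENNReal.ofReal (Real.exp (-(p * t))) =
      ENNReal.ofReal p⁻¹ * ENNReal.ofReal (lam / p ^ α) ^ n := by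
  have hG := Real.Gamma_pos_of_pos (show 0 < α * n + 1 by positivity)
  have h := lintegral_Gamma (a := α * n + 1) (by positivity) hp
  have e : ∀ t ∈ Ioi (0 : ℝ), ENNReal.ofReal (relaxTerm α lam n t) *
      ENNReal.ofReal (Real.exp (-(p * t))) = ENNReal.ofReal (lam ^ n / Real.Gamma (α * n + 1)) *
        ENNReal.ofReal (t ^ (α * n + 1 - 1) * Real.exp (-(p * t))) := by
    intro t (ht : 0 < t)
    rw [← ENNReal.ofReal_mul (relaxTerm_nonneg hα₀ hl n ht), ← ENNReal.ofReal_mul (by positivity),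
      relaxTerm, add_sub_cancel_right]
    congr 1; ring
  rw [setLIntegral_congr_fun measurableSet_Ioi e, lintegral_const_mul' _ _ ENNReal.ofReal_ne_top, h,
    ← ENNReal.ofReal_mul (by positivity), ← ENNReal.ofReal_pow (by positivity),
    ← ENNReal.ofReal_mul (by positivity)]
  congr 1
  rw [Real.rpow_add (by positivity), Real.rpow_one, Real.rpow_mul (by positivity), Real.rpow_natCast,
    Real.div_rpow zero_le_one hp.le, Real.one_rpow, div_pow, div_pow, one_pow]
  field_simp

/-- `∫_0^∞ K(r) e^{-rt} dr`. -/
def relaxLaplace (α lam t : ℝ) : ℝ≥0∞ :=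
  ∫⁻ r in Ioi 0, ENNReal.ofReal (relaxKernel α lam r) * ENNReal.ofReal (Real.exp (-(r * t)))

lemma measurable_relaxKernel : Measurable (relaxKernel α lam) := by
  unfold relaxKernel; fun_prop

lemma measurable_relaxLaplace : Measurable (relaxLaplace α lam) := by
  refine Measurable.lintegral_prod_right' (f := fun q : ℝ × ℝ =>
    ENNReal.ofReal (relaxKernel α lam q.2) * ENNReal.ofReal (Real.exp (-(q.2 * q.1)))) ?_
  have := measurable_relaxKernel (α := α) (lam := lam)
  fun_prop

lemma lintegral_exp_Ioi {p : ℝ} (hp : 0 < p) :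
    ∫⁻ t in Ioi (0 : ℝ), ENNReal.ofReal (Real.exp (-(p * t))) = ENNReal.ofReal p⁻¹ := by
  have := lintegral_Gamma one_pos hp
  simpa using this

/-- By Tonelli, the Laplace transform of a Laplace transform is a Stieltjes transform. -/
lemma lintegral_relaxLaplace (hα₀ : 0 < α) (hα₁ : α < 1) (hl : 0 < lam) {p : ℝ} (hp : 0 < p) :
    ∫⁻ t in Ioi 0, relaxLaplace α lam t * ENNReal.ofReal (Real.exp (-(p * t))) =
      ENNReal.ofReal (p⁻¹ * (1 + lam / p ^ α)⁻¹) := by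
  have hm := measurable_relaxKernel (α := α) (lam := lam)
  simp_rw [relaxLaplace]
  simp_rw [← lintegral_mul_const' _ _ ENNReal.ofReal_ne_top]
  rw [lintegral_lintegral_swap (by fun_prop)]
  have e : ∀ r ∈ Ioi (0 : ℝ), ∫⁻ t in Ioi 0, ENNReal.ofReal (relaxKernel α lam r) *
      ENNReal.ofReal (Real.exp (-(r * t))) * ENNReal.ofReal (Real.exp (-(p * t))) =
      ENNReal.ofReal (relaxKernel α lam r / (r + p)) := by
    intro r (hr : 0 < r)
    simp_rw [mul_assoc]
    rw [lintegral_const_mul' _ _ ENNReal.ofReal_ne_top]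
    have : ∀ t : ℝ, ENNReal.ofReal (Real.exp (-(r * t))) * ENNReal.ofReal (Real.exp (-(p * t))) =
        ENNReal.ofReal (Real.exp (-((r + p) * t))) := by
      intro t
      rw [← ENNReal.ofReal_mul (Real.exp_pos _).le, ← Real.exp_add]; ring_nf
    simp_rw [this]
    rw [lintegral_exp_Ioi (by linarith), ← ENNReal.ofReal_mul (relaxKernel_nonneg hα₀ hα₁ hl hr),
      div_eq_mul_inv]
  rw [setLIntegral_congr_fun measurableSet_Ioi e, lintegral_relaxKernel_div hα₀ hα₁ hl hp]
  congr 1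
  rw [Real.rpow_sub_one hp.ne']
  have := Real.rpow_pos_of_pos hp α
  field_simp

/-- The alternating series cannot be handled termwise in `ℝ≥0∞`, so the odd terms are moved to the
other side. With `x = λ p^{-α}` the transforms are geometric series, and the claim becomes `1/(1+x)
+ x/(1-x²) = 1/(1-x²)`, up to the factor `p⁻¹`. -/
lemma relax_even_odd (hα₀ : 0 < α) (hα₁ : α < 1) (hl : 0 < lam) :
    (fun t => relaxLaplace α lam t + ∑' n : ℕ, ENNReal.ofReal (relaxTerm α lam (2 * n + 1) t))
      =ᵐ[volume.restrict (Ioi 0)] (fun t => ∑' n : ℕ, ENNReal.ofReal (relaxTerm α lam (2 * n) t)) ∧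
    ∀ᵐ t ∂(volume.restrict (Ioi 0)),
      ∑' n : ℕ, ENNReal.ofReal (relaxTerm α lam (2 * n) t) ≠ ⊤ := by
  have hm : ∀ n, Measurable (relaxTerm α lam n) := fun n => by unfold relaxTerm; fun_prop
  have hZ := measurable_relaxLaplace (α := α) (lam := lam)
  have hsum : ∀ (f : ℕ → ℕ) (p : ℝ), ∫⁻ t in Ioi 0,
      (∑' n : ℕ, ENNReal.ofReal (relaxTerm α lam (f n) t)) * ENNReal.ofReal (Real.exp (-(p * t))) =
      ∑' n : ℕ, ∫⁻ t in Ioi 0, ENNReal.ofReal (relaxTerm α lam (f n) t) *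
        ENNReal.ofReal (Real.exp (-(p * t))) := by
    intro f p
    simp_rw [← ENNReal.tsum_mul_right]
    exact lintegral_tsum fun n => by have := hm (f n); fun_prop
  -- `ae_eq_of_laplace_eq` wants equality for every real `p`; for `p ≤ 0` both sides are infinite,
  -- already by their first terms.
  have htop : ∀ (f : ℕ → ℕ) (p : ℝ), p ≤ 0 → ∫⁻ t in Ioi 0,
      (∑' n : ℕ, ENNReal.ofReal (relaxTerm α lam (f n) t)) *
        ENNReal.ofReal (Real.exp (-(p * t))) = ⊤ := by
    intro f p hp
    have hG := Real.Gamma_pos_of_pos (show 0 < α * (f 0 : ℕ) + 1 by positivity)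
    rw [eq_top_iff]
    calc (⊤ : ℝ≥0∞) = ∫⁻ t in Ioi (1 : ℝ),
          ENNReal.ofReal (lam ^ (f 0) / Real.Gamma (α * (f 0 : ℕ) + 1)) := by
          rw [lintegral_const, Measure.restrict_apply MeasurableSet.univ, univ_inter,
            Real.volume_Ioi, ENNReal.mul_top]
          simp; positivity
      _ ≤ ∫⁻ t in Ioi (1 : ℝ), (∑' n : ℕ, ENNReal.ofReal (relaxTerm α lam (f n) t)) *
            ENNReal.ofReal (Real.exp (-(p * t))) := by
          refine setLIntegral_mono' measurableSet_Ioi fun t (ht : 1 < t) => ?_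
          rw [← mul_one (ENNReal.ofReal (lam ^ _ / _))]
          refine mul_le_mul' ((ENNReal.ofReal_le_ofReal ?_).trans
            (ENNReal.le_tsum (f := fun n => ENNReal.ofReal (relaxTerm α lam (f n) t)) 0)) ?_
          · rw [relaxTerm]
            gcongr
            exact le_mul_of_one_le_right (by positivity)
              (Real.one_le_rpow ht.le (by positivity))
          · rw [ENNReal.one_le_ofReal]
            exact Real.one_le_exp (by nlinarith)
      _ ≤ _ := lintegral_mono_set (Ioi_subset_Ioi zero_le_one)
  have heven : ∀ p : ℝ, 0 < p → ∫⁻ t in Ioi 0,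
      (∑' n : ℕ, ENNReal.ofReal (relaxTerm α lam (2 * n) t)) * ENNReal.ofReal (Real.exp (-(p * t)))
      = ENNReal.ofReal p⁻¹ * (1 - ENNReal.ofReal (lam / p ^ α) ^ 2)⁻¹ := by
    intro p hp
    rw [hsum (fun n => 2 * n)]
    simp_rw [lintegral_relaxTerm hα₀ hl _ hp, pow_mul]
    rw [ENNReal.tsum_mul_left, ENNReal.tsum_geometric]
  have hodd : ∀ p : ℝ, 0 < p → ∫⁻ t in Ioi 0,
      (∑' n : ℕ, ENNReal.ofReal (relaxTerm α lam (2 * n + 1) t)) *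
        ENNReal.ofReal (Real.exp (-(p * t))) =
      ENNReal.ofReal p⁻¹ * ((1 - ENNReal.ofReal (lam / p ^ α) ^ 2)⁻¹ *
        ENNReal.ofReal (lam / p ^ α)) := by
    intro p hp
    rw [hsum (fun n => 2 * n + 1)]
    simp_rw [lintegral_relaxTerm hα₀ hl _ hp, pow_succ _ (2 * _), pow_mul]
    rw [ENNReal.tsum_mul_left, ENNReal.tsum_mul_right, ENNReal.tsum_geometric]
  have hgeom : ∀ x : ℝ, 0 < x → x < 1 → (1 - ENNReal.ofReal x ^ 2)⁻¹ =
      ENNReal.ofReal (1 - x ^ 2)⁻¹ := by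
    intro x hx hx1
    rw [ENNReal.ofReal_inv_of_pos (by nlinarith), ENNReal.ofReal_sub _ (by positivity),
      ENNReal.ofReal_one, ENNReal.ofReal_pow hx.le]
  have hEm : Measurable fun t => ∑' n : ℕ, ENNReal.ofReal (relaxTerm α lam (2 * n) t) :=
    Measurable.tsum fun n => by have := hm (2 * n); fun_prop
  have hOm : Measurable fun t => ∑' n : ℕ, ENNReal.ofReal (relaxTerm α lam (2 * n + 1) t) :=
    Measurable.tsum fun n => by have := hm (2 * n + 1); fun_prop
  have hfin : ∀ p : ℝ, lam ^ (1 / α) < p → ∫⁻ t in Ioi 0,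
      (∑' n : ℕ, ENNReal.ofReal (relaxTerm α lam (2 * n) t)) *
        ENNReal.ofReal (Real.exp (-(p * t))) ≠ ⊤ := by
    intro p hp
    have hp0 : 0 < p := (Real.rpow_pos_of_pos hl _).trans hp
    have hx1 : lam / p ^ α < 1 := by
      rw [div_lt_one (by positivity)]
      calc lam = (lam ^ (1 / α)) ^ α := by
            rw [← Real.rpow_mul hl.le, one_div_mul_cancel hα₀.ne', Real.rpow_one]
        _ < p ^ α := by gcongr
    rw [heven p hp0, hgeom _ (by positivity) hx1]
    exact ENNReal.mul_ne_top ENNReal.ofReal_ne_top ENNReal.ofReal_ne_top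
  refine ⟨(ae_eq_of_laplace_eq hEm (hZ.add hOm) ?_ hfin).symm, ?_⟩
  · intro p
    simp_rw [Pi.add_apply, add_mul]
    rw [lintegral_add_left (by fun_prop)]
    rcases le_or_gt p 0 with hp | hp
    · rw [htop (fun n => 2 * n) p hp, htop (fun n => 2 * n + 1) p hp, add_top]
    · rw [heven p hp, hodd p hp, lintegral_relaxLaplace hα₀ hα₁ hl hp]
      have hx : 0 < lam / p ^ α := by positivity
      set x := lam / p ^ α
      rcases lt_or_ge x 1 with hx1 | hx1
      · have h1 : 0 < 1 - x ^ 2 := by nlinarith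
        rw [hgeom x hx hx1, ← ENNReal.ofReal_mul (by positivity), ← ENNReal.ofReal_mul (by positivity),
          ← ENNReal.ofReal_mul (by positivity), ← ENNReal.ofReal_add (by positivity) (by positivity)]
        congr 1
        field_simp
        ring
      -- For `x ≥ 1` both geometric series diverge and the identity reads `⊤ = ⊤`.
      · have h1 : (1 - ENNReal.ofReal x ^ 2)⁻¹ = ⊤ := by
          rw [ENNReal.inv_eq_top, tsub_eq_zero_iff_le]
          exact one_le_pow₀ (ENNReal.one_le_ofReal.2 hx1)
        have h2 : ENNReal.ofReal p⁻¹ ≠ 0 := by simpa using hp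
        have h3 : ENNReal.ofReal x ≠ 0 := by simpa using hx
        rw [h1, ENNReal.top_mul h3, ENNReal.mul_top h2, add_top]
  · filter_upwards [ae_lt_top (by fun_prop) (hfin _ (lt_add_one _))] with t ht htop
    rw [htop, ENNReal.top_mul (by simp [Real.exp_pos])] at ht
    exact ht.ne rfl

lemma mittagLeffler_ae_eq (hα₀ : 0 < α) (hα₁ : α < 1) (hl : 0 < lam) :
    ∀ᵐ t ∂(volume.restrict (Ioi 0)),
      mittagLeffler α 1 (-lam * t ^ α) = (relaxLaplace α lam t).toReal := by
  obtain ⟨h, hfin⟩ := relax_even_odd hα₀ hα₁ hl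
  filter_upwards [h, hfin, ae_restrict_mem measurableSet_Ioi] with t h1 h2 (ht : 0 < t)
  have hO : ∑' n : ℕ, ENNReal.ofReal (relaxTerm α lam (2 * n + 1) t) ≠ ⊤ :=
    ne_top_of_le_ne_top h2 (h1 ▸ le_add_self)
  have hterm : ∀ n : ℕ, (-lam * t ^ α) ^ n / Real.Gamma (α * n + 1) =
      (-1) ^ n * relaxTerm α lam n t := by
    intro n
    rw [relaxTerm, neg_mul, neg_pow, mul_pow, Real.rpow_mul ht.le, Real.rpow_natCast]
    ring
  have hsum : ∀ f : ℕ → ℕ, ∑' n : ℕ, ENNReal.ofReal (relaxTerm α lam (f n) t) ≠ ⊤ →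
      Summable (fun n => relaxTerm α lam (f n) t) ∧
      (∑' n : ℕ, ENNReal.ofReal (relaxTerm α lam (f n) t)).toReal =
        ∑' n, relaxTerm α lam (f n) t := by
    intro f hf
    have h0 := fun n => relaxTerm_nonneg hα₀ hl (f n) ht
    refine ⟨?_, ?_⟩
    · have := ENNReal.summable_toReal hf
      exact this.congr fun n => ENNReal.toReal_ofReal (h0 n)
    · rw [ENNReal.tsum_toReal_eq fun _ => ENNReal.ofReal_ne_top]
      exact tsum_congr fun n => ENNReal.toReal_ofReal (h0 n)
  obtain ⟨sE, tE⟩ := hsum (fun n => 2 * n) h2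
  obtain ⟨sO, tO⟩ := hsum (fun n => 2 * n + 1) hO
  have e1 : ∀ n : ℕ, (-1 : ℝ) ^ (2 * n) * relaxTerm α lam (2 * n) t = relaxTerm α lam (2 * n) t := by
    intro n; rw [pow_mul]; simp
  have e2 : ∀ n : ℕ, (-1 : ℝ) ^ (2 * n + 1) * relaxTerm α lam (2 * n + 1) t =
      -relaxTerm α lam (2 * n + 1) t := by
    intro n; rw [pow_succ, pow_mul]; simp
  rw [mittagLeffler]
  simp_rw [hterm]
  rw [← tsum_even_add_odd (by simpa only [e1] using sE) (by simpa only [e2] using sO.neg)]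
  simp_rw [e1, e2]
  rw [tsum_neg, ← tE, ← tO, ← h1, ENNReal.toReal_add
    (ne_top_of_le_ne_top h2 (h1 ▸ le_self_add)) hO]
  ring

end

/-! ### Kernel bounds and the pairing of the relaxation function with Jacobi polynomials. -/

noncomputable section

open Set Filter Topology ProbabilityTheory Polynomial

variable {α lam T : ℝ}

/-- Completing the square in either variable bounds the denominator below by `sin²(απ) r^{2α}` and
by `sin²(απ) λ²`. The exponents are written as `-β - 1` with `β = α` and `β = -α`, the two end
points of the later interpolation. -/
lemma relaxKernel_le (hα₀ : 0 < α) (hα₁ : α < 1) (hl : 0 < lam) {r : ℝ} (hr : 0 < r) :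
    relaxKernel α lam r ≤ (Real.pi * Real.sin (α * Real.pi))⁻¹ * lam * r ^ (-α - 1) ∧
    relaxKernel α lam r ≤ (Real.pi * Real.sin (α * Real.pi))⁻¹ * lam⁻¹ * r ^ (-(-α) - 1) := by
  have hs := sin_mul_pi_pos hα₀ hα₁
  have hpi := Real.pi_pos
  have hD := relaxKernel_den_pos hα₀ hα₁ hl (r ^ α)
  have hx : 0 < r ^ α := by positivity
  have hcs := Real.sin_sq_add_cos_sq (α * Real.pi)
  set s := Real.sin (α * Real.pi)
  set c := Real.cos (α * Real.pi)
  set x := r ^ α with hxdef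
  have h1 : s ^ 2 * x ^ 2 ≤ x ^ 2 + 2 * lam * x * c + lam ^ 2 := by
    nlinarith [sq_nonneg (x * c + lam)]
  have h2 : s ^ 2 * lam ^ 2 ≤ x ^ 2 + 2 * lam * x * c + lam ^ 2 := by
    nlinarith [sq_nonneg (x + lam * c)]
  have e1 : r ^ (α - 1) = x / r := Real.rpow_sub_one hr.ne' α
  have e2 : r ^ (-α - 1) = x⁻¹ / r := by rw [Real.rpow_sub_one hr.ne', Real.rpow_neg hr.le]
  rw [neg_neg, relaxKernel, e1, e2]
  constructor
  · calc s / Real.pi * (lam * (x / r) / (x ^ 2 + 2 * lam * x * c + lam ^ 2))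
        ≤ s / Real.pi * (lam * (x / r) / (s ^ 2 * x ^ 2)) := by gcongr
      _ = _ := by field_simp
  · calc s / Real.pi * (lam * (x / r) / (x ^ 2 + 2 * lam * x * c + lam ^ 2))
        ≤ s / Real.pi * (lam * (x / r) / (s ^ 2 * lam ^ 2)) := by gcongr
      _ = _ := by field_simp

lemma integrableOn_relaxKernel (hα₀ : 0 < α) (hα₁ : α < 1) (hl : 0 < lam) :
    IntegrableOn (relaxKernel α lam) (Ioi 0) := by
  have hm := measurable_relaxKernel (α := α) (lam := lam)
  rw [← Ioc_union_Ioi_eq_Ioi zero_le_one, integrableOn_union]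
  constructor
  · have : IntegrableOn (fun r : ℝ => (Real.pi * Real.sin (α * Real.pi))⁻¹ * lam⁻¹ *
        r ^ (-(-α) - 1)) (Ioc 0 1) := by
      rw [integrableOn_Ioc_iff_integrableOn_Ioo]
      exact ((intervalIntegral.integrableOn_Ioo_rpow_iff zero_lt_one).2 (by linarith)).const_mul _
    refine Integrable.mono' this hm.aestronglyMeasurable
      ((ae_restrict_iff' measurableSet_Ioc).2 (.of_forall fun r hr => ?_))
    rw [Real.norm_of_nonneg (relaxKernel_nonneg hα₀ hα₁ hl hr.1)]
    exact (relaxKernel_le hα₀ hα₁ hl hr.1).2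
  · have : IntegrableOn (fun r : ℝ => (Real.pi * Real.sin (α * Real.pi))⁻¹ * lam *
        r ^ (-α - 1)) (Ioi 1) :=
      (integrableOn_Ioi_rpow_of_lt (by linarith) zero_lt_one).const_mul _
    refine Integrable.mono' this hm.aestronglyMeasurable
      ((ae_restrict_iff' measurableSet_Ioi).2 (.of_forall fun r (hr : 1 < r) => ?_))
    rw [Real.norm_of_nonneg (relaxKernel_nonneg hα₀ hα₁ hl (by linarith))]
    exact (relaxKernel_le hα₀ hα₁ hl (by linarith)).1

/-- `∫_0^∞ K(r) e^{-r|t|} dr`, a continuous function equal to `E_{α,1}(-λ t^α)` for `t > 0`. -/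
def relaxCont (α lam t : ℝ) : ℝ := ∫ r in Ioi 0, relaxKernel α lam r * Real.exp (-(r * |t|))

lemma continuous_relaxCont (hα₀ : 0 < α) (hα₁ : α < 1) (hl : 0 < lam) :
    Continuous (relaxCont α lam) := by
  have hm := measurable_relaxKernel (α := α) (lam := lam)
  refine continuous_of_dominated (bound := relaxKernel α lam)
    (fun t => (by fun_prop : Measurable _).aestronglyMeasurable) (fun t => ?_)
    (integrableOn_relaxKernel hα₀ hα₁ hl) (.of_forall fun r => by fun_prop)
  refine (ae_restrict_iff' measurableSet_Ioi).2 (.of_forall fun r (hr : 0 < r) => ?_)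
  have h0 := relaxKernel_nonneg hα₀ hα₁ hl hr
  rw [Real.norm_of_nonneg (by positivity)]
  refine mul_le_of_le_one_right h0 (Real.exp_le_one_iff.2 ?_)
  have := abs_nonneg t
  nlinarith

/-- Uniqueness of Laplace transforms gives equality only almost everywhere. This suffices, because
the coefficients and both norms do not see null sets. -/
lemma relaxation_ae_eq (hα₀ : 0 < α) (hα₁ : α < 1) (hl : 0 < lam) (y₀ : ℝ) :
    ∀ᵐ t ∂(volume.restrict (Ioo 0 T)), relaxation α lam y₀ t = y₀ * relaxCont α lam t := by
  have hm := measurable_relaxKernel (α := α) (lam := lam)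
  filter_upwards [ae_restrict_of_ae_restrict_of_subset Ioo_subset_Ioi_self
    (mittagLeffler_ae_eq hα₀ hα₁ hl), ae_restrict_mem measurableSet_Ioo] with t ht ht0
  rw [relaxation, ht, relaxCont, integral_eq_lintegral_of_nonneg_ae _
    (by fun_prop : Measurable _).aestronglyMeasurable, relaxLaplace]
  · congr 2
    refine setLIntegral_congr_fun measurableSet_Ioi fun r (hr : 0 < r) => ?_
    rw [← ENNReal.ofReal_mul (relaxKernel_nonneg hα₀ hα₁ hl hr), abs_of_pos ht0.1]
  · refine (ae_restrict_iff' measurableSet_Ioi).2 (.of_forall fun r (hr : 0 < r) => ?_)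
    have h0 := relaxKernel_nonneg hα₀ hα₁ hl hr
    simp only [Pi.zero_apply]; positivity

lemma iteratedDeriv_exp_neg_mul (r : ℝ) (k : ℕ) :
    iteratedDeriv k (fun t : ℝ => Real.exp (-(r * t))) =
      fun t => (-r) ^ k * Real.exp (-(r * t)) := by
  induction k with
  | zero => simp
  | succ k ih =>
    rw [iteratedDeriv_succ, ih]
    ext t
    have : HasDerivAt (fun t : ℝ => (-r) ^ k * Real.exp (-(r * t)))
        ((-r) ^ k * (Real.exp (-(r * t)) * (-(r * 1)))) t :=
      ((((hasDerivAt_id t).const_mul r).neg).exp).const_mul _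
    rw [this.deriv]; ring

lemma enorm_integral_exp_mul_jacobiPoly_le (hα₁ : α < 1) (hT : 0 < T) {r : ℝ} (hr : 0 < r)
    (k : ℕ) :
    ‖∫ t in Ioo 0 T, Real.exp (-(r * |t|)) * (jacobiPoly α T k).eval t * (T - t) ^ (-α)‖ₑ ≤
      ENNReal.ofReal (1 / (T ^ k * k.factorial)) * ∫⁻ t in Ioo 0 T,
        ENNReal.ofReal (r ^ k * Real.exp (-(r * t)) * ((T - t) ^ (k - α) * t ^ (k : ℝ))) := by
  have h1 : ∫ t in Ioo 0 T, Real.exp (-(r * |t|)) * (jacobiPoly α T k).eval t * (T - t) ^ (-α) =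
      ∫ t in Ioo 0 T, Real.exp (-(r * t)) * (jacobiPoly α T k).eval t * (T - t) ^ (-α) :=
    setIntegral_congr_fun measurableSet_Ioo fun t ht => by simp only [abs_of_pos ht.1]
  rw [h1, integral_mul_jacobiPoly hα₁ hT (by fun_prop), iteratedDeriv_exp_neg_mul, enorm_mul,
    Real.enorm_of_nonneg (by positivity)]
  gcongr
  refine (enorm_integral_le_lintegral_enorm _).trans (lintegral_mono_ae ?_)
  refine (ae_restrict_iff' measurableSet_Ioo).2 (.of_forall fun t ht => ?_)
  have h0 := ht.1
  have h2 : 0 < T - t := sub_pos.2 ht.2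
  rw [Real.enorm_eq_ofReal_abs, abs_mul, abs_mul, abs_pow, abs_neg, abs_of_pos hr,
    abs_of_pos (Real.exp_pos _), abs_of_pos (by positivity : 0 < (T - t) ^ (k - α) * t ^ (k : ℝ))]

/-- After `k` integrations by parts the `r`-integral of `r^{k-β-1} e^{-rt}` is `Γ(k-β) t^{β-k}`,
convergent since `β < 1 ≤ k`. The factor `t^k` then cancels `t^{-k}`, and `t^β (T-t)^{k-α}` is a
Beta integrand since `β > -1`. -/
lemma abs_integral_relaxCont_mul_jacobiPoly_le (hα₀ : 0 < α) (hα₁ : α < 1) (hl : 0 < lam)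
    (hT : 0 < T) {A β : ℝ} (hA : 0 ≤ A) (hβ : -1 < β) (hβ' : β < 1)
    (hK : ∀ r, 0 < r → relaxKernel α lam r ≤ A * r ^ (-β - 1)) {k : ℕ} (hk : 1 ≤ k) :
    |∫ t in Ioo 0 T, relaxCont α lam t * (jacobiPoly α T k).eval t * (T - t) ^ (-α)| ≤
      A * T ^ (β + 1 - α) * (Real.Gamma (k - β) / k.factorial * beta (β + 1) (k - α + 1)) := by
  have hk1 : (1 : ℝ) ≤ k := by exact_mod_cast hk
  have hm := measurable_relaxKernel (α := α) (lam := lam)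
  have hB := beta_pos (show 0 < β + 1 by linarith) (show 0 < (k : ℝ) - α + 1 by linarith)
  have hG := Real.Gamma_pos_of_pos (show 0 < (k : ℝ) - β by linarith)
  have hswap : ∫ t in Ioo 0 T, relaxCont α lam t * (jacobiPoly α T k).eval t * (T - t) ^ (-α) =
      ∫ r in Ioi 0, relaxKernel α lam r *
        ∫ t in Ioo 0 T, Real.exp (-(r * |t|)) * (jacobiPoly α T k).eval t * (T - t) ^ (-α) := by
    simp_rw [relaxCont, mul_assoc, ← integral_mul_const, ← integral_const_mul]
    rw [integral_integral_swap]
    · simp_rw [mul_assoc]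
    -- The exponential is at most `1`, so a product of integrable functions of `t` and `r`
    -- dominates.
    · have hg : IntegrableOn (fun t => (jacobiPoly α T k).eval t * (T - t) ^ (-α)) (Ioo 0 T) := by
        have h := integrableOn_beta (a := 1) (b := 1 - α) hT one_pos (by linarith)
        refine (h.continuousOn_mul_of_subset (g := fun t => (jacobiPoly α T k).eval t)
          (jacobiPoly α T k).continuous.continuousOn isCompact_Icc measurableSet_Ioo
          Ioo_subset_Icc_self).congr_fun (fun t _ => ?_) measurableSet_Ioo
        simp only [sub_self, Real.rpow_zero, one_mul]
        ring_nf
      have hp := hg.mul_prod (integrableOn_relaxKernel hα₀ hα₁ hl)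
      refine hp.mono (by
        have := (jacobiPoly α T k).continuous.measurable
        refine Measurable.aestronglyMeasurable ?_
        unfold Function.uncurry
        fun_prop) ?_
      rw [Measure.prod_restrict]
      refine (ae_restrict_iff' (measurableSet_Ioo.prod measurableSet_Ioi)).2
        (.of_forall fun q hq => ?_)
      have hq2 : 0 < q.2 := hq.2
      simp only [Function.uncurry, norm_mul]
      have : ‖Real.exp (-(q.2 * |q.1|))‖ ≤ 1 := by
        rw [Real.norm_of_nonneg (Real.exp_pos _).le, Real.exp_le_one_iff]
        have := abs_nonneg q.1
        nlinarith
      calc _ = ‖Real.exp (-(q.2 * |q.1|))‖ * (‖(jacobiPoly α T k).eval q.1‖ *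
            ‖(T - q.1) ^ (-α)‖ * ‖relaxKernel α lam q.2‖) := by ring
        _ ≤ _ := mul_le_of_le_one_left (by positivity) this
  have hfin : ENNReal.ofReal |∫ t in Ioo 0 T,
      relaxCont α lam t * (jacobiPoly α T k).eval t * (T - t) ^ (-α)| ≤
      ENNReal.ofReal (A * T ^ (β + 1 - α) *
        (Real.Gamma (k - β) / k.factorial * beta (β + 1) (k - α + 1))) := by
    rw [← Real.enorm_eq_ofReal_abs, hswap]
    calc _ ≤ ∫⁻ r in Ioi 0, ‖relaxKernel α lam r * ∫ t in Ioo 0 T,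
          Real.exp (-(r * |t|)) * (jacobiPoly α T k).eval t * (T - t) ^ (-α)‖ₑ :=
          enorm_integral_le_lintegral_enorm _
      _ ≤ ∫⁻ r in Ioi 0, ∫⁻ t in Ioo 0 T, ENNReal.ofReal (A / (T ^ k * k.factorial)) *
          (ENNReal.ofReal (r ^ (k - β - 1) * Real.exp (-(t * r))) *
            ENNReal.ofReal ((T - t) ^ (k - α) * t ^ (k : ℝ))) := by
          refine setLIntegral_mono' measurableSet_Ioi fun r (hr : 0 < r) => ?_
          have h0 := relaxKernel_nonneg hα₀ hα₁ hl hr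
          rw [enorm_mul, Real.enorm_of_nonneg h0]
          refine (mul_le_mul' (ENNReal.ofReal_le_ofReal (hK r hr))
            (enorm_integral_exp_mul_jacobiPoly_le hα₁ hT hr k)).trans ?_
          rw [← mul_assoc, ← ENNReal.ofReal_mul (by positivity),
            ← lintegral_const_mul' _ _ ENNReal.ofReal_ne_top]
          refine (setLIntegral_congr_fun measurableSet_Ioo fun t ht => ?_).le
          have h1 := ht.1
          have h2 : 0 < T - t := sub_pos.2 ht.2
          rw [← ENNReal.ofReal_mul (by positivity), ← ENNReal.ofReal_mul (by positivity),
            ← ENNReal.ofReal_mul (by positivity)]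
          congr 1
          have e : r ^ (k - β - 1) = r ^ (-β - 1) * r ^ k := by
            rw [← Real.rpow_natCast, ← Real.rpow_add hr]; ring_nf
          rw [e, mul_comm t r]
          ring
      _ = ∫⁻ t in Ioo 0 T, ∫⁻ r in Ioi 0, ENNReal.ofReal (A / (T ^ k * k.factorial)) *
          (ENNReal.ofReal (r ^ (k - β - 1) * Real.exp (-(t * r))) *
            ENNReal.ofReal ((T - t) ^ (k - α) * t ^ (k : ℝ))) :=
          lintegral_lintegral_swap (by fun_prop)
      _ = ∫⁻ t in Ioo 0 T, ENNReal.ofReal (A / (T ^ k * k.factorial) * Real.Gamma (k - β)) *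
            ENNReal.ofReal (t ^ (β + 1 - 1) * (T - t) ^ (k - α + 1 - 1)) := by
          refine setLIntegral_congr_fun measurableSet_Ioo fun t ht => ?_
          have h1 := ht.1
          have h2 : 0 < T - t := sub_pos.2 ht.2
          rw [lintegral_const_mul' _ _ ENNReal.ofReal_ne_top,
            lintegral_mul_const' _ _ ENNReal.ofReal_ne_top, lintegral_Gamma (by linarith) h1,
            ← ENNReal.ofReal_mul (by positivity), ← ENNReal.ofReal_mul (by positivity),
            ← ENNReal.ofReal_mul (by positivity)]
          congr 1
          have e : t ^ (β + 1 - 1) = (1 / t) ^ (k - β) * t ^ (k : ℝ) := by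
            rw [one_div, Real.inv_rpow h1.le, ← Real.rpow_neg h1.le, ← Real.rpow_add h1]; ring_nf
          rw [e, add_sub_cancel_right]
          ring
      _ = _ := by
          rw [lintegral_const_mul' _ _ ENNReal.ofReal_ne_top,
            lintegral_beta hT (by linarith) (by linarith), ← ENNReal.ofReal_mul (by positivity)]
          congr 1
          rw [show β + 1 + (k - α + 1) - 1 = (β + 1 - α) + k by ring, Real.rpow_add hT,
            Real.rpow_natCast]
          field_simp
  exact (ENNReal.ofReal_le_ofReal_iff (by positivity)).1 hfin

end

/-! ### Decay of the Jacobi coefficients. -/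

noncomputable section

open Set Filter Topology ProbabilityTheory Polynomial

variable {α lam T : ℝ}

lemma Gamma_natCast_eq {k : ℕ} (hk : 1 ≤ k) : (k.factorial : ℝ) = k * Real.Gamma k := by
  rw [← Real.Gamma_nat_eq_factorial, Real.Gamma_add_one (by positivity)]

/-- Each of the two factors is `O(k^{-α-1})` by `Gamma_add_le`. The shift from `k - α` to `k` costs
`1/(1-α)`, since `k(1-α) ≤ k-α` for `k ≥ 1`. -/
lemma gamma_ratio_pos_le (hα₀ : 0 < α) (hα₁ : α < 1) {k : ℕ} (hk : 1 ≤ k) :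
    Real.Gamma (k - α) / k.factorial * beta (α + 1) (k - α + 1) ≤
      Real.Gamma (α + 1) / (1 - α) * (k : ℝ) ^ (-2 * α - 2) := by
  have hk1 : (1 : ℝ) ≤ k := by exact_mod_cast hk
  have hk0 : (0 : ℝ) < k := by linarith
  have hG := Real.Gamma_pos_of_pos hk0
  have hGa := Real.Gamma_pos_of_pos (show 0 < α + 1 by linarith)
  have hGka := Real.Gamma_pos_of_pos (show 0 < (k : ℝ) - α by linarith)
  have h1 : Real.Gamma (k - α + 1) ≤ (k : ℝ) ^ (1 - α) * Real.Gamma k := by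
    have := Gamma_add_le hk0 (show 0 < 1 - α by linarith) (by linarith)
    rwa [show (k : ℝ) - α + 1 = k + (1 - α) by ring]
  have h2 : Real.Gamma (k - α) / k.factorial ≤ (k : ℝ) ^ (-α - 1) / (1 - α) := by
    have e : Real.Gamma (k - α + 1) = (k - α) * Real.Gamma (k - α) :=
      Real.Gamma_add_one (by linarith)
    rw [Gamma_natCast_eq hk, div_le_div_iff₀ (by positivity) (by linarith)]
    have hle : (k : ℝ) * (1 - α) ≤ k - α := by nlinarith
    have hp : (k : ℝ) ^ (1 - α) = (k : ℝ) ^ (-α - 1) * (k * k) := by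
      rw [show 1 - α = (-α - 1) + 1 + 1 by ring, Real.rpow_add_one hk0.ne',
        Real.rpow_add_one hk0.ne']; ring
    rw [e, hp] at h1
    have : (k : ℝ) * (1 - α) * Real.Gamma (k - α) ≤ (k : ℝ) ^ (-α - 1) * (k * k) * Real.Gamma k :=
      (mul_le_mul_of_nonneg_right hle hGka.le).trans h1
    have h3 : (k : ℝ) * (Real.Gamma (k - α) * (1 - α)) ≤
        k * ((k : ℝ) ^ (-α - 1) * (k * Real.Gamma k)) := by linarith
    exact le_of_mul_le_mul_left h3 hk0
  have h3 : beta (α + 1) (k - α + 1) ≤ Real.Gamma (α + 1) * (k : ℝ) ^ (-α - 1) := by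
    rw [beta, show α + 1 + (k - α + 1) = (k : ℝ) + 1 + 1 by ring,
      Real.Gamma_add_one (s := (k : ℝ) + 1) (by positivity), Real.Gamma_add_one hk0.ne',
      mul_div_assoc]
    refine mul_le_mul_of_nonneg_left ?_ hGa.le
    rw [div_le_iff₀ (by positivity)]
    refine h1.trans ?_
    rw [show 1 - α = (-α - 1) + 1 + 1 by ring, Real.rpow_add_one hk0.ne',
      Real.rpow_add_one hk0.ne']
    have : 0 < (k : ℝ) ^ (-α - 1) * k * Real.Gamma k := by positivity
    nlinarith
  calc _ ≤ (k : ℝ) ^ (-α - 1) / (1 - α) * (Real.Gamma (α + 1) * (k : ℝ) ^ (-α - 1)) :=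
        mul_le_mul h2 h3 (beta_pos (by linarith) (by linarith)).le
          (div_nonneg (by positivity) (by linarith))
    _ = _ := by
        rw [show -2 * α - 2 = (-α - 1) + (-α - 1) by ring, Real.rpow_add hk0]; ring

/-- The counterpart at `β = -α`: each factor is `O(k^{α-1})`. -/
lemma gamma_ratio_neg_le (hα₀ : 0 < α) (hα₁ : α < 1) {k : ℕ} (hk : 1 ≤ k) :
    Real.Gamma (k - (-α)) / k.factorial * beta (-α + 1) (k - α + 1) ≤
      3 * Real.Gamma (1 - α) * (k : ℝ) ^ (-2 * -α - 2) := by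
  have hk1 : (1 : ℝ) ≤ k := by exact_mod_cast hk
  have hk0 : (0 : ℝ) < k := by linarith
  have hG := Real.Gamma_pos_of_pos hk0
  have hGa := Real.Gamma_pos_of_pos (show 0 < 1 - α by linarith)
  have h2 : Real.Gamma (k - (-α)) / k.factorial ≤ (k : ℝ) ^ (α - 1) := by
    rw [Gamma_natCast_eq hk, div_le_iff₀ (by positivity), sub_neg_eq_add, ← mul_assoc,
      ← Real.rpow_add_one hk0.ne', sub_add_cancel]
    exact Gamma_add_le hk0 hα₀ hα₁
  have h3 : beta (-α + 1) (k - α + 1) ≤ 3 * Real.Gamma (1 - α) * (k : ℝ) ^ (α - 1) := by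
    have hx : 0 < (k : ℝ) - α + 1 := by linarith
    have hGx := Real.Gamma_pos_of_pos (show 0 < (k : ℝ) - α + 1 + (1 - α) by linarith)
    have h := Gamma_le_Gamma_add hx (show 0 < 1 - α by linarith) (by linarith)
    rw [sub_sub_cancel] at h
    have hb : ((k : ℝ) - α + 1 + (1 - α)) ^ α / (k - α + 1) ≤ 3 * (k : ℝ) ^ (α - 1) := by
      calc ((k : ℝ) - α + 1 + (1 - α)) ^ α / (k - α + 1) ≤ (3 * k) ^ α / k := by
            gcongr <;> linarith
        _ = 3 ^ α * (k : ℝ) ^ (α - 1) := by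
            rw [Real.mul_rpow (by norm_num) hk0.le, Real.rpow_sub_one hk0.ne']; ring
        _ ≤ 3 * (k : ℝ) ^ (α - 1) := by
            gcongr
            calc (3 : ℝ) ^ α ≤ 3 ^ (1 : ℝ) :=
                  Real.rpow_le_rpow_of_exponent_le (by norm_num) hα₁.le
              _ = 3 := Real.rpow_one _
    rw [beta, show -α + 1 = 1 - α by ring, show 1 - α + (k - α + 1) = (k : ℝ) - α + 1 + (1 - α) by ring,
      div_le_iff₀ hGx]
    calc Real.Gamma (1 - α) * Real.Gamma (k - α + 1) ≤ Real.Gamma (1 - α) *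
          (3 * (k : ℝ) ^ (α - 1) * Real.Gamma (k - α + 1 + (1 - α))) := by
            gcongr; exact h.trans (by gcongr)
      _ = _ := by ring
  calc _ ≤ (k : ℝ) ^ (α - 1) * (3 * Real.Gamma (1 - α) * (k : ℝ) ^ (α - 1)) :=
        mul_le_mul h2 h3 (beta_pos (by linarith) (by linarith)).le (by positivity)
    _ = _ := by
        rw [show -2 * -α - 2 = (α - 1) + (α - 1) by ring, Real.rpow_add hk0]; ring

lemma abs_jacobiCoeff_relaxCont_le_of_kernel_le (hα₀ : 0 < α) (hα₁ : α < 1) (hl : 0 < lam)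
    (hT : 0 < T) {A B β : ℝ} (hA : 0 ≤ A) (hB : 0 ≤ B) (hβ : -1 < β) (hβ' : β < 1)
    (hK : ∀ r, 0 < r → relaxKernel α lam r ≤ A * r ^ (-β - 1)) {k : ℕ} (hk : 1 ≤ k)
    (hG : Real.Gamma (k - β) / k.factorial * beta (β + 1) (k - α + 1) ≤
      B * (k : ℝ) ^ (-2 * β - 2)) :
    |jacobiCoeff T (-α) 0 (relaxCont α lam) k| ≤
      3 * A * B * T ^ β * (k : ℝ) ^ (-2 * β - 1) := by
  have hk1 : (1 : ℝ) ≤ k := by exact_mod_cast hk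
  have hk0 : (0 : ℝ) < k := by linarith
  have h := abs_integral_relaxCont_mul_jacobiPoly_le hα₀ hα₁ hl hT hA hβ hβ' hK hk
  rw [jacobiCoeff_eq, jacobiNormSq_eq hα₁, abs_div,
    abs_of_pos (div_pos (Real.rpow_pos_of_pos hT _) (by linarith) :
      0 < T ^ (1 - α) / (2 * (k : ℝ) + 1 - α)), div_le_iff₀ (div_pos (by positivity) (by linarith))]
  refine h.trans ((mul_le_mul_of_nonneg_left hG (by positivity)).trans ?_)
  rw [mul_div_assoc', le_div_iff₀ (by linarith)]
  have e1 : T ^ (β + 1 - α) = T ^ β * T ^ (1 - α) := by rw [← Real.rpow_add hT]; ring_nf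
  have e2 : (k : ℝ) ^ (-2 * β - 1) = (k : ℝ) ^ (-2 * β - 2) * k := by
    rw [← Real.rpow_add_one hk0.ne']; ring_nf
  rw [e1, e2]
  have : 0 ≤ A * (T ^ β * T ^ (1 - α)) * (B * (k : ℝ) ^ (-2 * β - 2)) := by positivity
  calc _ ≤ A * (T ^ β * T ^ (1 - α)) * (B * (k : ℝ) ^ (-2 * β - 2)) * (3 * k) := by
        gcongr; linarith
    _ = _ := by ring

/-- The decay of the Jacobi coefficients of `E_{α,1}(-λ t^α)`. -/
lemma exists_abs_jacobiCoeff_relaxCont_le (hα₀ : 0 < α) (hα₁ : α < 1) (hT : 0 < T) :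
    ∃ C : ℝ, 0 < C ∧ ∀ lam : ℝ, 0 < lam → ∀ k : ℕ, 1 ≤ k → ∀ θ : ℝ, -1 ≤ θ → θ ≤ 1 →
      |jacobiCoeff T (-α) 0 (relaxCont α lam) k| ≤
        C * (lam * T ^ α) ^ θ * (k : ℝ) ^ (-1 - 2 * α * θ) := by
  have hs := sin_mul_pi_pos hα₀ hα₁
  have hpi := Real.pi_pos
  have hGa := Real.Gamma_pos_of_pos (show 0 < α + 1 by linarith)
  have hGb := Real.Gamma_pos_of_pos (show 0 < 1 - α by linarith)
  set κ := (Real.pi * Real.sin (α * Real.pi))⁻¹ with hκ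
  have hκ0 : 0 < κ := by positivity
  set B₁ := Real.Gamma (α + 1) / (1 - α) with hB₁
  have hB₁0 : 0 < B₁ := div_pos hGa (by linarith)
  set B₂ := 3 * Real.Gamma (1 - α) with hB₂
  refine ⟨3 * κ * (B₁ + B₂), by positivity, fun lam hl k hk θ hθ hθ' => ?_⟩
  have hk1 : (1 : ℝ) ≤ k := by exact_mod_cast hk
  have hk0 : (0 : ℝ) < k := by linarith
  have h1 := abs_jacobiCoeff_relaxCont_le_of_kernel_le hα₀ hα₁ hl hT (A := κ * lam) (by positivity)
    hB₁0.le (by linarith) hα₁ (fun r hr => (relaxKernel_le hα₀ hα₁ hl hr).1) hk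
    (gamma_ratio_pos_le hα₀ hα₁ hk)
  have h2 := abs_jacobiCoeff_relaxCont_le_of_kernel_le hα₀ hα₁ hl hT (A := κ * lam⁻¹)
    (B := B₂) (β := -α) (by positivity)
    (by positivity) (by linarith) (by linarith)
    (fun r hr => (relaxKernel_le hα₀ hα₁ hl hr).2) hk (gamma_ratio_neg_le hα₀ hα₁ hk)
  -- The two bounds are constants times `k⁻¹ X` and `k⁻¹ X⁻¹`, and `min(X, X⁻¹) ≤ X^θ` for `-1 ≤ θ ≤
  -- 1`.
  set X := lam * T ^ α * (k : ℝ) ^ (-2 * α) with hX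
  have hX0 : 0 < X := by positivity
  have hgoal : 3 * κ * (B₁ + B₂) * (lam * T ^ α) ^ θ * (k : ℝ) ^ (-1 - 2 * α * θ) =
      3 * κ * (B₁ + B₂) * (k : ℝ)⁻¹ * X ^ θ := by
    rw [hX, Real.mul_rpow (x := lam * T ^ α) (by positivity) (by positivity), ← Real.rpow_mul hk0.le,
      show -1 - 2 * α * θ = -2 * α * θ - 1 by ring, Real.rpow_sub_one hk0.ne']
    ring
  rw [hgoal]
  rcases le_or_gt X 1 with hX1 | hX1
  · have hle : X ≤ X ^ θ := by
      conv_lhs => rw [← Real.rpow_one X]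
      exact Real.rpow_le_rpow_of_exponent_ge hX0 hX1 hθ'
    calc _ ≤ _ := h1
      _ = 3 * κ * B₁ * (k : ℝ)⁻¹ * X := by
          rw [hX, Real.rpow_sub_one hk0.ne']; ring
      _ ≤ _ := by gcongr; linarith [show 0 < B₂ by positivity]
  · have hle : X⁻¹ ≤ X ^ θ := by
      rw [← Real.rpow_neg_one X]
      exact Real.rpow_le_rpow_of_exponent_le hX1.le hθ
    calc _ ≤ _ := h2
      _ = 3 * κ * B₂ * (k : ℝ)⁻¹ * X⁻¹ := by
          rw [hX, Real.rpow_sub_one hk0.ne', mul_inv, mul_inv, ← Real.rpow_neg hT.le,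
            ← Real.rpow_neg hk0.le]
          ring_nf
      _ ≤ _ := by gcongr; linarith

end

noncomputable section

open Set Filter Topology

/-! ### Power sums -/

lemma sum_Ico_rpow_le_integral {s : ℝ} (hs : s ≤ 0) {M N : ℕ} (hM : 1 ≤ M) (hMN : M ≤ N) :
    ∑ k ∈ Finset.Ico (M + 1) (N + 1), (k : ℝ) ^ s ≤ ∫ x in (M : ℝ)..N, x ^ s := by
  have h := AntitoneOn.sum_le_integral_Ico (f := fun x : ℝ => x ^ s) hMN (fun x hx y hy hxy =>
    Real.rpow_le_rpow_of_nonpos ((Nat.cast_pos.2 hM).trans_le hx.1) hxy hs)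
  rwa [Finset.sum_Ico_add' (fun k : ℕ => (k : ℝ) ^ s) M N 1] at h

/-- `∑_{M < k ≤ N} k^{-e-1} ≤ M^{-e} / e`. -/
lemma sum_Ico_rpow_neg_le {e : ℝ} (he : 0 < e) {M : ℕ} (hM : 1 ≤ M) (N : ℕ) :
    ∑ k ∈ Finset.Ico (M + 1) (N + 1), (k : ℝ) ^ (-e - 1) ≤ (M : ℝ) ^ (-e) / e := by
  rcases le_or_gt M N with h | h
  · have hM0 : (0 : ℝ) < M := Nat.cast_pos.2 hM
    have hN0 : (0 : ℝ) < N := Nat.cast_pos.2 (by omega)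
    refine (sum_Ico_rpow_le_integral (by linarith) hM h).trans ?_
    rw [integral_rpow (Or.inr ⟨by linarith, fun h0 => ?_⟩)]
    · rw [sub_add_cancel, div_neg, ← neg_div, neg_sub]
      gcongr
      have : 0 < (N : ℝ) ^ (-e) := by positivity
      linarith
    · rw [uIcc_of_le (by exact_mod_cast h)] at h0
      linarith [h0.1]
  · rw [Finset.Ico_eq_empty (by omega), Finset.sum_empty]
    positivity

/-- `∑_{1 ≤ k ≤ n} k^{f-1} ≤ n^f / f` for `0 < f ≤ 1`. -/
lemma sum_Icc_rpow_le {f : ℝ} (hf : 0 < f) (hf1 : f ≤ 1) {n : ℕ} (hn : 1 ≤ n) :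
    ∑ k ∈ Finset.Ico 1 (n + 1), (k : ℝ) ^ (f - 1) ≤ (n : ℝ) ^ f / f := by
  have h := sum_Ico_rpow_le_integral (s := f - 1) (by linarith) le_rfl hn
  rw [Nat.cast_one, integral_rpow (Or.inl (by linarith)), sub_add_cancel, Real.one_rpow] at h
  rw [Finset.sum_eq_sum_Ico_succ_bot (by omega)]
  have h1 : 1 ≤ 1 / f := (one_le_div hf).2 hf1
  rw [sub_div] at h
  simp only [Nat.cast_one, Real.one_rpow]
  linarith

/-- Tail bound without uniformity in the exponent. -/
lemma sum_tail_le {α σ D Λ θ : ℝ} {a : ℕ → ℝ} {N M : ℕ} (hM : 1 ≤ M)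
    (ha : ∀ k : ℕ, 1 ≤ k → a k ≤ D * Λ ^ (2 * θ) * (k : ℝ) ^ (-3 + 2 * σ - 4 * α * θ))
    (he : 0 < 2 - 2 * σ + 4 * α * θ) (hD : 0 ≤ D) (hΛ : 0 < Λ) :
    ∑ k ∈ Finset.Ico (M + 1) (N + 1), a k ≤
      D / (2 - 2 * σ + 4 * α * θ) * (Λ ^ (2 * θ) * (M : ℝ) ^ (-(2 - 2 * σ + 4 * α * θ))) := by
  calc ∑ k ∈ Finset.Ico (M + 1) (N + 1), a k
      ≤ ∑ k ∈ Finset.Ico (M + 1) (N + 1),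
        D * Λ ^ (2 * θ) * (k : ℝ) ^ (-(2 - 2 * σ + 4 * α * θ) - 1) := by
        refine Finset.sum_le_sum fun k hk => ?_
        have := ha k (by have := (Finset.mem_Ico.1 hk).1; omega)
        rwa [show -(2 - 2 * σ + 4 * α * θ) - 1 = -3 + 2 * σ - 4 * α * θ by ring]
    _ ≤ D * Λ ^ (2 * θ) * ((M : ℝ) ^ (-(2 - 2 * σ + 4 * α * θ)) / (2 - 2 * σ + 4 * α * θ)) := by
        rw [← Finset.mul_sum]
        have := sum_Ico_rpow_neg_le he hM N
        gcongr
    _ = _ := by ring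

/-- A bound independent of `M`, obtained from the whole sum over `k ≥ 1`. It is split at `k ≈
Λ^{1/(2α)}`: the bound with exponent `f - 1 > -1` is summed below, the one with exponent `-3 + 2σ`
above, and both pieces have the size `Λ^{2θ₀}`. -/
lemma sum_all_le {α σ D Λ θ₀ f : ℝ} {a : ℕ → ℝ} {N M : ℕ} (hα : 0 < α) (hσ : σ < 1)
    (hD : 0 ≤ D) (hΛ : 1 < Λ) (hθ₀ : θ₀ = -(1 - σ) / (2 * α)) (hf : 0 < f) (hf1 : f ≤ 1)
    (ha0 : ∀ k, 0 ≤ a k)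
    (ha : ∀ k : ℕ, 1 ≤ k → a k ≤ D * (k : ℝ) ^ (-3 + 2 * σ))
    (ha' : ∀ k : ℕ, 1 ≤ k → a k ≤ D * Λ ^ (2 * θ₀ - f / (2 * α)) * (k : ℝ) ^ (f - 1)) :
    ∑ k ∈ Finset.Ico (M + 1) (N + 1), a k ≤
      D * (1 / f + 2 ^ (2 - 2 * σ) / (2 - 2 * σ)) * Λ ^ (2 * θ₀) := by
  have hΛ0 : 0 < Λ := by linarith
  set K := Λ ^ (1 / (2 * α)) with hK
  have hK1 : 1 < K := Real.one_lt_rpow hΛ (by positivity)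
  set n := ⌊K⌋₊ with hn
  have hn1 : 1 ≤ n := Nat.le_floor (by simpa using hK1.le)
  have hn1' : (1 : ℝ) ≤ n := by exact_mod_cast hn1
  have hnK : (n : ℝ) ≤ K := Nat.floor_le (by linarith)
  have hKn : K ≤ 2 * n := by
    have := Nat.lt_floor_add_one K
    linarith
  have hKf : K ^ f = Λ ^ (f / (2 * α)) := by
    rw [hK, ← Real.rpow_mul hΛ0.le]; ring_nf
  have hKe : K ^ (-(2 - 2 * σ)) = Λ ^ (2 * θ₀) := by
    rw [hK, ← Real.rpow_mul hΛ0.le, hθ₀]; congr 1; field_simp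
  have hlow : ∑ k ∈ Finset.Ico 1 (n + 1), a k ≤ D * (1 / f) * Λ ^ (2 * θ₀) := by
    calc ∑ k ∈ Finset.Ico 1 (n + 1), a k ≤ ∑ k ∈ Finset.Ico 1 (n + 1),
          D * Λ ^ (2 * θ₀ - f / (2 * α)) * (k : ℝ) ^ (f - 1) :=
          Finset.sum_le_sum fun k hk => ha' k (Finset.mem_Ico.1 hk).1
      _ ≤ D * Λ ^ (2 * θ₀ - f / (2 * α)) * (K ^ f / f) := by
          rw [← Finset.mul_sum]
          have h1 := sum_Icc_rpow_le hf hf1 hn1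
          have h2 : (n : ℝ) ^ f / f ≤ K ^ f / f := by gcongr
          have := h1.trans h2
          gcongr
      _ = _ := by
          rw [hKf, Real.rpow_sub hΛ0]
          field_simp
  have hhigh : ∑ k ∈ Finset.Ico (n + 1) (N + 1), a k ≤
      D * (2 ^ (2 - 2 * σ) / (2 - 2 * σ)) * Λ ^ (2 * θ₀) := by
    have h := sum_tail_le (α := α) (θ := 0) (Λ := Λ) (σ := σ) (N := N) hn1 (a := a) (D := D)
      (by simpa using ha) (by linarith) hD hΛ0
    simp only [mul_zero, Real.rpow_zero, add_zero, one_mul] at h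
    refine h.trans ?_
    have h2 : (n : ℝ) ^ (-(2 - 2 * σ)) ≤ 2 ^ (2 - 2 * σ) * Λ ^ (2 * θ₀) := by
      rw [← hKe]
      calc (n : ℝ) ^ (-(2 - 2 * σ)) ≤ (K / 2) ^ (-(2 - 2 * σ)) :=
            Real.rpow_le_rpow_of_nonpos (by linarith) (by linarith) (by linarith)
        _ = _ := by
            rw [Real.div_rpow (by linarith) (by norm_num), Real.rpow_neg (by norm_num : (0:ℝ) ≤ 2)]
            field_simp
    have h3 : 0 < 2 - 2 * σ := by linarith
    calc D / (2 - 2 * σ) * (n : ℝ) ^ (-(2 - 2 * σ)) ≤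
          D / (2 - 2 * σ) * (2 ^ (2 - 2 * σ) * Λ ^ (2 * θ₀)) := by gcongr
      _ = _ := by ring
  have hsub : Finset.Ico (M + 1) (N + 1) ⊆ Finset.Ico 1 (n + 1) ∪ Finset.Ico (n + 1) (N + 1) := by
    intro k hk
    simp only [Finset.mem_union, Finset.mem_Ico] at hk ⊢
    omega
  calc ∑ k ∈ Finset.Ico (M + 1) (N + 1), a k ≤
        ∑ k ∈ Finset.Ico 1 (n + 1) ∪ Finset.Ico (n + 1) (N + 1), a k :=
        Finset.sum_le_sum_of_subset_of_nonneg hsub fun k _ _ => ha0 k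
    _ ≤ ∑ k ∈ Finset.Ico 1 (n + 1), a k + ∑ k ∈ Finset.Ico (n + 1) (N + 1), a k := by
        rw [← Finset.sum_union_inter]
        exact le_add_of_nonneg_right (Finset.sum_nonneg fun k _ => ha0 k)
    _ ≤ _ := by linarith

/-- Tail bound uniform in the exponent `θ`, away from the critical case `1 - σ = 2α`. -/
lemma exists_sum_tail_le {α σ : ℝ} (hα : 0 < α) (hσ : σ < 1) (hne : 1 - σ ≠ 2 * α) :
    ∃ C : ℝ, 0 < C ∧ ∀ (D Λ : ℝ) (a : ℕ → ℝ), 0 ≤ D → 0 < Λ → (∀ k, 0 ≤ a k) →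
      (∀ k : ℕ, 1 ≤ k → ∀ θ : ℝ, -1 ≤ θ → θ ≤ 1 →
        a k ≤ D * Λ ^ (2 * θ) * (k : ℝ) ^ (-3 + 2 * σ - 4 * α * θ)) →
      ∀ θ : ℝ, -1 ≤ θ → θ ≤ 1 → 0 < 2 - 2 * σ + 4 * α * θ → ∀ M N : ℕ, 1 ≤ M →
        ∑ k ∈ Finset.Ico (M + 1) (N + 1), a k ≤
          C * D * (Λ ^ (2 * θ) * (M : ℝ) ^ (-(2 - 2 * σ + 4 * α * θ))) := by
  rcases lt_or_gt_of_ne hne with hlt | hgt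
  · set θ₀ := -(1 - σ) / (2 * α) with hθ₀
    have hθ₀' : 2 * α * θ₀ = -(1 - σ) := by rw [hθ₀]; field_simp
    have hθ₀1 : -1 < θ₀ := by nlinarith
    have hθ₀0 : θ₀ < 0 := by nlinarith
    -- Chosen so that `θ₀ - f/(4α)`, an exponent strictly below the critical one, is still at least
    -- `-1`.
    set f := min 1 (4 * α * (1 + θ₀)) with hf
    have hf0 : 0 < f := lt_min one_pos (by nlinarith)
    have hf1 : f ≤ 1 := min_le_left _ _
    have hf2 : f ≤ 4 * α * (1 + θ₀) := min_le_right _ _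
    have hσ0 : 0 < 1 - σ := by linarith
    have hσ2 : 0 < 2 - 2 * σ := by linarith
    refine ⟨1 / (1 - σ) + (1 / f + 2 ^ (2 - 2 * σ) / (2 - 2 * σ)), by positivity, ?_⟩
    intro D Λ a hD hΛ ha0 ha θ hθ hθ' he M N hM
    have hM0 : (0 : ℝ) < M := Nat.cast_pos.2 hM
    set R := Λ ^ (2 * θ) * (M : ℝ) ^ (-(2 - 2 * σ + 4 * α * θ)) with hR
    have hR0 : 0 < R := by positivity
    have hE0 : 0 ≤ 1 / f + 2 ^ (2 - 2 * σ) / (2 - 2 * σ) := by positivity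
    set E := 1 / f + 2 ^ (2 - 2 * σ) / (2 - 2 * σ) with hE
    have hfirst : ∀ x : ℝ, 1 - σ ≤ x → D / x * R ≤ (1 / (1 - σ) + E) * D * R := by
      intro x hx
      have : D / x ≤ D / (1 - σ) := by gcongr
      calc D / x * R ≤ D / (1 - σ) * R := by gcongr
        _ ≤ (1 / (1 - σ) + E) * D * R := by
          gcongr
          rw [add_mul, div_mul_eq_mul_div, one_mul]
          exact le_add_of_nonneg_right (by positivity)
    -- For `θ ≥ θ₀/2` the tail exponent is at least `1 - σ`, so the direct bound is uniform.
    rcases le_or_gt (θ₀ / 2) θ with hc | hc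
    · exact (sum_tail_le hM (fun k hk => ha k hk θ hθ hθ') he hD hΛ).trans
        (hfirst _ (by nlinarith))
    -- Here `θ < 0`. If `Λ ≤ M^{2α}`, the bound at exponent `0` is stronger than the one claimed.
    -- Otherwise the entire sum is `O(Λ^{2θ₀})`, and `Λ^{2θ₀} ≤ R` because `θ ≥ θ₀`.
    · rcases le_or_gt Λ ((M : ℝ) ^ (2 * α)) with hX | hX
      · have h := sum_tail_le (N := N) hM (fun k hk => ha k hk 0 (by norm_num) (by norm_num))
          (by linarith) hD hΛ
        refine h.trans (le_trans ?_ (hfirst (2 - 2 * σ) (by linarith)))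
        simp only [mul_zero, add_zero, Real.rpow_zero, one_mul]
        refine mul_le_mul_of_nonneg_left ?_ (by positivity)
        have hXθ : ((M : ℝ) ^ (2 * α)) ^ (2 * θ) ≤ Λ ^ (2 * θ) :=
          Real.rpow_le_rpow_of_nonpos hΛ hX (by linarith)
        calc (M : ℝ) ^ (-(2 - 2 * σ)) = ((M : ℝ) ^ (2 * α)) ^ (2 * θ) *
              (M : ℝ) ^ (-(2 - 2 * σ + 4 * α * θ)) := by
              rw [← Real.rpow_mul hM0.le, ← Real.rpow_add hM0]; ring_nf
          _ ≤ R := by rw [hR]; gcongr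
      · have hΛ1 : 1 < Λ :=
          (Real.one_le_rpow (by exact_mod_cast hM) (by positivity)).trans_lt hX
        have h := sum_all_le (α := α) (σ := σ) (D := D) (θ₀ := θ₀) (f := f) (a := a) (N := N)
          (M := M) hα hσ hD hΛ1 hθ₀ hf0 hf1 ha0
          (fun k hk => by simpa using ha k hk 0 (by norm_num) (by norm_num))
          (fun k hk => by
            have h4 : 4 * α * (f / (4 * α)) = f := by field_simp
            have hδ : f / (4 * α) ≤ 1 + θ₀ := by
              rw [div_le_iff₀ (by positivity)]; linarith
            have hδ0 : 0 < f / (4 * α) := by positivity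
            have := ha k hk (θ₀ - f / (4 * α)) (by linarith) (by linarith)
            rwa [show 2 * (θ₀ - f / (4 * α)) = 2 * θ₀ - f / (2 * α) by field_simp; ring,
              show -3 + 2 * σ - 4 * α * (θ₀ - f / (4 * α)) = f - 1 by
                linear_combination (-2) * hθ₀' + h4] at this)
        have hRge : Λ ^ (2 * θ₀) ≤ R := by
          have hd : 0 ≤ 2 * (θ - θ₀) := by nlinarith
          have h1 : ((M : ℝ) ^ (2 * α)) ^ (2 * (θ - θ₀)) ≤ Λ ^ (2 * (θ - θ₀)) := by gcongr
          have h2 : ((M : ℝ) ^ (2 * α)) ^ (2 * (θ - θ₀)) *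
              (M : ℝ) ^ (-(2 - 2 * σ + 4 * α * θ)) = 1 := by
            rw [← Real.rpow_mul hM0.le, ← Real.rpow_add hM0]
            rw [show 2 * α * (2 * (θ - θ₀)) + -(2 - 2 * σ + 4 * α * θ) = 0 by
              linear_combination (-2) * hθ₀', Real.rpow_zero]
          have h3 : Λ ^ (2 * θ) = Λ ^ (2 * θ₀) * Λ ^ (2 * (θ - θ₀)) := by
            rw [← Real.rpow_add hΛ]; ring_nf
          calc Λ ^ (2 * θ₀) = Λ ^ (2 * θ₀) * (((M : ℝ) ^ (2 * α)) ^ (2 * (θ - θ₀)) *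
                (M : ℝ) ^ (-(2 - 2 * σ + 4 * α * θ))) := by rw [h2, mul_one]
            _ ≤ Λ ^ (2 * θ₀) * (Λ ^ (2 * (θ - θ₀)) *
                (M : ℝ) ^ (-(2 - 2 * σ + 4 * α * θ))) := by gcongr
            _ = R := by rw [hR, h3]; ring
        calc _ ≤ D * E * Λ ^ (2 * θ₀) := h
          _ ≤ D * E * R := by gcongr
          _ ≤ (1 / (1 - σ) + E) * D * R := by
            have : 0 ≤ 1 / (1 - σ) * D * R := by positivity
            nlinarith
  -- The critical exponent lies below `-1`, so the tail exponent is bounded below by its positive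
  -- value at `θ = -1`.
  · have hgt' : 2 * α < 1 - σ := hgt
    have he0 : 0 < 2 - 2 * σ - 4 * α := by linarith
    refine ⟨1 / (2 - 2 * σ - 4 * α), by positivity, ?_⟩
    intro D Λ a hD hΛ ha0 ha θ hθ hθ' he M N hM
    refine (sum_tail_le hM (fun k hk => ha k hk θ hθ hθ') he hD hΛ).trans ?_
    have : D / (2 - 2 * σ + 4 * α * θ) ≤ D / (2 - 2 * σ - 4 * α) := by
      gcongr; nlinarith
    calc _ ≤ D / (2 - 2 * σ - 4 * α) *
          (Λ ^ (2 * θ) * (M : ℝ) ^ (-(2 - 2 * σ + 4 * α * θ))) := by gcongr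
      _ = _ := by ring

end

noncomputable section

open Set Filter Topology

/-! ### Weighted inequalities of Hardy type for the Riemann–Liouville integral -/

/-- Cauchy–Schwarz, with the pointwise hypothesis on squares so that no square roots appear in
applications. -/
lemma lintegral_sq_le_mul {Y : Type*} [MeasurableSpace Y] {ν : Measure Y} {f f₁ f₂ : Y → ℝ≥0∞}
    (h₁ : AEMeasurable f₁ ν) (h₂ : AEMeasurable f₂ ν) (h : ∀ᵐ y ∂ν, f y ^ 2 ≤ f₁ y * f₂ y) :
    (∫⁻ y, f y ∂ν) ^ 2 ≤ (∫⁻ y, f₁ y ∂ν) * ∫⁻ y, f₂ y ∂ν := by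
  have hroot : ∀ᵐ y ∂ν, f y ≤ f₁ y ^ (1 / 2 : ℝ) * f₂ y ^ (1 / 2 : ℝ) := by
    filter_upwards [h] with y hy
    rw [← ENNReal.mul_rpow_of_nonneg _ _ (by norm_num : (0 : ℝ) ≤ 1 / 2)]
    calc f y = (f y ^ (2 : ℕ)) ^ (1 / 2 : ℝ) := by
          rw [← ENNReal.rpow_natCast, ← ENNReal.rpow_mul]; norm_num
      _ ≤ _ := ENNReal.rpow_le_rpow hy (by norm_num)
  have hsq : ∀ x : ℝ≥0∞, (x ^ (1 / 2 : ℝ)) ^ (2 : ℝ) = x := fun x => by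
    rw [← ENNReal.rpow_mul]; norm_num
  have hH : ∫⁻ y, f₁ y ^ (1 / 2 : ℝ) * f₂ y ^ (1 / 2 : ℝ) ∂ν ≤
      (∫⁻ y, f₁ y ∂ν) ^ (1 / 2 : ℝ) * (∫⁻ y, f₂ y ∂ν) ^ (1 / 2 : ℝ) := by
    simpa only [hsq, Pi.mul_apply] using ENNReal.lintegral_mul_le_Lp_mul_Lq ν
      Real.HolderConjugate.two_two (h₁.pow_const (1 / 2 : ℝ)) (h₂.pow_const (1 / 2 : ℝ))
  calc (∫⁻ y, f y ∂ν) ^ 2 ≤ ((∫⁻ y, f₁ y ∂ν) ^ (1 / 2 : ℝ) * (∫⁻ y, f₂ y ∂ν) ^ (1 / 2 : ℝ)) ^ 2 := by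
        gcongr
        exact (lintegral_mono_ae hroot).trans hH
    _ = _ := by
        rw [mul_pow, ← ENNReal.rpow_natCast, ← ENNReal.rpow_natCast, ← ENNReal.rpow_mul,
          ← ENNReal.rpow_mul]
        norm_num

/-- Schur's test in weighted `L²`. -/
lemma lintegral_schur {X Y : Type*} [MeasurableSpace X] [MeasurableSpace Y] {μ : Measure X}
    {ν : Measure Y} [SFinite μ] [SFinite ν] {K : X → Y → ℝ≥0∞} (hK : Measurable (Function.uncurry K))
    {ρ A : X → ℝ≥0∞} {q B G : Y → ℝ≥0∞} (hA : Measurable A) (hq : Measurable q)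
    (hG : Measurable G) (hq0 : ∀ᵐ y ∂ν, q y ≠ 0) (hqt : ∀ᵐ y ∂ν, q y ≠ ⊤)
    (h₁ : ∀ᵐ x ∂μ, ρ x * ∫⁻ y, K x y * (q y)⁻¹ ∂ν ≤ A x)
    (h₂ : ∀ᵐ y ∂ν, ∫⁻ x, A x * K x y ∂μ ≤ B y) :
    ∫⁻ x, ρ x * (∫⁻ y, K x y * G y ∂ν) ^ 2 ∂μ ≤ ∫⁻ y, q y * B y * G y ^ 2 ∂ν := by
  have hKx : ∀ x, Measurable (K x) := fun x => hK.of_uncurry_left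
  calc ∫⁻ x, ρ x * (∫⁻ y, K x y * G y ∂ν) ^ 2 ∂μ
      ≤ ∫⁻ x, A x * ∫⁻ y, K x y * (q y * G y ^ 2) ∂ν ∂μ := by
        refine lintegral_mono_ae ?_
        filter_upwards [h₁] with x hx
        have hcs := lintegral_sq_le_mul (ν := ν) (f := fun y => K x y * G y)
          (f₁ := fun y => K x y * (q y)⁻¹) (f₂ := fun y => K x y * (q y * G y ^ 2))
          (by have := hKx x; fun_prop) (by have := hKx x; fun_prop) (by
            filter_upwards [hq0, hqt] with y h0 ht
            refine le_of_eq ?_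
            calc (K x y * G y) ^ 2 = K x y * K x y * ((q y)⁻¹ * q y) * G y ^ 2 := by
                  rw [ENNReal.inv_mul_cancel h0 ht]; ring
              _ = _ := by ring)
        calc _ ≤ ρ x * ((∫⁻ y, K x y * (q y)⁻¹ ∂ν) * ∫⁻ y, K x y * (q y * G y ^ 2) ∂ν) := by gcongr
          _ = (ρ x * ∫⁻ y, K x y * (q y)⁻¹ ∂ν) * ∫⁻ y, K x y * (q y * G y ^ 2) ∂ν := by ring
          _ ≤ _ := by gcongr
    _ = ∫⁻ x, ∫⁻ y, A x * (K x y * (q y * G y ^ 2)) ∂ν ∂μ := by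
        refine lintegral_congr fun x => ?_
        rw [lintegral_const_mul _ (by have := hKx x; fun_prop)]
    _ = ∫⁻ y, ∫⁻ x, A x * (K x y * (q y * G y ^ 2)) ∂μ ∂ν := by
        refine lintegral_lintegral_swap (Measurable.aemeasurable ?_)
        unfold Function.uncurry at hK ⊢
        fun_prop
    _ ≤ ∫⁻ y, q y * B y * G y ^ 2 ∂ν := by
        refine lintegral_mono_ae ?_
        filter_upwards [h₂] with y hy
        have hKy : Measurable fun x => K x y := hK.of_uncurry_right
        calc _ = ∫⁻ x, (A x * K x y) * (q y * G y ^ 2) ∂μ := by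
              refine lintegral_congr fun x => ?_; ring
          _ = (∫⁻ x, A x * K x y ∂μ) * (q y * G y ^ 2) := lintegral_mul_const _ (by fun_prop)
          _ ≤ B y * (q y * G y ^ 2) := by gcongr
          _ = _ := by ring

variable {α : ℝ}

/-- `u_+^{α-1}`. -/
def posPow (α u : ℝ) : ℝ := if 0 < u then u ^ (α - 1) else 0

@[fun_prop]
lemma measurable_posPow : Measurable (posPow α) :=
  Measurable.ite measurableSet_Ioi (by fun_prop) measurable_const

lemma posPow_nonneg (u : ℝ) : 0 ≤ posPow α u := by
  unfold posPow; split_ifs <;> positivity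

lemma lintegral_rpow_Ioo (hα : 0 < α) {x : ℝ} (hx : 0 < x) :
    ∫⁻ t in Ioo 0 x, ENNReal.ofReal (t ^ (α - 1)) = ENNReal.ofReal (x ^ α / α) := by
  have h := lintegral_beta hx hα one_pos
  have hG := Real.Gamma_pos_of_pos hα
  simp only [sub_self, Real.rpow_zero, mul_one] at h
  rw [h, ProbabilityTheory.beta, Real.Gamma_add_one hα.ne', Real.Gamma_one, add_sub_cancel_right]
  congr 1; field_simp

lemma lintegral_rpow_Ioi {p c : ℝ} (hp : 0 < p) (hc : 0 < c) :
    ∫⁻ t in Ioi c, ENNReal.ofReal (t ^ (-p - 1)) = ENNReal.ofReal (c ^ (-p) / p) := by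
  rw [← ofReal_integral_eq_lintegral_ofReal (integrableOn_Ioi_rpow_of_lt (by linarith) hc),
    integral_Ioi_rpow_of_lt (by linarith) hc, sub_add_cancel, div_neg, neg_div, neg_neg]
  refine (ae_restrict_iff' measurableSet_Ioi).2 (.of_forall fun t (ht : c < t) => ?_)
  have : 0 < t := hc.trans ht
  simp only [Pi.zero_apply]; positivity

lemma lintegral_posPow_sub_mul {γ : ℝ} (hα : 0 < α) (hγ : γ < 1) {t : ℝ} (ht : 0 < t) :
    ∫⁻ s in Ioi 0, ‖posPow α (t - s)‖ₑ * (ENNReal.ofReal (s ^ γ))⁻¹ =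
      ENNReal.ofReal (ProbabilityTheory.beta (1 - γ) α * t ^ (α - γ)) := by
  have h := lintegral_beta ht (show 0 < 1 - γ by linarith) hα
  have e : ∀ s ∈ Ioi (0 : ℝ), ‖posPow α (t - s)‖ₑ * (ENNReal.ofReal (s ^ γ))⁻¹ =
      (Ioo 0 t).indicator (fun s => ENNReal.ofReal (s ^ (1 - γ - 1) * (t - s) ^ (α - 1))) s := by
    intro s (hs : 0 < s)
    rw [← ENNReal.ofReal_inv_of_pos (by positivity), Real.enorm_of_nonneg (posPow_nonneg _),
      ← ENNReal.ofReal_mul (posPow_nonneg _), posPow, ← Real.rpow_neg hs.le]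
    by_cases hst : s < t
    · rw [indicator_of_mem (show s ∈ Ioo 0 t from ⟨hs, hst⟩), if_pos (sub_pos.2 hst)]
      congr 1; rw [mul_comm]; ring_nf
    · rw [indicator_of_notMem (fun h => hst h.2), if_neg (by linarith)]
      simp
  rw [setLIntegral_congr_fun measurableSet_Ioi e, lintegral_indicator measurableSet_Ioo,
    Measure.restrict_restrict measurableSet_Ioo, inter_eq_left.2 Ioo_subset_Ioi_self, h]
  congr 1; rw [mul_comm]; ring_nf

/-- For `s < t < 2s` the factor `t^{-γ}` is at most `s^{-γ}`. For `t ≥ 2s` one has `t - s ≥ t/2`,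
and `γ > α` gives convergence at infinity. -/
lemma lintegral_mul_posPow_sub_le {γ : ℝ} (hα : 0 < α) (hα₁ : α < 1) (hγ : α < γ) {s : ℝ}
    (hs : 0 < s) :
    ∫⁻ t in Ioi 0, ENNReal.ofReal (t ^ (-γ)) * ‖posPow α (t - s)‖ₑ ≤
      ENNReal.ofReal ((1 / α + 2 / (γ - α)) * s ^ (α - γ)) := by
  have hγα : 0 < γ - α := by linarith
  have h1 : ∫⁻ t in Ioi 0, ENNReal.ofReal (t ^ (-γ)) * ‖posPow α (t - s)‖ₑ ≤
      ∫⁻ t in Ioo s (2 * s) ∪ Ici (2 * s), ENNReal.ofReal (t ^ (-γ)) * ‖posPow α (t - s)‖ₑ := by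
    rw [← lintegral_indicator measurableSet_Ioi, ← lintegral_indicator
      (measurableSet_Ioo.union measurableSet_Ici)]
    refine lintegral_mono fun t => ?_
    by_cases ht : s < t
    · have : t ∈ Ioo s (2 * s) ∪ Ici (2 * s) := by
        rcases lt_or_ge t (2 * s) with h | h
        · exact Or.inl ⟨ht, h⟩
        · exact Or.inr h
      rw [indicator_of_mem this]
      exact indicator_le_self _ _ _
    · have : posPow α (t - s) = 0 := by rw [posPow, if_neg (by linarith)]
      refine (indicator_le_self _ _ _).trans ?_
      simp [this]
  refine h1.trans ((lintegral_union_le _ _ _).trans ?_)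
  have hA : ∫⁻ t in Ioo s (2 * s), ENNReal.ofReal (t ^ (-γ)) * ‖posPow α (t - s)‖ₑ ≤
      ENNReal.ofReal (s ^ (-γ) * (s ^ α / α)) := by
    rw [ENNReal.ofReal_mul (by positivity), ← lintegral_rpow_Ioo hα hs,
      ← lintegral_const_mul' _ _ ENNReal.ofReal_ne_top]
    have : Ioo s (2 * s) = (fun u => u - s) ⁻¹' Ioo 0 s := by
      ext t; simp only [mem_Ioo, mem_preimage]; constructor <;> rintro ⟨h, h'⟩ <;> constructor <;> linarith
    rw [this, ← (measurePreserving_sub_right volume s).setLIntegral_comp_preimage measurableSet_Ioo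
      (by fun_prop)]
    refine setLIntegral_mono' (by rw [← this]; exact measurableSet_Ioo) fun t ht => ?_
    have ht' : 0 < t - s := ht.1
    rw [posPow, if_pos ht', Real.enorm_of_nonneg (by positivity)]
    gcongr ?_ * _
    exact ENNReal.ofReal_le_ofReal (Real.rpow_le_rpow_of_nonpos hs (by linarith) (by linarith))
  have hB : ∫⁻ t in Ici (2 * s), ENNReal.ofReal (t ^ (-γ)) * ‖posPow α (t - s)‖ₑ ≤
      ENNReal.ofReal (2 * (s ^ (-(γ - α)) / (γ - α))) := by
    rw [ENNReal.ofReal_mul (by positivity), ← lintegral_rpow_Ioi hγα hs,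
      ← lintegral_const_mul' _ _ ENNReal.ofReal_ne_top]
    refine le_trans ?_ (lintegral_mono_set (Ici_subset_Ioi.2 (by linarith : s < 2 * s)))
    refine setLIntegral_mono' measurableSet_Ici fun t (ht : 2 * s ≤ t) => ?_
    have ht0 : 0 < t := by linarith
    have ht' : 0 < t - s := by linarith
    rw [posPow, if_pos ht', Real.enorm_of_nonneg (by positivity), ← ENNReal.ofReal_mul (by positivity),
      ← ENNReal.ofReal_mul (by positivity)]
    refine ENNReal.ofReal_le_ofReal ?_
    have hle : (t - s) ^ (α - 1) ≤ (t / 2) ^ (α - 1) :=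
      Real.rpow_le_rpow_of_nonpos (by positivity) (by linarith) (by linarith)
    have h2 : (t / 2) ^ (α - 1) ≤ 2 * t ^ (α - 1) := by
      rw [Real.div_rpow ht0.le (by norm_num), div_eq_mul_inv, mul_comm, ← Real.rpow_neg (by norm_num)]
      gcongr
      calc (2 : ℝ) ^ (-(α - 1)) ≤ 2 ^ (1 : ℝ) :=
            Real.rpow_le_rpow_of_exponent_le (by norm_num) (by linarith)
        _ = 2 := Real.rpow_one _
    calc t ^ (-γ) * (t - s) ^ (α - 1) ≤ t ^ (-γ) * (2 * t ^ (α - 1)) := by gcongr; linarith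
      _ = 2 * t ^ (-(γ - α) - 1) := by
        rw [mul_left_comm, ← Real.rpow_add ht0]; ring_nf
  refine (add_le_add hA hB).trans ?_
  rw [← ENNReal.ofReal_add (by positivity) (by positivity)]
  refine (ENNReal.ofReal_le_ofReal (le_of_eq ?_))
  rw [mul_div_assoc', ← Real.rpow_add hs, show -(γ - α) = α - γ by ring,
    show -γ + α = α - γ by ring]
  ring

/-- Hardy's inequality `∫ t^{-α} (I^α G)² ≤ C ∫ s^α G²`. -/
lemma exists_hardy (hα : 0 < α) (hα₁ : α < 1) :
    ∃ C : ℝ, 0 < C ∧ ∀ G : ℝ → ℝ≥0∞, Measurable G →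
      ∫⁻ t in Ioi 0, ENNReal.ofReal (t ^ (-α)) *
        (∫⁻ s in Ioi 0, ‖posPow α (t - s)‖ₑ * G s) ^ 2 ≤
      ENNReal.ofReal C * ∫⁻ s in Ioi 0, ENNReal.ofReal (s ^ α) * G s ^ 2 := by
  -- The Schur weight `s^γ` needs `γ < 1` for the integral in `s` and `γ > α` for the one in `t`;
  -- the midpoint serves both.
  set γ := (1 + α) / 2 with hγ
  have hγ1 : γ < 1 := by rw [hγ]; linarith
  have hγα : α < γ := by rw [hγ]; linarith
  have hγα' : 0 < γ - α := by linarith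
  have hB := ProbabilityTheory.beta_pos (show 0 < 1 - γ by linarith) hα
  set b := ProbabilityTheory.beta (1 - γ) α
  set c := 1 / α + 2 / (γ - α) with hc
  have hc0 : 0 < c := by positivity
  refine ⟨b * c, by positivity, fun G hG => ?_⟩
  refine (lintegral_schur (K := fun t s => ‖posPow α (t - s)‖ₑ)
    (A := fun t => ENNReal.ofReal b * ENNReal.ofReal (t ^ (-γ)))
    (q := fun s => ENNReal.ofReal (s ^ γ))
    (B := fun s => ENNReal.ofReal b * ENNReal.ofReal (c * s ^ (α - γ)))
    (by unfold Function.uncurry; fun_prop) (by fun_prop) (by fun_prop) hG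
    ?_ (.of_forall fun _ => ENNReal.ofReal_ne_top) ?_ ?_).trans ?_
  · refine (ae_restrict_iff' measurableSet_Ioi).2 (.of_forall fun s (hs : 0 < s) => ?_)
    simpa using Real.rpow_pos_of_pos hs γ
  · refine (ae_restrict_iff' measurableSet_Ioi).2 (.of_forall fun t (ht : 0 < t) => ?_)
    rw [lintegral_posPow_sub_mul hα hγ1 ht, ← ENNReal.ofReal_mul (by positivity),
      ← ENNReal.ofReal_mul (by positivity), mul_left_comm, ← Real.rpow_add ht,
      show -α + (α - γ) = -γ by ring]
  · refine (ae_restrict_iff' measurableSet_Ioi).2 (.of_forall fun s (hs : 0 < s) => ?_)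
    simp_rw [mul_assoc]
    rw [lintegral_const_mul' _ _ ENNReal.ofReal_ne_top]
    gcongr
    exact lintegral_mul_posPow_sub_le hα hα₁ hγα hs
  · rw [← lintegral_const_mul' _ _ ENNReal.ofReal_ne_top]
    refine setLIntegral_mono' measurableSet_Ioi fun s (hs : 0 < s) => ?_
    rw [← mul_assoc (ENNReal.ofReal (b * c))]
    refine mul_le_mul' ?_ le_rfl
    rw [← ENNReal.ofReal_mul (by positivity), ← ENNReal.ofReal_mul (by positivity),
      ← ENNReal.ofReal_mul (by positivity)]
    refine ENNReal.ofReal_le_ofReal (le_of_eq ?_)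
    rw [show s ^ γ * (b * (c * s ^ (α - γ))) = b * c * (s ^ γ * s ^ (α - γ)) by ring,
      ← Real.rpow_add hs, add_sub_cancel]

end

/-! ### Gagliardo estimate for the Riemann–Liouville integral. -/

noncomputable section

open Set Filter Topology

variable {α : ℝ}

lemma setLIntegral_Ioo_comp_add (F : ℝ → ℝ≥0∞) (a b h : ℝ) :
    ∫⁻ u in Ioo a b, F (u + h) = ∫⁻ v in Ioo (a + h) (b + h), F v := by
  have := (measurePreserving_add_right volume h).setLIntegral_comp_preimage_emb
    (measurableEmbedding_addRight h) F (Ioo (a + h) (b + h))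
  rw [← this]
  congr 2
  ext u; simp

lemma posPow_sub_nonneg (hα₁ : α < 1) {u h : ℝ} (hu : 0 < u) (hh : 0 < h) :
    posPow α (u + h) ≤ posPow α u := by
  rw [posPow, posPow, if_pos hu, if_pos (by linarith)]
  exact Real.rpow_le_rpow_of_nonpos hu (by linarith) (by linarith)

lemma enorm_posPow_sub (hα₁ : α < 1) {u h : ℝ} (hu : 0 < u) (hh : 0 < h) :
    ‖posPow α (u + h) - posPow α u‖ₑ = ENNReal.ofReal (u ^ (α - 1) - (u + h) ^ (α - 1)) := by
  have h1 := posPow_sub_nonneg hα₁ hu hh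
  rw [Real.enorm_eq_ofReal_abs, abs_of_nonpos (by linarith), posPow, posPow, if_pos hu,
    if_pos (by linarith)]
  congr 1; ring

/-- The kernel is decreasing on `u > 0`, so the integral telescopes to one over `(0, h)`. The
truncation at `R` keeps the subtracted integral finite, as `u^{α-1}` is not integrable at infinity.
-/
lemma lintegral_posPow_sub_Ioo_le (hα : 0 < α) (hα₁ : α < 1) {h R : ℝ} (hh : 0 < h) (hR : 0 < R) :
    ∫⁻ u in Ioo 0 R, ‖posPow α (u + h) - posPow α u‖ₑ ≤ ENNReal.ofReal (h ^ α / α) := by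
  have e : ∀ u ∈ Ioo 0 R, ‖posPow α (u + h) - posPow α u‖ₑ =
      ENNReal.ofReal (u ^ (α - 1)) - ENNReal.ofReal ((u + h) ^ (α - 1)) := fun u hu => by
    have := hu.1
    rw [enorm_posPow_sub hα₁ hu.1 hh, ENNReal.ofReal_sub _ (by positivity)]
  have hshift : ∫⁻ u in Ioo 0 R, ENNReal.ofReal ((u + h) ^ (α - 1)) =
      ∫⁻ v in Ioo h (R + h), ENNReal.ofReal (v ^ (α - 1)) := by
    rw [setLIntegral_Ioo_comp_add (fun v => ENNReal.ofReal (v ^ (α - 1))), zero_add]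
  rw [setLIntegral_congr_fun measurableSet_Ioo e, lintegral_sub (by fun_prop)]
  · rw [tsub_le_iff_right, hshift, ← lintegral_rpow_Ioo hα hh]
    calc ∫⁻ u in Ioo 0 R, ENNReal.ofReal (u ^ (α - 1))
        ≤ ∫⁻ u in Ioc 0 h ∪ Ioo h (R + h), ENNReal.ofReal (u ^ (α - 1)) := by
          refine lintegral_mono_set fun u hu => ?_
          rcases le_or_gt u h with h' | h'
          · exact Or.inl ⟨hu.1, h'⟩
          · exact Or.inr ⟨h', by linarith [hu.2]⟩
      _ ≤ _ := (lintegral_union_le _ _ _).trans (by rw [restrict_Ioo_eq_restrict_Ioc (a := 0)])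
  · rw [hshift]
    refine ne_top_of_le_ne_top ENNReal.ofReal_ne_top ((lintegral_mono_set
      (Ioo_subset_Ioo_left hh.le)).trans (lintegral_rpow_Ioo hα (show 0 < R + h by linarith)).le)
  · refine (ae_restrict_iff' measurableSet_Ioo).2 (.of_forall fun u hu => ?_)
    exact ENNReal.ofReal_le_ofReal
      (Real.rpow_le_rpow_of_nonpos hu.1 (by linarith) (by linarith))

lemma lintegral_posPow_sub_le (hα : 0 < α) (hα₁ : α < 1) {h : ℝ} (hh : 0 < h) :
    ∫⁻ u, ‖posPow α (u + h) - posPow α u‖ₑ ≤ ENNReal.ofReal (2 / α * h ^ α) := by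
  rw [← lintegral_add_compl _ (measurableSet_Ioi (a := (0 : ℝ))), compl_Ioi]
  have h1 : ∫⁻ u in Ioi 0, ‖posPow α (u + h) - posPow α u‖ₑ ≤ ENNReal.ofReal (h ^ α / α) := by
    have hU : Ioi (0 : ℝ) = ⋃ n : ℕ, Ioo (0 : ℝ) (n + 1) := by
      ext x
      simp only [mem_Ioi, mem_iUnion, mem_Ioo]
      refine ⟨fun hx => ?_, fun ⟨n, hn⟩ => hn.1⟩
      obtain ⟨n, hn⟩ := exists_nat_gt x
      exact ⟨n, hx, by linarith⟩
    rw [hU, setLIntegral_iUnion_of_directed _ (Monotone.directed_le fun m n hmn =>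
      Ioo_subset_Ioo_right (by have : (m : ℝ) ≤ n := (by exact_mod_cast hmn); linarith))]
    exact iSup_le fun n => lintegral_posPow_sub_Ioo_le hα hα₁ hh (by positivity)
  have h2 : ∫⁻ u in Iic 0, ‖posPow α (u + h) - posPow α u‖ₑ ≤ ENNReal.ofReal (h ^ α / α) := by
    have e : ∀ u ∈ Iic (0 : ℝ), ‖posPow α (u + h) - posPow α u‖ₑ =
        (Ioc (-h) 0).indicator (fun u => ENNReal.ofReal ((u + h) ^ (α - 1))) u := by
      intro u (hu : u ≤ 0)
      rw [posPow, posPow, if_neg (by linarith : ¬ 0 < u), sub_zero]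
      split_ifs with h'
      · rw [indicator_of_mem (show u ∈ Ioc (-h) 0 from ⟨by linarith, hu⟩),
          Real.enorm_of_nonneg (by positivity)]
      · rw [indicator_of_notMem (fun hm => h' (by linarith [hm.1]))]; simp
    rw [setLIntegral_congr_fun measurableSet_Iic e, lintegral_indicator measurableSet_Ioc,
      Measure.restrict_restrict measurableSet_Ioc, inter_eq_left.2 (fun x hx => hx.2),
      ← restrict_Ioo_eq_restrict_Ioc,
      setLIntegral_Ioo_comp_add (fun v => ENNReal.ofReal (v ^ (α - 1))), neg_add_cancel, zero_add,
      lintegral_rpow_Ioo hα hh]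
  refine (add_le_add h1 h2).trans ?_
  rw [← ENNReal.ofReal_add (by positivity) (by positivity)]
  exact ENNReal.ofReal_le_ofReal (le_of_eq (by ring))

lemma rpow_sub_rpow_add_le (hα : 0 < α) {u h : ℝ} (hu : 0 < u) (hh : 0 < h) :
    u ^ (α - 1) - (u + h) ^ (α - 1) ≤ h * u ^ (α - 2) := by
  have hx : 0 < h / u := by positivity
  have e1 : u ^ (α - 1) = u ^ (α - 2) * u := by
    rw [← Real.rpow_add_one hu.ne']; ring_nf
  have e2 : (u + h) ^ (α - 1) = u ^ (α - 1) * (1 + h / u) ^ (α - 1) := by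
    rw [← Real.mul_rpow hu.le (by positivity)]; congr 1; field_simp
  have h1 : (1 + h / u)⁻¹ ≤ (1 + h / u) ^ (α - 1) := by
    rw [← Real.rpow_neg_one]
    exact Real.rpow_le_rpow_of_exponent_le (by linarith) (by linarith)
  have h2 : 1 - h / u ≤ (1 + h / u)⁻¹ := by
    rw [← one_div, le_div_iff₀ (by positivity)]; nlinarith
  rw [e2]
  have hpos : 0 < u ^ (α - 1) := by positivity
  have h3 : u ^ (α - 1) * (1 - h / u) ≤ u ^ (α - 1) * (1 + h / u) ^ (α - 1) := by
    gcongr; linarith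
  have h4 : u ^ (α - 1) * (h / u) = h * u ^ (α - 2) := by rw [e1]; field_simp
  linarith

/-- For `s < t/2` the kernel is smooth and its increment is at most `h (t/2)^{α-2}`, where `h ≤ h^α
t^{1-α}` because `h < t`. For `s ≥ t/2` the weight is at most `2 t^{-γ}`, and the `L¹` bound on the
increment applies. -/
lemma lintegral_posPow_diff_mul_le {γ : ℝ} (hα : 0 < α) (hα₁ : α < 1) (hγα : α < γ) (hγ : γ < 1)
    {t h : ℝ} (hh : 0 < h) (hht : h < t) :
    ∫⁻ s in Ioi 0, ‖posPow α (t + h - s) - posPow α (t - s)‖ₑ * (ENNReal.ofReal (s ^ γ))⁻¹ ≤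
      ENNReal.ofReal ((4 / (1 - γ) + 4 / α) * (t ^ (-γ) * h ^ α)) := by
  have ht : 0 < t := hh.trans hht
  have hγ1 : 0 < 1 - γ := by linarith
  have hU : Ioi (0 : ℝ) = Ioo 0 (t / 2) ∪ Ici (t / 2) :=
    (Ioo_union_Ici_eq_Ioi (by positivity)).symm
  have hinv : ∀ s : ℝ, 0 < s → (ENNReal.ofReal (s ^ γ))⁻¹ = ENNReal.ofReal (s ^ (-γ)) := by
    intro s hs
    rw [← ENNReal.ofReal_inv_of_pos (by positivity), Real.rpow_neg hs.le]
  have hA : ∫⁻ s in Ioo 0 (t / 2), ‖posPow α (t + h - s) - posPow α (t - s)‖ₑ *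
      (ENNReal.ofReal (s ^ γ))⁻¹ ≤ ENNReal.ofReal (4 / (1 - γ) * (t ^ (-γ) * h ^ α)) := by
    calc _ ≤ ∫⁻ s in Ioo 0 (t / 2), ENNReal.ofReal (h * (t / 2) ^ (α - 2)) *
          ENNReal.ofReal (s ^ (1 - γ - 1)) := by
          refine setLIntegral_mono' measurableSet_Ioo fun s hs => ?_
          have hts : t / 2 < t - s := by linarith [hs.2]
          have hts0 : 0 < t - s := by linarith
          rw [hinv s hs.1, show 1 - γ - 1 = -γ by ring, show t + h - s = t - s + h by ring,
            enorm_posPow_sub hα₁ hts0 hh]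
          gcongr
          have hle : (t - s) ^ (α - 2) ≤ (t / 2) ^ (α - 2) :=
            Real.rpow_le_rpow_of_nonpos (by positivity) hts.le (by linarith)
          exact (rpow_sub_rpow_add_le hα hts0 hh).trans (mul_le_mul_of_nonneg_left hle hh.le)
      _ = ENNReal.ofReal (h * (t / 2) ^ (α - 2) * ((t / 2) ^ (1 - γ) / (1 - γ))) := by
          rw [lintegral_const_mul' _ _ ENNReal.ofReal_ne_top,
            lintegral_rpow_Ioo hγ1 (by positivity), ← ENNReal.ofReal_mul (by positivity)]
      _ ≤ _ := by
          refine ENNReal.ofReal_le_ofReal ?_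
          have e1 : (t / 2) ^ (α - 2) * (t / 2) ^ (1 - γ) = (t / 2) ^ (α - 1 - γ) := by
            rw [← Real.rpow_add (by positivity)]; ring_nf
          have e2 : (t / 2) ^ (α - 1 - γ) ≤ 4 * t ^ (α - 1 - γ) := by
            rw [Real.div_rpow ht.le (by norm_num), div_eq_mul_inv, mul_comm,
              ← Real.rpow_neg (by norm_num)]
            gcongr
            calc (2 : ℝ) ^ (-(α - 1 - γ)) ≤ 2 ^ (2 : ℝ) :=
                  Real.rpow_le_rpow_of_exponent_le (by norm_num) (by linarith)
              _ = 4 := by norm_num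
          have e3 : h ≤ h ^ α * t ^ (1 - α) := by
            calc h = h ^ α * h ^ (1 - α) := by
                  rw [← Real.rpow_add hh, add_sub_cancel, Real.rpow_one]
              _ ≤ _ := by gcongr
          have e4 : t ^ (1 - α) * t ^ (α - 1 - γ) = t ^ (-γ) := by
            rw [← Real.rpow_add ht]; ring_nf
          calc h * (t / 2) ^ (α - 2) * ((t / 2) ^ (1 - γ) / (1 - γ))
              = h * ((t / 2) ^ (α - 2) * (t / 2) ^ (1 - γ)) / (1 - γ) := by ring
            _ ≤ (h ^ α * t ^ (1 - α)) * (4 * t ^ (α - 1 - γ)) / (1 - γ) := by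
                rw [e1]; gcongr
            _ = 4 / (1 - γ) * ((t ^ (1 - α) * t ^ (α - 1 - γ)) * h ^ α) := by ring
            _ = _ := by rw [e4]
  have hB : ∫⁻ s in Ici (t / 2), ‖posPow α (t + h - s) - posPow α (t - s)‖ₑ *
      (ENNReal.ofReal (s ^ γ))⁻¹ ≤ ENNReal.ofReal (4 / α * (t ^ (-γ) * h ^ α)) := by
    calc _ ≤ ∫⁻ s in Ici (t / 2), ‖posPow α (t + h - s) - posPow α (t - s)‖ₑ *
          ENNReal.ofReal (2 * t ^ (-γ)) := by
          refine setLIntegral_mono' measurableSet_Ici fun s (hs : t / 2 ≤ s) => ?_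
          have hs0 : 0 < s := by linarith
          rw [hinv s hs0]
          gcongr
          calc s ^ (-γ) ≤ (t / 2) ^ (-γ) :=
                Real.rpow_le_rpow_of_nonpos (by positivity) hs (by linarith)
            _ = 2 ^ γ * t ^ (-γ) := by
                rw [Real.div_rpow ht.le (by norm_num), Real.rpow_neg (by norm_num : (0 : ℝ) ≤ 2)]
                field_simp
            _ ≤ 2 * t ^ (-γ) := by
                gcongr
                calc (2 : ℝ) ^ γ ≤ 2 ^ (1 : ℝ) :=
                      Real.rpow_le_rpow_of_exponent_le (by norm_num) hγ.le
                  _ = 2 := Real.rpow_one _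
      _ ≤ (∫⁻ s, ‖posPow α (t + h - s) - posPow α (t - s)‖ₑ) * ENNReal.ofReal (2 * t ^ (-γ)) := by
          rw [lintegral_mul_const' _ _ ENNReal.ofReal_ne_top]
          gcongr
          exact Measure.restrict_le_self
      _ ≤ ENNReal.ofReal (2 / α * h ^ α) * ENNReal.ofReal (2 * t ^ (-γ)) := by
          gcongr
          have := lintegral_sub_left_eq_self (μ := volume)
            (fun u => ‖posPow α (u + h) - posPow α u‖ₑ) t
          simp_rw [show ∀ s, t + h - s = t - s + h from fun s => by ring]
          rw [this]
          exact lintegral_posPow_sub_le hα hα₁ hh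
      _ = _ := by
          rw [← ENNReal.ofReal_mul (by positivity)]; congr 1; ring
  rw [hU]
  refine (lintegral_union_le _ _ _).trans ((add_le_add hA hB).trans ?_)
  rw [← ENNReal.ofReal_add (by positivity) (by positivity)]
  exact ENNReal.ofReal_le_ofReal (le_of_eq (by ring))

lemma lintegral_max_rpow_le {γ : ℝ} (hα : 0 < α) (hγα : α < γ) {s : ℝ} (hs : 0 < s) :
    ∫⁻ h in Ioi 0, ENNReal.ofReal (h ^ (α - 1) * (max s h) ^ (-γ)) ≤
      ENNReal.ofReal ((1 / α + 1 / (γ - α)) * s ^ (α - γ)) := by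
  have hγ0 : 0 < γ - α := by linarith
  rw [← Ioc_union_Ioi_eq_Ioi hs.le]
  refine (lintegral_union_le _ _ _).trans ?_
  have h1 : ∫⁻ h in Ioc 0 s, ENNReal.ofReal (h ^ (α - 1) * (max s h) ^ (-γ)) =
      ENNReal.ofReal (s ^ α / α * s ^ (-γ)) := by
    rw [← restrict_Ioo_eq_restrict_Ioc, ENNReal.ofReal_mul (by positivity),
      ← lintegral_rpow_Ioo hα hs, ← lintegral_mul_const' _ _ ENNReal.ofReal_ne_top]
    refine setLIntegral_congr_fun measurableSet_Ioo fun h hh => ?_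
    have := hh.1
    rw [max_eq_left hh.2.le, ENNReal.ofReal_mul (by positivity)]
  have h2 : ∫⁻ h in Ioi s, ENNReal.ofReal (h ^ (α - 1) * (max s h) ^ (-γ)) =
      ENNReal.ofReal (s ^ (-(γ - α)) / (γ - α)) := by
    rw [← lintegral_rpow_Ioi hγ0 hs]
    refine setLIntegral_congr_fun measurableSet_Ioi fun h (hh : s < h) => ?_
    have : 0 < h := hs.trans hh
    rw [max_eq_right hh.le, ← Real.rpow_add this]
    ring_nf
  rw [h1, h2, ← ENNReal.ofReal_add (by positivity) (by positivity)]
  refine ENNReal.ofReal_le_ofReal (le_of_eq ?_)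
  rw [div_mul_eq_mul_div, ← Real.rpow_add hs, show -(γ - α) = α - γ by ring,
    show α + -γ = α - γ by ring]
  ring

/-- The Gagliardo part of the estimate of `I^α G`, on the region `0 < h < t`. -/
lemma exists_gagliardo (hα : 0 < α) (hα₁ : α < 1) :
    ∃ C : ℝ, 0 < C ∧ ∀ G : ℝ → ℝ≥0∞, Measurable G →
      ∫⁻ h in Ioi 0, ∫⁻ t in Ioi h, ENNReal.ofReal (h ^ (-1 - α)) *
        (∫⁻ s in Ioi 0, ‖posPow α (t + h - s) - posPow α (t - s)‖ₑ * G s) ^ 2 ≤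
      ENNReal.ofReal C * ∫⁻ s in Ioi 0, ENNReal.ofReal (s ^ α) * G s ^ 2 := by
  set γ := (1 + α) / 2 with hγ
  have hγ1 : γ < 1 := by rw [hγ]; linarith
  have hγα : α < γ := by rw [hγ]; linarith
  have hγα' : 0 < γ - α := by linarith
  have hγ1' : 0 < 1 - γ := by linarith
  set b := 4 / (1 - γ) + 4 / α with hb
  have hb0 : 0 < b := by positivity
  set c := 4 / α * b * (1 / α + 1 / (γ - α)) with hc
  have hc0 : 0 < c := by positivity
  refine ⟨c, hc0, fun G hG => ?_⟩
  -- Schur's test is applied with the pair `x = (h, t)` as output variable; the region `h < t` is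
  -- built into `ρ` and `A`.
  set K : ℝ × ℝ → ℝ → ℝ≥0∞ := fun x s => ‖posPow α (x.2 + x.1 - s) - posPow α (x.2 - s)‖ₑ with hK
  have hKm : Measurable (Function.uncurry K) := by
    rw [hK]; unfold Function.uncurry; fun_prop
  have hset : MeasurableSet {x : ℝ × ℝ | x.1 < x.2} := measurableSet_lt measurable_fst measurable_snd
  set ρ : ℝ × ℝ → ℝ≥0∞ := {x : ℝ × ℝ | x.1 < x.2}.indicator
    fun x => ENNReal.ofReal (x.1 ^ (-1 - α)) with hρ
  set A : ℝ × ℝ → ℝ≥0∞ := {x : ℝ × ℝ | x.1 < x.2}.indicator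
    fun x => ENNReal.ofReal (b * (x.1⁻¹ * x.2 ^ (-γ))) with hA
  have hρm : Measurable ρ := Measurable.indicator (by fun_prop) hset
  have hAm : Measurable A := Measurable.indicator (by fun_prop) hset
  have hmain := lintegral_schur (μ := (volume.restrict (Ioi (0 : ℝ))).prod (volume.restrict (Ioi 0)))
    (ν := volume.restrict (Ioi (0 : ℝ))) hKm (ρ := ρ) (A := A)
    (q := fun s => ENNReal.ofReal (s ^ γ)) (B := fun s => ENNReal.ofReal (c * s ^ (α - γ)))
    hAm (by fun_prop) hG ?_ (.of_forall fun _ => ENNReal.ofReal_ne_top) ?_ ?_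
  · calc _ = ∫⁻ x, ρ x * (∫⁻ s in Ioi 0, K x s * G s) ^ 2
          ∂((volume.restrict (Ioi (0 : ℝ))).prod (volume.restrict (Ioi 0))) := by
          rw [lintegral_prod]
          · refine setLIntegral_congr_fun measurableSet_Ioi fun h (hh : 0 < h) => ?_
            have hsub : Ioi h ∩ Ioi 0 = Ioi h := inter_eq_left.2 (Ioi_subset_Ioi hh.le)
            rw [← hsub, ← Measure.restrict_restrict measurableSet_Ioi,
              ← lintegral_indicator measurableSet_Ioi]
            refine lintegral_congr fun t => ?_
            by_cases ht : h < t
            · rw [indicator_of_mem (show t ∈ Ioi h from ht), hρ,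
                indicator_of_mem (show (h, t) ∈ {x : ℝ × ℝ | x.1 < x.2} from ht)]
            · rw [indicator_of_notMem (show t ∉ Ioi h from ht), hρ,
                indicator_of_notMem (show (h, t) ∉ {x : ℝ × ℝ | x.1 < x.2} from ht), zero_mul]
          · refine Measurable.aemeasurable (hρm.mul (Measurable.pow_const ?_ 2))
            refine Measurable.lintegral_prod_right' (f := fun q : (ℝ × ℝ) × ℝ => K q.1 q.2 * G q.2) ?_
            exact hKm.mul (by fun_prop)
      _ ≤ _ := hmain
      _ ≤ _ := by
          rw [← lintegral_const_mul' _ _ ENNReal.ofReal_ne_top]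
          refine setLIntegral_mono' measurableSet_Ioi fun s (hs : 0 < s) => ?_
          rw [← mul_assoc (ENNReal.ofReal c)]
          refine mul_le_mul' ?_ le_rfl
          rw [← ENNReal.ofReal_mul (by positivity), ← ENNReal.ofReal_mul (by positivity)]
          refine ENNReal.ofReal_le_ofReal (le_of_eq ?_)
          rw [mul_left_comm, ← Real.rpow_add hs, add_sub_cancel]
  · refine (ae_restrict_iff' measurableSet_Ioi).2 (.of_forall fun s (hs : 0 < s) => ?_)
    simpa using Real.rpow_pos_of_pos hs γ
  · rw [Measure.prod_restrict]
    refine (ae_restrict_iff' (measurableSet_Ioi.prod measurableSet_Ioi)).2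
      (.of_forall fun x hx => ?_)
    have hx1 : 0 < x.1 := hx.1
    have hx2 : 0 < x.2 := hx.2
    by_cases hlt : x ∈ {x : ℝ × ℝ | x.1 < x.2}
    · rw [hρ, hA, indicator_of_mem hlt, indicator_of_mem hlt]
      refine (mul_le_mul' le_rfl (lintegral_posPow_diff_mul_le hα hα₁ hγα hγ1 hx1 hlt)).trans ?_
      rw [← ENNReal.ofReal_mul (by positivity)]
      refine ENNReal.ofReal_le_ofReal (le_of_eq ?_)
      have : x.1 ^ (-1 - α) * x.1 ^ α = x.1⁻¹ := by
        rw [← Real.rpow_add hx1, sub_add_cancel, Real.rpow_neg_one]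
      rw [← this]; ring
    · rw [hρ, hA, indicator_of_notMem hlt, indicator_of_notMem hlt, zero_mul]
  · refine (ae_restrict_iff' measurableSet_Ioi).2 (.of_forall fun s (hs : 0 < s) => ?_)
    have hKs : Measurable fun x => K x s := hKm.of_uncurry_right
    rw [lintegral_prod _ (by fun_prop)]
    calc _ ≤ ∫⁻ h in Ioi 0, ENNReal.ofReal (4 / α * b) *
          ENNReal.ofReal (h ^ (α - 1) * (max s h) ^ (-γ)) := by
          refine setLIntegral_mono' measurableSet_Ioi fun h (hh : 0 < h) => ?_
          have hmax : 0 < max s h := lt_max_of_lt_left hs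
          calc ∫⁻ t in Ioi 0, A (h, t) * K (h, t) s
              ≤ ∫⁻ t in Ioi 0, ENNReal.ofReal (2 * b * (h⁻¹ * (max s h) ^ (-γ))) * K (h, t) s := by
                refine setLIntegral_mono' measurableSet_Ioi fun t (ht : 0 < t) => ?_
                by_cases hlt : (h, t) ∈ {x : ℝ × ℝ | x.1 < x.2}
                · have hlt' : h < t := hlt
                  -- The kernel vanishes unless `s < t + h`; together with `h < t` this gives `t >
                  -- max(s, h)/2`, so `t^{-γ}` can be replaced by `2 max(s, h)^{-γ}`.
                  by_cases hts : s < t + h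
                  · rw [hA, indicator_of_mem hlt]
                    refine mul_le_mul' (ENNReal.ofReal_le_ofReal ?_) le_rfl
                    have h1 : t ^ (-γ) ≤ 2 * (max s h) ^ (-γ) := by
                      calc t ^ (-γ) ≤ (max s h / 2) ^ (-γ) := by
                            refine Real.rpow_le_rpow_of_nonpos (by positivity) ?_ (by linarith)
                            rcases max_cases s h with h' | h' <;> rw [h'.1] <;> linarith
                        _ = 2 ^ γ * (max s h) ^ (-γ) := by
                            rw [Real.div_rpow hmax.le (by norm_num),
                              Real.rpow_neg (by norm_num : (0 : ℝ) ≤ 2)]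
                            field_simp
                        _ ≤ _ := by
                            gcongr
                            calc (2 : ℝ) ^ γ ≤ 2 ^ (1 : ℝ) :=
                                  Real.rpow_le_rpow_of_exponent_le (by norm_num) hγ1.le
                              _ = 2 := Real.rpow_one _
                    calc b * (h⁻¹ * t ^ (-γ)) ≤ b * (h⁻¹ * (2 * (max s h) ^ (-γ))) := by gcongr
                      _ = _ := by ring
                  · have : K (h, t) s = 0 := by
                      rw [hK]
                      simp only
                      rw [posPow, posPow, if_neg (by linarith), if_neg (by linarith)]
                      simp
                    rw [this, mul_zero, mul_zero]
                · rw [hA, indicator_of_notMem hlt, zero_mul]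
                  exact zero_le
            _ ≤ ENNReal.ofReal (2 * b * (h⁻¹ * (max s h) ^ (-γ))) *
                  ENNReal.ofReal (2 / α * h ^ α) := by
                rw [lintegral_const_mul' _ _ ENNReal.ofReal_ne_top]
                gcongr
                refine (setLIntegral_le_lintegral _ _).trans ?_
                have := lintegral_sub_right_eq_self (μ := volume)
                  (fun u => ‖posPow α (u + h) - posPow α u‖ₑ) s
                simp only [hK]
                simp_rw [show ∀ t, t + h - s = t - s + h from fun t => by ring]
                rw [this]
                exact lintegral_posPow_sub_le hα hα₁ hh
            _ = _ := by
                rw [← ENNReal.ofReal_mul (by positivity), ← ENNReal.ofReal_mul (by positivity)]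
                congr 1
                rw [Real.rpow_sub_one hh.ne']
                ring
      _ ≤ _ := by
          rw [lintegral_const_mul' _ _ ENNReal.ofReal_ne_top]
          refine (mul_le_mul' le_rfl (lintegral_max_rpow_le hα hγα hs)).trans ?_
          rw [← ENNReal.ofReal_mul (by positivity)]
          exact ENNReal.ofReal_le_ofReal (le_of_eq (by rw [hc]; ring))

end

/-! ### Plancherel and the Fourier form of the Gagliardo seminorm. -/

noncomputable section

open Set Filter
open scoped ContDiff

lemma continuous_fourier {f : ℝ → ℂ} (hf : Integrable f) : Continuous (𝓕 f) :=
  VectorFourier.fourierIntegral_continuous (μ := volume) (L := innerₗ ℝ)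
    Real.continuous_fourierChar (by exact continuous_inner) hf

/-- Plancherel's theorem for the Fourier integral of a function in `L¹ ∩ L²`. -/
lemma lintegral_enorm_fourier_sq {f : ℝ → ℂ} (h1 : Integrable f) (h2 : MemLp f 2) :
    ∫⁻ ξ, ‖𝓕 f ξ‖ₑ ^ 2 = ∫⁻ t, ‖f t‖ₑ ^ 2 := by
  have hcont := continuous_fourier h1
  -- The Fourier integral is identified with the `L²` Fourier transform by testing both against
  -- smooth compactly supported functions; Plancherel in `Lp` then applies.
  have hae : ∀ᵐ ξ, 𝓕 f ξ = (𝓕 (h2.toLp f) : Lp ℂ 2 (volume : Measure ℝ)) ξ := by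
    refine ae_eq_of_integral_contDiff_smul_eq (hcont.locallyIntegrable)
      ((Lp.memLp _).locallyIntegrable (by norm_num)) fun g g_smooth g_cpt => ?_
    have hg₁ : HasCompactSupport (Complex.ofRealCLM ∘ g) := g_cpt.comp_left rfl
    have hg₂ : ContDiff ℝ ∞ (Complex.ofRealCLM ∘ g) := by fun_prop
    set φ : SchwartzMap ℝ ℂ := hg₁.toSchwartzMap hg₂ with hφ
    have e := congrArg (fun d => d φ) (Lp.fourier_toTemperedDistribution_eq (h2.toLp f))
    simp only [TemperedDistribution.fourier_apply, Lp.toTemperedDistribution_apply] at e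
    have e' : ∫ x, 𝓕 f x • φ x = ∫ x, f x • (𝓕 φ) x := by
      have := VectorFourier.integral_fourierIntegral_smul_eq_flip (μ := volume) (ν := volume)
        (L := innerₗ ℝ) Real.continuous_fourierChar (by exact continuous_inner) h1
        (φ.integrable (μ := volume))
      rw [flip_innerₗ] at this
      exact this
    have e2 : ∫ x, (𝓕 φ) x • h2.toLp f x = ∫ x, f x • (𝓕 φ) x := by
      refine integral_congr_ae ?_
      filter_upwards [h2.coeFn_toLp] with x hx
      rw [hx, smul_eq_mul, smul_eq_mul, mul_comm]
    have hφg : ∀ (x : ℝ) (z : ℂ), g x • z = φ x • z := fun x z => by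
      simp [hφ]
    simp_rw [hφg]
    rw [← e, e2, ← e']
    simp_rw [smul_eq_mul, mul_comm]
  have hn := Lp.norm_fourier_eq (h2.toLp f)
  rw [Lp.norm_def, Lp.norm_def] at hn
  have hn' := (ENNReal.toReal_eq_toReal_iff' (Lp.eLpNorm_ne_top _) (Lp.eLpNorm_ne_top _)).1 hn
  rw [eLpNorm_congr_ae h2.coeFn_toLp, ← eLpNorm_congr_ae hae] at hn'
  have key : ∀ u : ℝ → ℂ, eLpNorm u 2 volume ^ 2 = ∫⁻ t, ‖u t‖ₑ ^ 2 := fun u => by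
    rw [eLpNorm_eq_lintegral_rpow_enorm_toReal (by norm_num) (by norm_num), ← ENNReal.rpow_natCast,
      ← ENNReal.rpow_mul]
    norm_num
  rw [← key, ← key, hn']

lemma enorm_fourier_comp_add_sub {f : ℝ → ℂ} (h1 : Integrable f) (h ξ : ℝ) :
    ‖𝓕 (fun t => f (t + h) - f t) ξ‖ₑ =
      ‖(Real.fourierChar (h * ξ) : ℂ) - 1‖ₑ * ‖𝓕 f ξ‖ₑ := by
  have e1 : 𝓕 (fun t => f (t + h)) ξ = (Real.fourierChar (h * ξ) : ℂ) * 𝓕 f ξ := by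
    have := congrFun (VectorFourier.fourierIntegral_comp_add_right Real.fourierChar volume
      (innerₗ ℝ) f h) ξ
    rw [show innerₗ ℝ h ξ = h * ξ by simp [mul_comm]] at this
    exact this
  have e2 : 𝓕 (fun t => f (t + h) - f t) ξ = 𝓕 (fun t => f (t + h)) ξ - 𝓕 f ξ := by
    simp_rw [Real.fourier_real_eq, smul_sub]
    refine integral_sub ?_ ?_
    · exact (Real.fourierIntegral_convergent_iff' (.mul ℝ ℝ) ξ).2 (h1.comp_add_right h)
    · exact (Real.fourierIntegral_convergent_iff' (.mul ℝ ℝ) ξ).2 h1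
  rw [e2, e1, ← enorm_mul]
  congr 1
  ring

/-- It is enough to keep `1/(4|ξ|) < h < 1/(2|ξ|)`, where `cos(2πhξ) ≤ 0` and hence `|e^{2πihξ} -
1|² ≥ 2`. -/
lemma rpow_le_lintegral_fourierChar_sub_one {α : ℝ} (hα : 0 < α) (ξ : ℝ) :
    ENNReal.ofReal (|ξ| ^ α) ≤ ∫⁻ h in Ioi 0, ENNReal.ofReal (h ^ (-1 - α)) *
      ‖(Real.fourierChar (h * ξ) : ℂ) - 1‖ₑ ^ 2 := by
  rcases eq_or_ne ξ 0 with rfl | hξ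
  · simp [hα.ne']
  have hx : 0 < |ξ| := abs_pos.2 hξ
  calc ENNReal.ofReal (|ξ| ^ α)
      ≤ ∫⁻ h in Ioo (1 / (4 * |ξ|)) (1 / (2 * |ξ|)),
          ENNReal.ofReal ((1 / (2 * |ξ|)) ^ (-1 - α) * 2) := by
        rw [setLIntegral_const, Real.volume_Ioo, ← ENNReal.ofReal_mul (by positivity)]
        refine ENNReal.ofReal_le_ofReal ?_
        have h1 : (1 / (2 * |ξ|)) ^ (-1 - α) = (2 * |ξ|) * ((2 : ℝ) ^ α * |ξ| ^ α) := by
          rw [one_div, Real.inv_rpow (by positivity), ← Real.rpow_neg (by positivity),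
            show -(-1 - α) = 1 + α by ring, Real.rpow_add (by positivity), Real.rpow_one,
            Real.mul_rpow (by norm_num) hx.le]
        have h2 : (1 : ℝ) ≤ 2 ^ α := Real.one_le_rpow (by norm_num) hα.le
        rw [h1]
        have h3 : 2 * |ξ| * (2 ^ α * |ξ| ^ α) * 2 * (1 / (2 * |ξ|) - 1 / (4 * |ξ|)) =
          2 ^ α * |ξ| ^ α := by field_simp; ring
        rw [h3]
        exact le_mul_of_one_le_left (by positivity) h2
    _ ≤ ∫⁻ h in Ioo (1 / (4 * |ξ|)) (1 / (2 * |ξ|)), ENNReal.ofReal (h ^ (-1 - α)) *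
          ‖(Real.fourierChar (h * ξ) : ℂ) - 1‖ₑ ^ 2 := by
        refine setLIntegral_mono' measurableSet_Ioo fun h hh => ?_
        have hh0 : 0 < h := lt_trans (by positivity) hh.1
        rw [ENNReal.ofReal_mul (by positivity)]
        refine mul_le_mul' (ENNReal.ofReal_le_ofReal
          (Real.rpow_le_rpow_of_nonpos hh0 hh.2.le (by linarith))) ?_
        rw [← ofReal_norm, ← ENNReal.ofReal_pow (norm_nonneg _)]
        refine ENNReal.ofReal_le_ofReal ?_
        rw [← Complex.normSq_eq_norm_sq, Complex.normSq_apply, Real.fourierChar_apply]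
        simp only [Complex.sub_re, Complex.sub_im, Complex.exp_ofReal_mul_I_re,
          Complex.exp_ofReal_mul_I_im, Complex.one_re, Complex.one_im, sub_zero]
        have hc : Real.cos (2 * Real.pi * (h * ξ)) ≤ 0 := by
          rw [← Real.cos_abs]
          have hp := Real.pi_pos
          have e : |2 * Real.pi * (h * ξ)| = 2 * Real.pi * (h * |ξ|) := by
            rw [abs_mul, abs_mul h, abs_of_pos hh0, abs_of_pos (by positivity)]
          have l1 : 1 / 4 < h * |ξ| := by
            have := hh.1; rw [div_lt_iff₀ (by positivity)] at this; linarith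
          have l2 : h * |ξ| < 1 / 2 := by
            have := hh.2; rw [lt_div_iff₀ (by positivity)] at this; linarith
          rw [e]
          refine Real.cos_nonpos_of_pi_div_two_le_of_le ?_ ?_ <;> nlinarith
        nlinarith [Real.sin_sq_add_cos_sq (2 * Real.pi * (h * ξ))]
    _ ≤ _ := by
        refine lintegral_mono_set fun h hh => lt_trans (by positivity) hh.1

/-- The Gagliardo seminorm controls the Fourier seminorm. -/
lemma lintegral_rpow_mul_enorm_fourier_sq_le {α : ℝ} (hα : 0 < α) {f : ℝ → ℂ} (h1 : Integrable f)
    (h2 : MemLp f 2) :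
    ∫⁻ ξ, ENNReal.ofReal (|ξ| ^ α) * ‖𝓕 f ξ‖ₑ ^ 2 ≤
      ∫⁻ h in Ioi 0, ENNReal.ofReal (h ^ (-1 - α)) * ∫⁻ t, ‖f (t + h) - f t‖ₑ ^ 2 := by
  have hm : Measurable (𝓕 f) := (continuous_fourier h1).measurable
  have hfc : Continuous fun q : ℝ × ℝ => (Real.fourierChar (q.2 * q.1) : ℂ) := by
    have := Real.continuous_fourierChar
    fun_prop
  calc _ ≤ ∫⁻ ξ, ∫⁻ h in Ioi 0, ENNReal.ofReal (h ^ (-1 - α)) *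
        ‖(Real.fourierChar (h * ξ) : ℂ) - 1‖ₑ ^ 2 * ‖𝓕 f ξ‖ₑ ^ 2 := by
        refine lintegral_mono fun ξ => ?_
        rw [lintegral_mul_const' _ _ (by simp)]
        exact mul_le_mul' (rpow_le_lintegral_fourierChar_sub_one hα ξ) le_rfl
    _ = ∫⁻ h in Ioi 0, ∫⁻ ξ, ENNReal.ofReal (h ^ (-1 - α)) *
        ‖(Real.fourierChar (h * ξ) : ℂ) - 1‖ₑ ^ 2 * ‖𝓕 f ξ‖ₑ ^ 2 := by
        rw [lintegral_lintegral_swap]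
        refine Measurable.aemeasurable ?_
        unfold Function.uncurry
        have := hfc.measurable
        fun_prop
    _ = _ := by
        refine setLIntegral_congr_fun measurableSet_Ioi fun h _ => ?_
        simp_rw [mul_assoc]
        have hp := lintegral_enorm_fourier_sq ((h1.comp_add_right h).sub h1)
          ((h2.comp_measurePreserving (measurePreserving_add_right volume h)).sub h2)
        rw [lintegral_const_mul' _ _ ENNReal.ofReal_ne_top]
        refine congrArg _ (Eq.trans ?_ hp)
        refine lintegral_congr fun ξ => ?_
        rw [← mul_pow, ← enorm_fourier_comp_add_sub h1]
        rfl

/-- Substituting `2πξ` for `ξ`, the Jacobian `2π` cancels the squared unitary prefactor and the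
weight leaves `(2π)^α`. -/
lemma sobolevSeminorm_sq {T α : ℝ} (w : ℝ → ℝ) :
    sobolevSeminorm T (α / 2) w = (ENNReal.ofReal ((2 * Real.pi) ^ α) *
      ∫⁻ ξ, ENNReal.ofReal (|ξ| ^ α) *
        ‖𝓕 (fun t : ℝ => (((Ioo 0 T).indicator w t : ℝ) : ℂ)) ξ‖ₑ ^ 2) ^ (1 / 2 : ℝ) := by
  have hp : 0 < 2 * Real.pi := by positivity
  rw [sobolevSeminorm]
  congr 1
  set F := 𝓕 (fun t : ℝ => (((Ioo 0 T).indicator w t : ℝ) : ℂ)) with hF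
  have hmap := (Homeomorph.mulLeft₀ (2 * Real.pi) hp.ne').measurableEmbedding.lintegral_map
    (μ := volume) (fun ξ => ENNReal.ofReal (|ξ| ^ (2 * (α / 2)) * ‖fourierZeroExt T w ξ‖ ^ 2))
  simp only [Homeomorph.coe_mulLeft₀] at hmap
  rw [Real.map_volume_mul_left hp.ne', lintegral_smul_measure] at hmap
  rw [← lintegral_const_mul' _ _ ENNReal.ofReal_ne_top]
  have h3 : ∫⁻ ξ, ENNReal.ofReal (|ξ| ^ (2 * (α / 2)) * ‖fourierZeroExt T w ξ‖ ^ 2) =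
    ENNReal.ofReal (2 * Real.pi) * ∫⁻ ξ, ENNReal.ofReal (|2 * Real.pi * ξ| ^ (2 * (α / 2)) *
      ‖fourierZeroExt T w (2 * Real.pi * ξ)‖ ^ 2) := by
    rw [← hmap, smul_eq_mul, ← mul_assoc, ← ENNReal.ofReal_mul hp.le, abs_of_pos (by positivity),
      mul_inv_cancel₀ hp.ne', ENNReal.ofReal_one, one_mul]
  rw [h3, ← lintegral_const_mul' _ _ ENNReal.ofReal_ne_top]
  refine lintegral_congr fun ξ => ?_
  rw [fourierZeroExt, ← hF, mul_div_cancel_left₀ _ hp.ne', norm_mul, mul_pow, Complex.norm_real,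
    Real.norm_eq_abs, sq_abs, inv_pow, Real.sq_sqrt hp.le, abs_mul, abs_of_pos hp,
    mul_div_cancel₀ _ (two_ne_zero), Real.mul_rpow hp.le (abs_nonneg _),
    ← ofReal_norm, ← ENNReal.ofReal_pow (norm_nonneg _), ← ENNReal.ofReal_mul (by positivity),
    ← ENNReal.ofReal_mul (by positivity), ← ENNReal.ofReal_mul (by positivity)]
  congr 1
  field_simp
end

/-! ### From increments on `(0,T)` to the seminorm of the zero extension. -/

noncomputable section

open Set Filter

/-- Tonelli and `∫_τ^∞ h^{-1-α} dh = τ^{-α}/α`. This turns regions where the increment is estimated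
crudely into Hardy weights. -/
lemma lintegral_threshold {α : ℝ} (hα : 0 < α) {F : ℝ → ℝ≥0∞} (hFm : Measurable F) {τ : ℝ → ℝ}
    (hτ : Measurable τ) (hF : ∀ t, τ t ≤ 0 → F t = 0) :
    ∫⁻ h in Ioi 0, ENNReal.ofReal (h ^ (-1 - α)) * ∫⁻ t, {t | τ t ≤ h}.indicator F t =
      ∫⁻ t, ENNReal.ofReal (τ t ^ (-α) / α) * F t := by
  have hm : Measurable fun q : ℝ × ℝ => {t | τ t ≤ q.1}.indicator F q.2 := by
    have : (fun q : ℝ × ℝ => {t | τ t ≤ q.1}.indicator F q.2) =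
        {q : ℝ × ℝ | τ q.2 ≤ q.1}.indicator fun q => F q.2 := by
      ext q; simp [indicator_apply]
    rw [this]
    exact Measurable.indicator (by fun_prop) (measurableSet_le (by fun_prop) (by fun_prop))
  simp_rw [← lintegral_const_mul' _ _ ENNReal.ofReal_ne_top]
  rw [lintegral_lintegral_swap]
  · refine lintegral_congr fun t => ?_
    rcases le_or_gt (τ t) 0 with ht | ht
    · have : ∀ h, {t | τ t ≤ h}.indicator F t = 0 := fun h => by
        simp [indicator_apply, hF t ht]
      simp [this, hF t ht]
    · have e : ∀ h ∈ Ioi (0 : ℝ), ENNReal.ofReal (h ^ (-1 - α)) * {t | τ t ≤ h}.indicator F t =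
          (Ici (τ t)).indicator (fun h => ENNReal.ofReal (h ^ (-α - 1)) * F t) h := by
        intro h _
        rw [show -1 - α = -α - 1 by ring]
        by_cases hh : τ t ≤ h
        · rw [indicator_of_mem (show t ∈ {t | τ t ≤ h} from hh),
            indicator_of_mem (show h ∈ Ici (τ t) from hh)]
        · rw [indicator_of_notMem (show t ∉ {t | τ t ≤ h} from hh),
            indicator_of_notMem (show h ∉ Ici (τ t) from hh), mul_zero]
      rw [setLIntegral_congr_fun measurableSet_Ioi e, lintegral_indicator measurableSet_Ici,
        Measure.restrict_restrict measurableSet_Ici,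
        inter_eq_left.2 (Ici_subset_Ioi.2 ht), ← restrict_Ioi_eq_restrict_Ici,
        lintegral_mul_const _ (by fun_prop), lintegral_rpow_Ioi hα ht]
  · refine Measurable.aemeasurable ?_
    unfold Function.uncurry
    exact Measurable.mul (by fun_prop) hm

lemma enorm_sub_sq_le (a b : ℝ) : ‖a - b‖ₑ ^ 2 ≤ 2 * ‖a‖ₑ ^ 2 + 2 * ‖b‖ₑ ^ 2 := by
  simp only [← ofReal_norm]
  rw [← ENNReal.ofReal_pow (norm_nonneg _), ← ENNReal.ofReal_pow (norm_nonneg _),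
    ← ENNReal.ofReal_pow (norm_nonneg _), Real.norm_eq_abs, Real.norm_eq_abs, Real.norm_eq_abs,
    sq_abs, sq_abs, sq_abs, show (2 : ℝ≥0∞) = ENNReal.ofReal 2 by simp, ← ENNReal.ofReal_mul (by norm_num),
    ← ENNReal.ofReal_mul (by norm_num), ← ENNReal.ofReal_add (by positivity) (by positivity)]
  exact ENNReal.ofReal_le_ofReal (by nlinarith [sq_nonneg (a + b)])

lemma lintegral_add_add_add {X : Type*} [MeasurableSpace X] {μ : Measure X} {a b c : X → ℝ≥0∞}
    (ha : Measurable a) (hb : Measurable b) (hc : Measurable c) (d : X → ℝ≥0∞) :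
    ∫⁻ x, (a x + b x + c x + d x) ∂μ =
      (∫⁻ x, a x ∂μ) + (∫⁻ x, b x ∂μ) + (∫⁻ x, c x ∂μ) + ∫⁻ x, d x ∂μ := by
  rw [lintegral_add_left (by fun_prop), lintegral_add_left (by fun_prop), lintegral_add_left ha]

/-- The squared Gagliardo seminorm of `f` is controlled by two Hardy terms and the integral of its
increments over the region `0 < h < t`, `t + h < T`. -/
lemma lintegral_gagliardo_le {α T : ℝ} (hα : 0 < α) (hα₁ : α < 1) {f : ℝ → ℝ} (hf : Measurable f)
    (hf0 : ∀ t ∉ Ioo 0 T, f t = 0) {D : ℝ → ℝ → ℝ≥0∞}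
    (hD : ∀ h t, 0 < h → h < t → t + h < T → ‖f (t + h) - f t‖ₑ ≤ D h t) :
    ∫⁻ h in Ioi 0, ENNReal.ofReal (h ^ (-1 - α)) * ∫⁻ t, ‖f (t + h) - f t‖ₑ ^ 2 ≤
      ENNReal.ofReal (6 / α) * (∫⁻ t in Ioo 0 T, ENNReal.ofReal (t ^ (-α)) * ‖f t‖ₑ ^ 2) +
      ENNReal.ofReal (1 / α) * (∫⁻ t in Ioo 0 T, ENNReal.ofReal ((T - t) ^ (-α)) * ‖f t‖ₑ ^ 2) +
      ∫⁻ h in Ioi 0, ∫⁻ t in Ioi h, ENNReal.ofReal (h ^ (-1 - α)) * D h t ^ 2 := by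
  set F : ℝ → ℝ≥0∞ := fun t => ‖f t‖ₑ ^ 2 with hF
  have hFm : Measurable F := by fun_prop
  have hF0 : ∀ t ∉ Ioo 0 T, F t = 0 := fun t ht => by simp [hF, hf0 t ht]
  -- If `t ≤ h` both values are kept, the condition becoming `u/2 ≤ h` at `u = t + h`. If `T - t ≤
  -- h` then `f (t + h) = 0`. Otherwise the increment lies inside `(0,T)` and `D` bounds it.
  have hpt : ∀ h t, 0 < h → ‖f (t + h) - f t‖ₑ ^ 2 ≤
      2 * {u | u / 2 ≤ h}.indicator F (t + h) + 2 * {t | t ≤ h}.indicator F t +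
        {t | T - t ≤ h}.indicator F t + (Ioi h).indicator (fun t => D h t ^ 2) t := by
    intro h t hh
    rcases le_or_gt t h with hth | hth
    · rw [indicator_of_mem (show t + h ∈ {u | u / 2 ≤ h} by
          show (t + h) / 2 ≤ h; linarith), indicator_of_mem (show t ∈ {t | t ≤ h} from hth),
        add_assoc]
      exact (enorm_sub_sq_le _ _).trans le_self_add
    · rcases le_or_gt (T - t) h with hT | hT
      · have h0 : f (t + h) = 0 := hf0 _ fun hm => by linarith [hm.2]
        rw [indicator_of_mem (show t ∈ {t | T - t ≤ h} from hT), h0, zero_sub, enorm_neg, add_assoc]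
        exact le_self_add.trans le_add_self
      · rw [indicator_of_mem (show t ∈ Ioi h from hth)]
        exact (pow_le_pow_left' (hD h t hh hth (by linarith)) 2).trans le_add_self
  have hind : ∀ (s : Set ℝ), MeasurableSet s → Measurable (s.indicator F) :=
    fun s hs => hFm.indicator hs
  have hms : ∀ h : ℝ, MeasurableSet {u : ℝ | u / 2 ≤ h} := fun h =>
    measurableSet_le (by fun_prop) (by fun_prop)
  have hms2 : ∀ h : ℝ, MeasurableSet {t : ℝ | t ≤ h} := fun h =>
    measurableSet_le (by fun_prop) (by fun_prop)
  have hms3 : ∀ h : ℝ, MeasurableSet {t : ℝ | T - t ≤ h} := fun h =>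
    measurableSet_le (by fun_prop) (by fun_prop)
  have hinner : ∀ h, 0 < h → ∫⁻ t, ‖f (t + h) - f t‖ₑ ^ 2 ≤
      2 * (∫⁻ t, {u | u / 2 ≤ h}.indicator F t) + 2 * (∫⁻ t, {t | t ≤ h}.indicator F t) +
        (∫⁻ t, {t | T - t ≤ h}.indicator F t) + ∫⁻ t in Ioi h, D h t ^ 2 := by
    intro h hh
    refine (lintegral_mono fun t => hpt h t hh).trans (le_of_eq ?_)
    have m1 : Measurable fun t => 2 * {u | u / 2 ≤ h}.indicator F (t + h) :=
      ((hind _ (hms h)).comp (measurable_add_const h)).const_mul 2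
    have m2 : Measurable fun t => 2 * {t | t ≤ h}.indicator F t := (hind _ (hms2 h)).const_mul 2
    rw [lintegral_add_add_add m1 m2 (hind _ (hms3 h)), lintegral_const_mul' _ _ (by norm_num),
      lintegral_const_mul' _ _ (by norm_num), lintegral_indicator measurableSet_Ioi,
      lintegral_add_right_eq_self (fun t => {u | u / 2 ≤ h}.indicator F t) h]
  have hjm : ∀ τ : ℝ → ℝ, Measurable τ → Measurable fun h : ℝ =>
      ENNReal.ofReal (h ^ (-1 - α)) * ∫⁻ t, {t | τ t ≤ h}.indicator F t := by
    intro τ hτ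
    refine Measurable.mul (by fun_prop) ?_
    refine Measurable.lintegral_prod_right' (f := fun q : ℝ × ℝ => {t | τ t ≤ q.1}.indicator F q.2) ?_
    have : (fun q : ℝ × ℝ => {t | τ t ≤ q.1}.indicator F q.2) =
        {q : ℝ × ℝ | τ q.2 ≤ q.1}.indicator fun q => F q.2 := by
      ext q; simp [indicator_apply]
    rw [this]
    exact Measurable.indicator (by fun_prop) (measurableSet_le (by fun_prop) (by fun_prop))
  have j1 := hjm (fun t => t / 2) (by fun_prop)
  have j2 := hjm (fun t => t) (by fun_prop)
  have j3 := hjm (fun t => T - t) (by fun_prop)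
  have t1 := lintegral_threshold hα hFm (τ := fun t => t / 2) (by fun_prop)
    (fun t ht => hF0 t fun hm => by linarith [hm.1])
  have t2 := lintegral_threshold hα hFm (τ := fun t => t) (by fun_prop)
    (fun t ht => hF0 t fun hm => by linarith [hm.1])
  have t3 := lintegral_threshold hα hFm (τ := fun t => T - t) (by fun_prop)
    (fun t ht => hF0 t fun hm => by linarith [hm.2])
  have hsupp : ∀ (g : ℝ → ℝ≥0∞), ∫⁻ t, g t * F t = ∫⁻ t in Ioo 0 T, g t * F t := fun g => by
    rw [← lintegral_indicator measurableSet_Ioo]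
    refine lintegral_congr fun t => ?_
    by_cases ht : t ∈ Ioo 0 T
    · rw [indicator_of_mem ht]
    · rw [indicator_of_notMem ht, hF0 t ht, mul_zero]
  calc _ ≤ ∫⁻ h in Ioi 0,
        (2 * (ENNReal.ofReal (h ^ (-1 - α)) * ∫⁻ t, {u | u / 2 ≤ h}.indicator F t) +
        2 * (ENNReal.ofReal (h ^ (-1 - α)) * ∫⁻ t, {t | t ≤ h}.indicator F t) +
        ENNReal.ofReal (h ^ (-1 - α)) * (∫⁻ t, {t | T - t ≤ h}.indicator F t) +
        ∫⁻ t in Ioi h, ENNReal.ofReal (h ^ (-1 - α)) * D h t ^ 2) := by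
        refine setLIntegral_mono' measurableSet_Ioi fun h hh => ?_
        refine (mul_le_mul' le_rfl (hinner h hh)).trans (le_of_eq ?_)
        rw [lintegral_const_mul' _ _ ENNReal.ofReal_ne_top]
        ring
    _ ≤ _ := by
        rw [lintegral_add_add_add (j1.const_mul 2) (j2.const_mul 2) j3,
          lintegral_const_mul' _ _ (by norm_num),
          lintegral_const_mul' _ _ (by norm_num), t1, t2, t3, hsupp, hsupp, hsupp,
          ← lintegral_const_mul' _ _ (by norm_num), ← lintegral_const_mul' _ _ (by norm_num),
          ← lintegral_const_mul' _ _ ENNReal.ofReal_ne_top,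
          ← lintegral_const_mul' _ _ ENNReal.ofReal_ne_top,
          ← lintegral_add_left (by fun_prop)]
        refine add_le_add (add_le_add ?_ ?_) le_rfl
        · refine setLIntegral_mono' measurableSet_Ioo fun t ht => ?_
          have ht0 := ht.1
          rw [← mul_assoc, ← mul_assoc, ← mul_assoc, ← add_mul]
          refine mul_le_mul' ?_ le_rfl
          rw [show (2 : ℝ≥0∞) = ENNReal.ofReal 2 by simp, ← ENNReal.ofReal_mul (by norm_num),
            ← ENNReal.ofReal_mul (by norm_num), ← ENNReal.ofReal_mul (by positivity),
            ← ENNReal.ofReal_add (by positivity) (by positivity)]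
          refine ENNReal.ofReal_le_ofReal ?_
          have h2 : (t / 2) ^ (-α) ≤ 2 * t ^ (-α) := by
            rw [Real.div_rpow ht0.le (by norm_num), Real.rpow_neg (by norm_num : (0 : ℝ) ≤ 2),
              div_inv_eq_mul, mul_comm]
            gcongr
            calc (2 : ℝ) ^ α ≤ 2 ^ (1 : ℝ) :=
                  Real.rpow_le_rpow_of_exponent_le (by norm_num) hα₁.le
              _ = 2 := Real.rpow_one _
          -- The constant `6` is `2·2` from the shifted threshold `t/2` plus `2` from the threshold
          -- `t`.
          calc 2 * ((t / 2) ^ (-α) / α) + 2 * (t ^ (-α) / α)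
              ≤ 2 * (2 * t ^ (-α) / α) + 2 * (t ^ (-α) / α) := by gcongr
            _ = _ := by ring
        · refine setLIntegral_mono' measurableSet_Ioo fun t ht => ?_
          have ht0 : 0 < T - t := by linarith [ht.2]
          rw [← mul_assoc, ← ENNReal.ofReal_mul (by positivity)]
          refine mul_le_mul' (ENNReal.ofReal_le_ofReal (le_of_eq ?_)) le_rfl
          ring

/-- `I^α` maps the weighted space `L²(s^α)` boundedly into the Gagliardo space of order `α / 2`, up
to a Hardy term at the right end point. -/
lemma exists_fourier_le {α : ℝ} (hα : 0 < α) (hα₁ : α < 1) :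
    ∃ C : ℝ, 0 < C ∧ ∀ (T : ℝ) (w g : ℝ → ℝ), Continuous w → Measurable g →
      (∀ t ∈ Ioo 0 T, IntegrableOn (fun s => posPow α (t - s) * g s) (Ioo 0 T)) →
      (∀ t ∈ Ioo 0 T, w t = ∫ s in Ioo 0 T, posPow α (t - s) * g s) →
      ∫⁻ ξ, ENNReal.ofReal (|ξ| ^ α) *
        ‖𝓕 (fun t : ℝ => (((Ioo 0 T).indicator w t : ℝ) : ℂ)) ξ‖ₑ ^ 2 ≤
      ENNReal.ofReal C * ((∫⁻ s in Ioo 0 T, ENNReal.ofReal (s ^ α) * ‖g s‖ₑ ^ 2) +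
        ∫⁻ t in Ioo 0 T, ENNReal.ofReal ((T - t) ^ (-α)) * ‖w t‖ₑ ^ 2) := by
  obtain ⟨C₁, hC₁, hH⟩ := exists_hardy hα hα₁
  obtain ⟨C₂, hC₂, hG⟩ := exists_gagliardo hα hα₁
  refine ⟨6 / α * C₁ + C₂ + 1 / α, by positivity, fun T w g hw hg hint hwg => ?_⟩
  set f : ℝ → ℝ := (Ioo 0 T).indicator w with hf
  set G : ℝ → ℝ≥0∞ := (Ioo 0 T).indicator fun s => ‖g s‖ₑ with hGdef
  have hGm : Measurable G := Measurable.indicator (by fun_prop) measurableSet_Ioo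
  have hfm : Measurable f := hw.measurable.indicator measurableSet_Ioo
  have hbd : ∀ k : ℝ → ℝ, ‖∫ s in Ioo 0 T, k s * g s‖ₑ ≤ ∫⁻ s in Ioi 0, ‖k s‖ₑ * G s := by
    intro k
    refine (enorm_integral_le_lintegral_enorm _).trans ?_
    have hsub : Ioo 0 T ∩ Ioi 0 = Ioo 0 T := inter_eq_left.2 Ioo_subset_Ioi_self
    rw [← hsub, ← Measure.restrict_restrict measurableSet_Ioo,
      ← lintegral_indicator measurableSet_Ioo]
    refine lintegral_mono fun s => ?_
    by_cases hs : s ∈ Ioo 0 T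
    · simp [hs, hGdef, enorm_mul]
    · simp [hs]
  have hfw : ∀ t ∈ Ioo 0 T, f t = w t := fun t ht => indicator_of_mem ht w
  have hGint : ∫⁻ s in Ioi 0, ENNReal.ofReal (s ^ α) * G s ^ 2 =
      ∫⁻ s in Ioo 0 T, ENNReal.ofReal (s ^ α) * ‖g s‖ₑ ^ 2 := by
    have hsub : Ioo 0 T ∩ Ioi 0 = Ioo 0 T := inter_eq_left.2 Ioo_subset_Ioi_self
    rw [← hsub, ← Measure.restrict_restrict measurableSet_Ioo,
      ← lintegral_indicator measurableSet_Ioo]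
    refine lintegral_congr fun s => ?_
    by_cases hs : s ∈ Ioo 0 T
    · simp [hs, hGdef]
    · simp [hs, hGdef]
  have hhardy : ∫⁻ t in Ioo 0 T, ENNReal.ofReal (t ^ (-α)) * ‖f t‖ₑ ^ 2 ≤
      ENNReal.ofReal C₁ * ∫⁻ s in Ioo 0 T, ENNReal.ofReal (s ^ α) * ‖g s‖ₑ ^ 2 := by
    rw [← hGint]
    refine le_trans ?_ (hH G hGm)
    refine le_trans ?_ (lintegral_mono_set (Ioo_subset_Ioi_self : Ioo 0 T ⊆ Ioi 0))
    refine setLIntegral_mono' measurableSet_Ioo fun t ht => ?_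
    rw [hfw t ht, hwg t ht]
    exact mul_le_mul' le_rfl (pow_le_pow_left' (hbd _) 2)
  have hD : ∀ h t, 0 < h → h < t → t + h < T → ‖f (t + h) - f t‖ₑ ≤
      ∫⁻ s in Ioi 0, ‖posPow α (t + h - s) - posPow α (t - s)‖ₑ * G s := by
    intro h t hh hht hT
    have ht1 : t ∈ Ioo 0 T := ⟨by linarith, by linarith⟩
    have ht2 : t + h ∈ Ioo 0 T := ⟨by linarith, by linarith⟩
    rw [hfw _ ht1, hfw _ ht2, hwg _ ht1, hwg _ ht2, ← integral_sub (hint _ ht2) (hint _ ht1)]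
    simp_rw [← sub_mul]
    exact hbd _
  have hmain := lintegral_gagliardo_le hα hα₁ hfm (fun t ht => indicator_of_notMem ht w) hD
  obtain ⟨B, hB⟩ := (isCompact_Icc (a := (0 : ℝ)) (b := T)).exists_bound_of_continuousOn
    hw.continuousOn
  have hfint : IntegrableOn w (Ioo 0 T) :=
    (hw.continuousOn.integrableOn_compact isCompact_Icc).mono_set Ioo_subset_Icc_self
  have h1 : Integrable fun t : ℝ => ((f t : ℝ) : ℂ) :=
    ((integrable_indicator_iff measurableSet_Ioo).2 hfint).ofReal
  have h2 : MemLp (fun t : ℝ => ((f t : ℝ) : ℂ)) 2 := by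
    have : MemLp f 2 := by
      rw [hf, memLp_indicator_iff_restrict measurableSet_Ioo]
      refine MemLp.of_bound hw.aestronglyMeasurable B ?_
      exact (ae_restrict_iff' measurableSet_Ioo).2 (.of_forall fun t ht =>
        hB t (Ioo_subset_Icc_self ht))
    exact this.ofReal
  refine (lintegral_rpow_mul_enorm_fourier_sq_le hα h1 h2).trans ?_
  have e : ∀ t h : ℝ, ‖((f (t + h) : ℝ) : ℂ) - ((f t : ℝ) : ℂ)‖ₑ = ‖f (t + h) - f t‖ₑ := by
    intro t h
    rw [← Complex.ofReal_sub, ← ofReal_norm, ← ofReal_norm, Complex.norm_real]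
  simp_rw [e]
  refine hmain.trans ?_
  have hw2 : ∫⁻ t in Ioo 0 T, ENNReal.ofReal ((T - t) ^ (-α)) * ‖f t‖ₑ ^ 2 =
      ∫⁻ t in Ioo 0 T, ENNReal.ofReal ((T - t) ^ (-α)) * ‖w t‖ₑ ^ 2 :=
    setLIntegral_congr_fun measurableSet_Ioo fun t ht => by rw [hfw t ht]
  rw [hw2]
  set X := ∫⁻ s in Ioo 0 T, ENNReal.ofReal (s ^ α) * ‖g s‖ₑ ^ 2 with hX
  set Z := ∫⁻ t in Ioo 0 T, ENNReal.ofReal ((T - t) ^ (-α)) * ‖w t‖ₑ ^ 2 with hZ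
  calc _ ≤ ENNReal.ofReal (6 / α) * (ENNReal.ofReal C₁ * X) + ENNReal.ofReal (1 / α) * Z +
        ENNReal.ofReal C₂ * X := by
        have h3 := hG G hGm
        rw [hGint] at h3
        exact add_le_add (add_le_add (mul_le_mul' le_rfl hhardy) le_rfl) h3
    _ = ENNReal.ofReal (6 / α * C₁ + C₂) * X + ENNReal.ofReal (1 / α) * Z := by
        rw [ENNReal.ofReal_add (by positivity) hC₂.le, ENNReal.ofReal_mul (by positivity)]
        ring
    _ ≤ _ := by
        rw [mul_add]
        refine add_le_add (mul_le_mul' (ENNReal.ofReal_le_ofReal ?_) le_rfl)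
          (mul_le_mul' (ENNReal.ofReal_le_ofReal ?_) le_rfl)
        · have : 0 < 1 / α := by positivity
          linarith
        · have : 0 < 6 / α * C₁ := by positivity
          linarith
end

/-! ### Fractional integration of Jacobi polynomials. -/

noncomputable section

open Set Polynomial ProbabilityTheory

lemma measurePreserving_reflect (T : ℝ) :
    MeasurePreserving (fun t : ℝ => T - t) (volume.restrict (Ioo 0 T)) (volume.restrict (Ioo 0 T)) := by
  have h := (Measure.measurePreserving_sub_left (volume : Measure ℝ) T).restrict_preimage
    (measurableSet_Ioo (a := 0) (b := T))
  simpa using h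

lemma measurableEmbedding_reflect (T : ℝ) : MeasurableEmbedding fun t : ℝ => T - t :=
  (MeasurableEquiv.subLeft T).measurableEmbedding

lemma integral_reflect (T : ℝ) (f : ℝ → ℝ) :
    ∫ s in Ioo 0 T, f (T - s) = ∫ s in Ioo 0 T, f s :=
  (measurePreserving_reflect T).integral_comp (measurableEmbedding_reflect T) f

lemma lintegral_reflect (T : ℝ) (f : ℝ → ℝ≥0∞) :
    ∫⁻ s in Ioo 0 T, f (T - s) = ∫⁻ s in Ioo 0 T, f s :=
  (measurePreserving_reflect T).lintegral_comp_emb (measurableEmbedding_reflect T) f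

/-- The polynomial `t ↦ ∫_0^t (t-s)^(α-1) s^(-α) q(s) ds`. -/
def fracPoly (α : ℝ) (q : ℝ[X]) : ℝ[X] :=
  ∑ j ∈ Finset.range (q.natDegree + 1), monomial j (q.coeff j * beta (j + 1 - α) α)

variable {α T : ℝ}

lemma eval_fracPoly (q : ℝ[X]) (t : ℝ) : (fracPoly α q).eval t =
    ∑ j ∈ Finset.range (q.natDegree + 1), q.coeff j * (beta (j + 1 - α) α * t ^ j) := by
  simp [fracPoly, eval_finsetSum, mul_assoc]

lemma coeff_fracPoly (q : ℝ[X]) (k : ℕ) :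
    (fracPoly α q).coeff k = q.coeff k * beta (k + 1 - α) α := by
  simp only [fracPoly, finsetSum_coeff, coeff_monomial, Finset.sum_ite_eq', Finset.mem_range]
  split_ifs with h
  · rfl
  · rw [coeff_eq_zero_of_natDegree_lt (by omega), zero_mul]

lemma natDegree_fracPoly (q : ℝ[X]) : (fracPoly α q).natDegree ≤ q.natDegree :=
  natDegree_le_iff_coeff_eq_zero.2 fun k hk => by
    rw [coeff_fracPoly, coeff_eq_zero_of_natDegree_lt hk, zero_mul]

lemma posPow_mul_rpow_mul_eval (q : ℝ[X]) {t s : ℝ} (hs : s ∈ Ioo 0 T) :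
    posPow α (t - s) * (s ^ (-α) * q.eval s) = (Ioo 0 t).indicator (fun s =>
      ∑ j ∈ Finset.range (q.natDegree + 1),
        q.coeff j * (s ^ ((j : ℝ) + 1 - α - 1) * (t - s) ^ (α - 1))) s := by
  by_cases h : s < t
  · rw [indicator_of_mem (show s ∈ Ioo 0 t from ⟨hs.1, h⟩), posPow, if_pos (sub_pos.2 h),
      eval_eq_sum_range, Finset.mul_sum, Finset.mul_sum]
    refine Finset.sum_congr rfl fun j _ => ?_
    rw [show (j : ℝ) + 1 - α - 1 = j + -α by ring, Real.rpow_add hs.1, Real.rpow_natCast]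
    ring
  · rw [indicator_of_notMem fun hm => h hm.2, posPow, if_neg (by linarith), zero_mul]

lemma integrableOn_fracPoly (hα₀ : 0 < α) (hα : α < 1) (q : ℝ[X]) {t : ℝ} (ht : t ∈ Ioo 0 T) :
    IntegrableOn (fun s => posPow α (t - s) * (s ^ (-α) * q.eval s)) (Ioo 0 T) ∧
      ∫ s in Ioo 0 T, posPow α (t - s) * (s ^ (-α) * q.eval s) = (fracPoly α q).eval t := by
  have hj : ∀ j : ℕ, (0 : ℝ) < j + 1 - α := fun j => by
    have := j.cast_nonneg (α := ℝ); linarith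
  have hint : ∀ j ∈ Finset.range (q.natDegree + 1), IntegrableOn (fun s : ℝ =>
      q.coeff j * (s ^ ((j : ℝ) + 1 - α - 1) * (t - s) ^ (α - 1))) (Ioo 0 t) := fun j _ =>
    (integrableOn_beta ht.1 (hj j) hα₀).const_mul _
  have hsub : Ioo 0 t ∩ Ioo 0 T = Ioo 0 t := inter_eq_left.2 (Ioo_subset_Ioo_right ht.2.le)
  have hsub' : Ioo 0 T ∩ Ioo 0 t = Ioo 0 t := inter_eq_right.2 (Ioo_subset_Ioo_right ht.2.le)
  constructor
  · refine IntegrableOn.congr_fun ?_ (fun s hs => (posPow_mul_rpow_mul_eval q hs).symm)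
      measurableSet_Ioo
    rw [IntegrableOn, integrable_indicator_iff measurableSet_Ioo, IntegrableOn,
      Measure.restrict_restrict measurableSet_Ioo, hsub]
    exact integrable_finsetSum _ hint
  · rw [setIntegral_congr_fun measurableSet_Ioo fun s hs => posPow_mul_rpow_mul_eval q hs,
      setIntegral_indicator measurableSet_Ioo, hsub', integral_finsetSum _ hint, eval_fracPoly]
    refine Finset.sum_congr rfl fun j _ => ?_
    rw [integral_const_mul, integral_beta ht.1 (hj j) hα₀,
      show (j : ℝ) + 1 - α + α - 1 = j by ring, Real.rpow_natCast]
    ring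

/-- Fractional integration by parts: the right-sided fractional integral of `(T-t)^{m-α}` is a
multiple of `(T-t)^m`. On monomials this is an identity between Beta functions. -/
lemma integral_fracPoly_mul_pow (hα₀ : 0 < α) (hα : α < 1) (hT : 0 < T) (q : ℝ[X]) (m : ℕ) :
    ∫ t in Ioo 0 T, (fracPoly α q).eval t * (T - t) ^ m * (T - t) ^ (-α) =
      Real.Gamma α * Real.Gamma (m + 1 - α) / Real.Gamma (m + 1) *
        ∫ s in Ioo 0 T, q.eval s * (T - s) ^ m * s ^ (-α) := by
  have hj : ∀ j : ℕ, (0 : ℝ) < j + 1 - α := fun j => by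
    have := j.cast_nonneg (α := ℝ); linarith
  have hj' : ∀ j : ℕ, (0 : ℝ) < j + 1 := fun j => by positivity
  have e1 : ∀ t ∈ Ioo 0 T, (fracPoly α q).eval t * (T - t) ^ m * (T - t) ^ (-α) =
      ∑ j ∈ Finset.range (q.natDegree + 1), q.coeff j * beta (j + 1 - α) α *
        (t ^ ((j : ℝ) + 1 - 1) * (T - t) ^ ((m : ℝ) + 1 - α - 1)) := by
    intro t ht
    have hTt : 0 < T - t := sub_pos.2 ht.2
    rw [eval_fracPoly, Finset.sum_mul, Finset.sum_mul]
    refine Finset.sum_congr rfl fun j _ => ?_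
    rw [show (m : ℝ) + 1 - α - 1 = m + -α by ring, Real.rpow_add hTt, Real.rpow_natCast,
      add_sub_cancel_right, Real.rpow_natCast]
    ring
  have e2 : ∀ s ∈ Ioo 0 T, q.eval s * (T - s) ^ m * s ^ (-α) =
      ∑ j ∈ Finset.range (q.natDegree + 1), q.coeff j *
        (s ^ ((j : ℝ) + 1 - α - 1) * (T - s) ^ ((m : ℝ) + 1 - 1)) := by
    intro s hs
    rw [eval_eq_sum_range, Finset.sum_mul, Finset.sum_mul]
    refine Finset.sum_congr rfl fun j _ => ?_
    rw [show (j : ℝ) + 1 - α - 1 = j + -α by ring, Real.rpow_add hs.1, Real.rpow_natCast,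
      add_sub_cancel_right, Real.rpow_natCast]
    ring
  rw [setIntegral_congr_fun measurableSet_Ioo e1, setIntegral_congr_fun measurableSet_Ioo e2,
    integral_finsetSum _ fun j _ => (integrableOn_beta hT (hj' j) (hj m)).const_mul _,
    integral_finsetSum _ fun j _ => (integrableOn_beta hT (hj j) (hj' m)).const_mul _,
    Finset.mul_sum]
  refine Finset.sum_congr rfl fun j _ => ?_
  rw [integral_const_mul, integral_const_mul, integral_beta hT (hj' j) (hj m),
    integral_beta hT (hj j) (hj' m), beta, beta, beta,
    show (j : ℝ) + 1 + (m + 1 - α) = j + 1 - α + (m + 1) by ring,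
    show (j : ℝ) + 1 - α + α = j + 1 by ring]
  have g1 := Real.Gamma_pos_of_pos (hj' j)
  have g2 := Real.Gamma_pos_of_pos (hj' m)
  field_simp

lemma coeff_comp_C_sub_X (p : ℝ[X]) {k : ℕ} (hp : p.natDegree ≤ k) :
    (p.comp (C T - X)).coeff k = (-1) ^ k * p.coeff k := by
  have hdeg : (C T - X : ℝ[X]).natDegree = 1 := by
    rw [natDegree_sub, natDegree_X_sub_C]
  rcases hp.lt_or_eq with h | h
  · rw [coeff_eq_zero_of_natDegree_lt h, mul_zero, coeff_eq_zero_of_natDegree_lt]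
    rwa [natDegree_comp, hdeg, mul_one]
  · have := coeff_comp_degree_mul_degree (p := p) (q := C T - X) (by rw [hdeg]; norm_num)
    rw [hdeg, mul_one, h] at this
    rw [this, leadingCoeff, leadingCoeff, hdeg, h]
    simp [mul_comm]

lemma natDegree_comp_C_sub_X (p : ℝ[X]) : (p.comp (C T - X)).natDegree = p.natDegree := by
  rw [natDegree_comp, natDegree_sub, natDegree_X_sub_C, mul_one]

/-- Moments against `(T-t)^m` suffice. After fractional integration by parts and the reflection `s ↦
T - s` they pair `S_k` with `s^m`, `m < k`, in the original weight. -/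
lemma integral_fracPoly_mul_eq_zero (hα₀ : 0 < α) (hα : α < 1) (hT : 0 < T) {k : ℕ} {p : ℝ[X]}
    (hp : p.natDegree < k) :
    ∫ t in Ioo 0 T, (fracPoly α ((jacobiPoly α T k).comp (C T - X))).eval t * p.eval t *
      (T - t) ^ (-α) = 0 := by
  set q := (jacobiPoly α T k).comp (C T - X) with hq
  have hmom : ∀ m < k, ∫ t in Ioo 0 T, (fracPoly α q).eval t * (T - t) ^ m * (T - t) ^ (-α) = 0 := by
    intro m hm
    rw [integral_fracPoly_mul_pow hα₀ hα hT, ← integral_reflect]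
    have h0 := integral_jacobiPoly_mul_eq_zero hα hT (p := X ^ m) (k := k) (by simpa using hm)
    refine mul_eq_zero_of_right _ (Eq.trans (integral_congr_ae (.of_forall fun s => ?_)) h0)
    simp only [hq, eval_comp, eval_sub, eval_C, eval_X, eval_pow, sub_sub_cancel]
    ring
  have hpe : ∀ t, p.eval t =
      ∑ m ∈ Finset.range k, (p.comp (C T - X)).coeff m * (T - t) ^ m := by
    intro t
    rw [← eval_eq_sum_range' (by rwa [natDegree_comp_C_sub_X])]
    simp
  have e : ∀ t, (fracPoly α q).eval t * p.eval t * (T - t) ^ (-α) =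
      ∑ m ∈ Finset.range k, (p.comp (C T - X)).coeff m *
        ((fracPoly α q).eval t * (T - t) ^ m * (T - t) ^ (-α)) := by
    intro t
    rw [hpe, Finset.mul_sum, Finset.sum_mul]
    exact Finset.sum_congr rfl fun m _ => by ring
  have h1 := fun m : ℕ => integral_jacobiMeasure (α := α) (T := T)
    fun t => (p.comp (C T - X)).coeff m * ((fracPoly α q).eval t * (T - t) ^ m)
  have h2 := integral_jacobiMeasure (α := α) (T := T) fun t => ∑ m ∈ Finset.range k,
    (p.comp (C T - X)).coeff m * ((fracPoly α q).eval t * (T - t) ^ m)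
  rw [integral_finsetSum _ fun m _ => integrable_jacobiMeasure hα hT (by fun_prop)] at h2
  simp_rw [e]
  simp_rw [Finset.sum_mul, mul_assoc] at h2 ⊢
  rw [← h2]
  refine Finset.sum_eq_zero fun m hm => ?_
  have h3 := h1 m
  rw [h3]
  simp_rw [mul_assoc]
  rw [integral_const_mul]
  have := hmom m (Finset.mem_range.1 hm)
  simp_rw [mul_assoc] at this
  rw [this, mul_zero]

/-- Fractional integration maps `s^(-α) S_k(T - s)` to a multiple of `S_k`. -/
lemma fracPoly_jacobiPoly (hα₀ : 0 < α) (hα : α < 1) (hT : 0 < T) (k : ℕ) :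
    fracPoly α ((jacobiPoly α T k).comp (C T - X)) =
      C ((-1) ^ k * beta (k + 1 - α) α) * jacobiPoly α T k := by
  set q := (jacobiPoly α T k).comp (C T - X) with hq
  have hqd : q.natDegree ≤ k := by rw [hq, natDegree_comp_C_sub_X]; exact natDegree_jacobiPoly k
  obtain ⟨a, ha⟩ := exists_eq_sum_jacobiPoly hα hT (k + 1) (fracPoly α q)
    (by have := natDegree_fracPoly (α := α) q; omega)
  have ha0 : ∀ j < k, a j = 0 := by
    intro j hj
    have h0 := integral_fracPoly_mul_eq_zero hα₀ hα hT (k := k)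
      ((natDegree_jacobiPoly (α := α) (T := T) j).trans_lt hj)
    rw [← hq, ha, ← integral_jacobiMeasure (α := α)
      fun t => eval t (∑ k ∈ Finset.range (k + 1), C (a k) * jacobiPoly α T k) *
        eval t (jacobiPoly α T j)] at h0
    simp_rw [eval_finsetSum, eval_mul, eval_C, Finset.sum_mul, mul_assoc] at h0
    rw [integral_finsetSum _ fun m _ => integrable_jacobiMeasure hα hT (by fun_prop)] at h0
    simp_rw [integral_const_mul, integral_jacobiMeasure, integral_jacobiPoly_mul hα hT] at h0
    rw [Finset.sum_eq_single j (fun i _ hi => by rw [if_neg hi, mul_zero])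
      (fun h => absurd (Finset.mem_range.2 (by omega)) h), if_pos rfl] at h0
    have hp := jacobiNormSq_pos hα hT j
    rw [jacobiNormSq_eq hα] at hp
    exact (mul_eq_zero.1 h0).resolve_right hp.ne'
  have hk : fracPoly α q = C (a k) * jacobiPoly α T k := by
    rw [ha, Finset.sum_range_succ, Finset.sum_eq_zero, zero_add]
    intro j hj
    rw [ha0 j (Finset.mem_range.1 hj), map_zero, zero_mul]
  -- Orthogonality has left a multiple of `S_k`; the top coefficients identify it, the sign `(-1)^k`
  -- coming from the reflection.
  have hc := congrArg (fun p => p.coeff k) hk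
  simp only [coeff_fracPoly, coeff_C_mul, hq, coeff_comp_C_sub_X _ (natDegree_jacobiPoly k)] at hc
  have hne := coeff_jacobiPoly_ne_zero hα hT k
  rw [hk]
  congr 2
  refine mul_right_cancel₀ hne ?_
  rw [← hc]; ring

/-- `B(k+1-α, α) = Γ(k+1-α) Γ(α) / Γ(k+1)` is of order `k^{-α}`; only the lower bound is needed. -/
lemma exists_inv_beta_sq_le (hα₀ : 0 < α) (hα : α < 1) : ∃ C : ℝ, 0 < C ∧ ∀ k : ℕ, 1 ≤ k →
    (beta (k + 1 - α) α)⁻¹ ^ 2 ≤ C * (k : ℝ) ^ (2 * α) := by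
  have hG := Real.Gamma_pos_of_pos hα₀
  refine ⟨(2 / Real.Gamma α) ^ 2, by positivity, fun k hk => ?_⟩
  have hk' : (1 : ℝ) ≤ k := by exact_mod_cast hk
  have h1 := Gamma_add_le (x := k + 1 - α) (s := α) (by linarith) hα₀ hα
  rw [show (k : ℝ) + 1 - α + α = k + 1 by ring] at h1
  have hG1 := Real.Gamma_pos_of_pos (show 0 < (k : ℝ) + 1 - α by linarith)
  have h2 : ((k : ℝ) + 1 - α) ^ α ≤ 2 * (k : ℝ) ^ α := by
    calc ((k : ℝ) + 1 - α) ^ α ≤ (2 * k) ^ α :=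
          Real.rpow_le_rpow (by linarith) (by linarith) hα₀.le
      _ = 2 ^ α * (k : ℝ) ^ α := Real.mul_rpow (by norm_num) (by linarith)
      _ ≤ 2 * (k : ℝ) ^ α := by
          gcongr
          calc (2 : ℝ) ^ α ≤ 2 ^ (1 : ℝ) :=
                Real.rpow_le_rpow_of_exponent_le (by norm_num) hα.le
            _ = 2 := Real.rpow_one _
  have h3 : (beta (k + 1 - α) α)⁻¹ ≤ 2 / Real.Gamma α * (k : ℝ) ^ α := by
    rw [beta, show (k : ℝ) + 1 - α + α = k + 1 by ring, inv_div, div_le_iff₀ (by positivity)]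
    calc Real.Gamma (k + 1) ≤ 2 * (k : ℝ) ^ α * Real.Gamma (k + 1 - α) :=
          h1.trans (mul_le_mul_of_nonneg_right h2 hG1.le)
      _ = _ := by field_simp
  have h4 : 0 ≤ (beta (k + 1 - α) α)⁻¹ := inv_nonneg.2 (beta_pos (by linarith) hα₀).le
  calc (beta (k + 1 - α) α)⁻¹ ^ 2 ≤ (2 / Real.Gamma α * (k : ℝ) ^ α) ^ 2 := by gcongr
    _ = _ := by
        rw [mul_pow, ← Real.rpow_natCast ((k : ℝ) ^ α), ← Real.rpow_mul (by linarith)]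
        norm_num [mul_comm]

lemma lintegral_sum_jacobiPoly_sq (hα : α < 1) (hT : 0 < T) (s : Finset ℕ) (a : ℕ → ℝ) :
    ∫⁻ t in Ioo 0 T, ENNReal.ofReal ((T - t) ^ (-α)) *
      ‖∑ k ∈ s, a k * (jacobiPoly α T k).eval t‖ₑ ^ 2 =
      ENNReal.ofReal (∑ k ∈ s, a k ^ 2 * jacobiNormSq T (-α) 0 k) := by
  rw [← integral_sum_jacobiPoly_sq hα hT, ← lintegral_jacobiMeasure,
    ofReal_integral_eq_lintegral_ofReal (integrable_jacobiMeasure hα hT (by fun_prop))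
      (.of_forall fun t => sq_nonneg _)]
  refine lintegral_congr fun t => ?_
  rw [← ofReal_norm, ← ENNReal.ofReal_pow (norm_nonneg _), Real.norm_eq_abs, sq_abs]

/-- Weighted coefficient bound for the Fourier seminorm of a Jacobi polynomial expansion without
constant term. -/
lemma exists_fourier_sum_jacobiPoly_le (hα₀ : 0 < α) (hα : α < 1) (hT : 0 < T) :
    ∃ C : ℝ, 0 < C ∧ ∀ (s : Finset ℕ) (b : ℕ → ℝ), (∀ k ∈ s, 1 ≤ k) →
      ∫⁻ ξ, ENNReal.ofReal (|ξ| ^ α) * ‖𝓕 (fun t : ℝ => (((Ioo 0 T).indicator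
        (fun t => ∑ k ∈ s, b k * (jacobiPoly α T k).eval t) t : ℝ) : ℂ)) ξ‖ₑ ^ 2 ≤
      ENNReal.ofReal (C * ∑ k ∈ s, (k : ℝ) ^ (2 * α) * (b k ^ 2 * jacobiNormSq T (-α) 0 k)) := by
  obtain ⟨C₁, hC₁, h1⟩ := exists_fourier_le hα₀ hα
  obtain ⟨C₂, hC₂, h2⟩ := exists_inv_beta_sq_le hα₀ hα
  refine ⟨C₁ * (C₂ + 1), by positivity, fun s b hs => ?_⟩
  -- These coefficients undo the eigenvalues in `fracPoly_jacobiPoly`, so that integrating `g`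
  -- against the kernel returns `∑ b_k S_k`.
  set a : ℕ → ℝ := fun k => (-1) ^ k * (beta (k + 1 - α) α)⁻¹ * b k with ha
  set g : ℝ → ℝ := fun t => t ^ (-α) *
    ∑ k ∈ s, a k * ((jacobiPoly α T k).comp (C T - X)).eval t with hg
  have hβ : ∀ k : ℕ, beta (k + 1 - α) α ≠ 0 := fun k =>
    (beta_pos (by have := k.cast_nonneg (α := ℝ); linarith) hα₀).ne'
  have hgs : ∀ t u : ℝ, posPow α (t - u) * g u = ∑ k ∈ s,
      a k * (posPow α (t - u) * (u ^ (-α) * ((jacobiPoly α T k).comp (C T - X)).eval u)) := by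
    intro t u
    rw [hg]
    simp only [Finset.mul_sum]
    exact Finset.sum_congr rfl fun k _ => by ring
  have hint : ∀ t ∈ Ioo 0 T, ∀ k ∈ s, IntegrableOn (fun u =>
      a k * (posPow α (t - u) * (u ^ (-α) * ((jacobiPoly α T k).comp (C T - X)).eval u)))
      (Ioo 0 T) := fun t ht k _ => (integrableOn_fracPoly hα₀ hα _ ht).1.const_mul _
  refine (h1 T _ g (by fun_prop) (by fun_prop) (fun t ht => ?_) (fun t ht => ?_)).trans ?_
  · simp_rw [hgs]
    exact integrable_finsetSum _ (hint t ht)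
  · simp_rw [hgs]
    rw [integral_finsetSum _ (hint t ht)]
    refine Finset.sum_congr rfl fun k _ => ?_
    rw [integral_const_mul, (integrableOn_fracPoly hα₀ hα _ ht).2, fracPoly_jacobiPoly hα₀ hα hT,
      eval_mul, eval_C, ha]
    have h3 : ((-1 : ℝ) ^ k) * (-1) ^ k = 1 := by rw [← mul_pow]; simp
    have h4 := hβ k
    field_simp
    rw [sq, h3, mul_one]
  -- Since `t^α (t^{-α})² = t^{-α}`, reflection turns this into the weighted norm of `∑ a_k S_k`,
  -- where orthogonality applies.
  · have e1 : ∫⁻ t in Ioo 0 T, ENNReal.ofReal (t ^ α) * ‖g t‖ₑ ^ 2 =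
        ENNReal.ofReal (∑ k ∈ s, a k ^ 2 * jacobiNormSq T (-α) 0 k) := by
      rw [← lintegral_sum_jacobiPoly_sq hα hT, ← lintegral_reflect]
      refine setLIntegral_congr_fun measurableSet_Ioo fun t ht => ?_
      have hTt : 0 < T - t := sub_pos.2 ht.2
      rw [hg]
      simp only [eval_comp, eval_sub, eval_C, eval_X, sub_sub_cancel]
      rw [enorm_mul, mul_pow, ← mul_assoc]
      congr 1
      rw [Real.enorm_of_nonneg (by positivity), ← ENNReal.ofReal_pow (by positivity),
        ← ENNReal.ofReal_mul (by positivity), sq, ← mul_assoc, ← Real.rpow_add hTt,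
        add_neg_cancel, Real.rpow_zero, one_mul]
    have hn : ∀ k, 0 < jacobiNormSq T (-α) 0 k := fun k => jacobiNormSq_pos hα hT k
    have hsn : ∀ c : ℕ → ℝ, 0 ≤ ∑ k ∈ s, c k ^ 2 * jacobiNormSq T (-α) 0 k := fun c =>
      Finset.sum_nonneg fun k _ => mul_nonneg (sq_nonneg _) (hn k).le
    rw [e1, lintegral_sum_jacobiPoly_sq hα hT, ← ENNReal.ofReal_add (hsn a) (hsn b),
      ← ENNReal.ofReal_mul hC₁.le, mul_assoc]
    refine ENNReal.ofReal_le_ofReal (mul_le_mul_of_nonneg_left ?_ hC₁.le)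
    rw [← Finset.sum_add_distrib, Finset.mul_sum]
    refine Finset.sum_le_sum fun k hk => ?_
    have hk1 : (1 : ℝ) ≤ k := by exact_mod_cast hs k hk
    have h5 : (1 : ℝ) ≤ (k : ℝ) ^ (2 * α) := Real.one_le_rpow hk1 (by positivity)
    have h6 : a k ^ 2 = (beta (k + 1 - α) α)⁻¹ ^ 2 * b k ^ 2 := by
      rw [ha]
      simp only
      rw [mul_pow, mul_pow, ← pow_mul, mul_comm k 2, pow_mul]
      norm_num
    have h7 : 0 ≤ b k ^ 2 * jacobiNormSq T (-α) 0 k := mul_nonneg (sq_nonneg _) (hn k).le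
    rw [h6]
    calc _ = ((beta (k + 1 - α) α)⁻¹ ^ 2 + 1) * (b k ^ 2 * jacobiNormSq T (-α) 0 k) := by ring
      _ ≤ (C₂ * (k : ℝ) ^ (2 * α) + (k : ℝ) ^ (2 * α)) * (b k ^ 2 * jacobiNormSq T (-α) 0 k) :=
          mul_le_mul_of_nonneg_right (add_le_add (h2 k (hs k hk)) h5) h7
      _ = _ := by ring
end

/-! ### Passage to the remainder and assembly of the estimates. -/

noncomputable section

open Set Filter

variable {α T : ℝ}

lemma integrable_zeroExt {w : ℝ → ℝ} (hw : Continuous w) :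
    Integrable fun t : ℝ => (((Ioo 0 T).indicator w t : ℝ) : ℂ) :=
  ((integrable_indicator_iff measurableSet_Ioo).2
    ((hw.continuousOn.integrableOn_compact isCompact_Icc).mono_set Ioo_subset_Icc_self)).ofReal

lemma enorm_fourier_zeroExt_sub_le {u w : ℝ → ℝ} (hu : Continuous u) (hw : Continuous w) (ξ : ℝ) :
    ‖𝓕 (fun t : ℝ => (((Ioo 0 T).indicator u t : ℝ) : ℂ)) ξ -
      𝓕 (fun t : ℝ => (((Ioo 0 T).indicator w t : ℝ) : ℂ)) ξ‖ₑ ≤ ∫⁻ t in Ioo 0 T, ‖u t - w t‖ₑ := by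
  simp_rw [Real.fourier_real_eq]
  have hi : ∀ {f : ℝ → ℂ}, Integrable f → Integrable fun t => Real.fourierChar (-(t * ξ)) • f t :=
    fun hf => (Real.fourierIntegral_convergent_iff' (.mul ℝ ℝ) ξ).2 hf
  rw [← integral_sub (hi (integrable_zeroExt hu)) (hi (integrable_zeroExt hw)),
    ← lintegral_indicator measurableSet_Ioo]
  refine (enorm_integral_le_lintegral_enorm _).trans (lintegral_mono fun t => ?_)
  simp only
  rw [← smul_sub, ← ofReal_norm, Circle.norm_smul, ofReal_norm, ← Complex.ofReal_sub,
    ← ofReal_norm, Complex.norm_real, ofReal_norm]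
  by_cases ht : t ∈ Ioo 0 T <;> simp [ht]

/-- The `L¹` norm on `(0,T)` is controlled by the weighted `L²` norm. -/
lemma lintegral_enorm_sq_le (hα₀ : 0 < α) (hα : α < 1) (hT : 0 < T) {w : ℝ → ℝ}
    (hw : Continuous w) :
    (∫⁻ t in Ioo 0 T, ‖w t‖ₑ) ^ 2 ≤
      ENNReal.ofReal (T ^ α * T) * ENNReal.ofReal (∫ t, w t ^ 2 ∂(jacobiMeasure T (-α) 0)) := by
  have h := lintegral_sq_le_mul (ν := volume.restrict (Ioo 0 T)) (f := fun t => ‖w t‖ₑ)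
    (f₁ := fun t => ENNReal.ofReal ((T - t) ^ α))
    (f₂ := fun t => ENNReal.ofReal ((T - t) ^ (-α)) * ‖w t‖ₑ ^ 2) (by fun_prop) (by fun_prop) ?_
  · refine h.trans (mul_le_mul' ?_ (le_of_eq ?_))
    · calc _ ≤ ∫⁻ t in Ioo 0 T, ENNReal.ofReal (T ^ α) := by
            refine setLIntegral_mono' measurableSet_Ioo fun t ht => ENNReal.ofReal_le_ofReal ?_
            exact Real.rpow_le_rpow (by linarith [ht.2]) (by linarith [ht.1]) hα₀.le
        _ = _ := by
            rw [setLIntegral_const, Real.volume_Ioo, sub_zero, ← ENNReal.ofReal_mul (by positivity)]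
    · rw [← lintegral_jacobiMeasure,
        ofReal_integral_eq_lintegral_ofReal (integrable_jacobiMeasure hα hT (by fun_prop))
          (.of_forall fun t => sq_nonneg _)]
      refine lintegral_congr fun t => ?_
      rw [← ofReal_norm, ← ENNReal.ofReal_pow (norm_nonneg _), Real.norm_eq_abs, sq_abs]
  · refine (ae_restrict_iff' measurableSet_Ioo).2 (.of_forall fun t ht => le_of_eq ?_)
    have hTt : 0 < T - t := sub_pos.2 ht.2
    rw [← mul_assoc, ← ENNReal.ofReal_mul (by positivity), ← Real.rpow_add hTt, add_neg_cancel,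
      Real.rpow_zero, ENNReal.ofReal_one, one_mul]

/-- Convergence in the weighted `L²` norm implies convergence in `L¹(0,T)`, hence of the Fourier
integrals at every `ξ`. -/
lemma tendsto_fourier_jacobiExpansion (hα₀ : 0 < α) (hα : α < 1) (hT : 0 < T) {v : ℝ → ℝ}
    (hv : Continuous v) (M : ℕ) (ξ : ℝ) :
    Tendsto (fun N => 𝓕 (fun t : ℝ => (((Ioo 0 T).indicator
      (fun t => jacobiExpansion α T N v t - jacobiExpansion α T M v t) t : ℝ) : ℂ)) ξ) atTop
      (nhds (𝓕 (fun t : ℝ => (((Ioo 0 T).indicator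
        (fun t => v t - jacobiExpansion α T M v t) t : ℝ) : ℂ)) ξ)) := by
  have hc := fun N => continuous_jacobiExpansion (α := α) (T := T) N v
  rw [tendsto_iff_edist_tendsto_0]
  have hsq : Tendsto (fun N => ENNReal.ofReal (T ^ α * T) * ENNReal.ofReal
      (∫ t, (v t - jacobiExpansion α T N v t) ^ 2 ∂(jacobiMeasure T (-α) 0))) atTop (nhds 0) := by
    have h := ENNReal.tendsto_ofReal (tendsto_integral_sub_jacobiExpansion_sq hα hT hv)
    have := ENNReal.Tendsto.const_mul (a := ENNReal.ofReal (T ^ α * T)) h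
      (Or.inr ENNReal.ofReal_ne_top)
    simpa using this
  have hroot := (ENNReal.continuous_rpow_const (y := 1 / 2)).tendsto _ |>.comp hsq
  rw [ENNReal.zero_rpow_of_pos (by norm_num)] at hroot
  refine tendsto_of_tendsto_of_tendsto_of_le_of_le tendsto_const_nhds hroot (fun _ => zero_le)
    fun N => ?_
  have h1 := lintegral_enorm_sq_le hα₀ hα hT (hv.sub (hc N))
  simp only [Function.comp_apply]
  rw [edist_comm, edist_eq_enorm_sub]
  refine (enorm_fourier_zeroExt_sub_le (hv.sub (hc M)) ((hc N).sub (hc M)) ξ).trans ?_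
  simp only [Pi.sub_apply, sub_sub_sub_cancel_right] at h1 ⊢
  calc _ = ((∫⁻ t in Ioo 0 T, ‖v t - jacobiExpansion α T N v t‖ₑ) ^ 2) ^ (1 / 2 : ℝ) := by
        rw [← ENNReal.rpow_natCast, ← ENNReal.rpow_mul]; norm_num
    _ ≤ _ := ENNReal.rpow_le_rpow h1 (by norm_num)

lemma ofReal_mul_sq_rpow_half {C B : ℝ} (hC : 0 ≤ C) :
    ENNReal.ofReal (C * B) ^ (1 / 2 : ℝ) = ENNReal.ofReal (√C * √B) := by
  rw [← Real.sqrt_mul hC, Real.sqrt_eq_rpow]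
  rcases le_total 0 (C * B) with h | h
  · rw [ENNReal.ofReal_rpow_of_nonneg h (by norm_num)]
  · rw [ENNReal.ofReal_of_nonpos h, ← Real.sqrt_eq_rpow, Real.sqrt_eq_zero_of_nonpos h]
    simp

/-- The Sobolev seminorm of the remainder of a Jacobi expansion is controlled by the weighted tail of
its coefficients. -/
lemma exists_sobolevSeminorm_sub_le (hα₀ : 0 < α) (hα : α < 1) (hT : 0 < T) :
    ∃ C : ℝ, 0 < C ∧ ∀ v : ℝ → ℝ, Continuous v → ∀ (M : ℕ) (B : ℝ),
      (∀ N, ∑ k ∈ Finset.Ico (M + 1) (N + 1), (k : ℝ) ^ (2 * α) *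
        (jacobiCoeff T (-α) 0 v k ^ 2 * jacobiNormSq T (-α) 0 k) ≤ B) →
      sobolevSeminorm T (α / 2) (fun t => v t - jacobiExpansion α T M v t) ≤
        ENNReal.ofReal (C * √B) := by
  obtain ⟨C, hC, h⟩ := exists_fourier_sum_jacobiPoly_le hα₀ hα hT
  refine ⟨√((2 * Real.pi) ^ α * C), by positivity, fun v hv M B hB => ?_⟩
  have hc := fun N => continuous_jacobiExpansion (α := α) (T := T) N v
  rw [sobolevSeminorm_sq, ← ofReal_mul_sq_rpow_half (by positivity), mul_assoc,
    ENNReal.ofReal_mul (by positivity)]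
  refine ENNReal.rpow_le_rpow (mul_le_mul' le_rfl ?_) (by norm_num)
  set F : ℕ → ℝ → ℂ := fun N => 𝓕 (fun t : ℝ => (((Ioo 0 T).indicator
    (fun t => jacobiExpansion α T N v t - jacobiExpansion α T M v t) t : ℝ) : ℂ)) with hF
  have hlim : ∀ ξ, ENNReal.ofReal (|ξ| ^ α) * ‖𝓕 (fun t : ℝ => (((Ioo 0 T).indicator
        (fun t => v t - jacobiExpansion α T M v t) t : ℝ) : ℂ)) ξ‖ₑ ^ 2 =
      liminf (fun N => ENNReal.ofReal (|ξ| ^ α) * ‖F N ξ‖ₑ ^ 2) atTop := by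
    intro ξ
    refine (Tendsto.liminf_eq ?_).symm
    refine ENNReal.Tendsto.const_mul ?_ (Or.inr ENNReal.ofReal_ne_top)
    have := (tendsto_fourier_jacobiExpansion hα₀ hα hT hv M ξ).enorm
    exact ((ENNReal.continuous_pow 2).tendsto _).comp this
  have hFm : ∀ N, Measurable (F N) := fun N =>
    (continuous_fourier (integrable_zeroExt ((hc N).sub (hc M)))).measurable
  simp_rw [hlim]
  -- Fatou's lemma carries the coefficient bound from finite sections to the remainder, and so also
  -- proves that its seminorm is finite.
  refine (lintegral_liminf_le fun N => by have := hFm N; fun_prop).trans ?_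
  refine liminf_le_of_frequently_le' (Eventually.frequently ?_)
  filter_upwards [eventually_ge_atTop M] with N hN
  have e : ∀ t, jacobiExpansion α T N v t - jacobiExpansion α T M v t =
      ∑ k ∈ Finset.Ico (M + 1) (N + 1),
        jacobiCoeff T (-α) 0 v k * (jacobiPoly α T k).eval t := fun t => by
    rw [jacobiExpansion, jacobiExpansion, Finset.sum_Ico_eq_sub _ (by omega)]
  have h1 := h (Finset.Ico (M + 1) (N + 1)) (jacobiCoeff T (-α) 0 v)
    (fun k hk => by have := (Finset.mem_Ico.1 hk).1; omega)
  simp only [hF, e]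
  exact h1.trans (ENNReal.ofReal_le_ofReal (mul_le_mul_of_nonneg_left (hB N) hC.le))

lemma eLpNorm_sub_jacobiExpansion_le (hα : α < 1) (hT : 0 < T) {v : ℝ → ℝ} (hv : Continuous v)
    (M : ℕ) {B : ℝ} (hB : ∀ N, ∑ k ∈ Finset.Ico (M + 1) (N + 1),
      jacobiCoeff T (-α) 0 v k ^ 2 * jacobiNormSq T (-α) 0 k ≤ B) :
    weightedL2Norm T (-α) 0 (fun t => v t - jacobiExpansion α T M v t) ≤ ENNReal.ofReal √B := by
  have hc := continuous_jacobiExpansion (α := α) (T := T) M v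
  have h1 := integral_sub_jacobiExpansion_sq_le_of_tail hα hT hv M hB
  have h2 := ofReal_mul_sq_rpow_half (C := 1) (B := B) (by norm_num)
  rw [Real.sqrt_one, one_mul, one_mul] at h2
  rw [weightedL2Norm, eLpNorm_eq_lintegral_rpow_enorm_toReal (by norm_num) (by norm_num), ← h2]
  simp only [ENNReal.toReal_ofNat]
  refine ENNReal.rpow_le_rpow ?_ (by norm_num)
  refine le_trans (le_of_eq ?_) (ENNReal.ofReal_le_ofReal h1)
  rw [ofReal_integral_eq_lintegral_ofReal (integrable_jacobiMeasure hα hT (by fun_prop))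
    (.of_forall fun t => sq_nonneg _)]
  refine lintegral_congr fun t => ?_
  rw [show (2 : ℝ) = ((2 : ℕ) : ℝ) by norm_num, ENNReal.rpow_natCast, ← ofReal_norm,
    ← ENNReal.ofReal_pow (norm_nonneg _), Real.norm_eq_abs, sq_abs]

lemma weightedSq_jacobiCoeff_relaxCont_le (hα₀ : 0 < α) (hα : α < 1) (hT : 0 < T) :
    ∃ D : ℝ, 0 < D ∧ ∀ (σ lam : ℝ), 0 < lam → ∀ k : ℕ, 1 ≤ k → ∀ θ : ℝ, -1 ≤ θ → θ ≤ 1 →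
      (k : ℝ) ^ (2 * σ) * (jacobiCoeff T (-α) 0 (relaxCont α lam) k ^ 2 *
        jacobiNormSq T (-α) 0 k) ≤
      D * (lam * T ^ α) ^ (2 * θ) * (k : ℝ) ^ (-3 + 2 * σ - 4 * α * θ) := by
  obtain ⟨C, hC, h⟩ := exists_abs_jacobiCoeff_relaxCont_le hα₀ hα hT
  refine ⟨C ^ 2 * T ^ (1 - α), by positivity, fun σ lam hl k hk θ h1 h2 => ?_⟩
  have hk' : (1 : ℝ) ≤ k := by exact_mod_cast hk
  have hk0 : (0 : ℝ) < k := by linarith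
  have hΛ : 0 < lam * T ^ α := by positivity
  have hn : jacobiNormSq T (-α) 0 k ≤ T ^ (1 - α) * (k : ℝ) ^ (-1 : ℝ) := by
    rw [jacobiNormSq_eq hα, div_eq_mul_inv, Real.rpow_neg_one]
    gcongr
    linarith
  have hsq : jacobiCoeff T (-α) 0 (relaxCont α lam) k ^ 2 ≤
      (C * (lam * T ^ α) ^ θ * (k : ℝ) ^ (-1 - 2 * α * θ)) ^ 2 := by
    rw [← sq_abs]
    exact pow_le_pow_left₀ (abs_nonneg _) (h lam hl k hk θ h1 h2) 2
  calc _ ≤ (k : ℝ) ^ (2 * σ) * ((C * (lam * T ^ α) ^ θ * (k : ℝ) ^ (-1 - 2 * α * θ)) ^ 2 *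
        (T ^ (1 - α) * (k : ℝ) ^ (-1 : ℝ))) := by
        have := (jacobiNormSq_pos hα hT k).le
        gcongr
    _ = C ^ 2 * T ^ (1 - α) * ((lam * T ^ α) ^ θ) ^ 2 * ((k : ℝ) ^ (2 * σ) *
        ((k : ℝ) ^ (-1 - 2 * α * θ) * (k : ℝ) ^ (-1 - 2 * α * θ)) * (k : ℝ) ^ (-1 : ℝ)) := by ring
    _ = _ := by
        rw [← Real.rpow_add hk0, ← Real.rpow_add hk0, ← Real.rpow_add hk0,
          ← Real.rpow_natCast ((lam * T ^ α) ^ θ), ← Real.rpow_mul hΛ.le]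
        push_cast
        ring_nf

/-- Square roots of tails of the weighted coefficient series, uniformly in `θ` on the set `S`. -/
lemma exists_sqrt_tail_le (hα₀ : 0 < α) (hα : α < 1) (hT : 0 < T) {σ : ℝ} (hσ : σ < 1) (S : Set ℝ)
    (hS : 1 - σ ≠ 2 * α ∨ S.Subsingleton) :
    ∃ K : ℝ, 0 < K ∧ ∀ θ ∈ S, -1 ≤ θ → θ ≤ 1 → σ < 1 + 2 * α * θ → ∀ lam : ℝ, 0 < lam →
      ∀ M : ℕ, 1 ≤ M → ∃ B : ℝ,
        (∀ N, ∑ k ∈ Finset.Ico (M + 1) (N + 1), (k : ℝ) ^ (2 * σ) *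
          (jacobiCoeff T (-α) 0 (relaxCont α lam) k ^ 2 * jacobiNormSq T (-α) 0 k) ≤ B) ∧
        √B ≤ K * lam ^ θ * (M : ℝ) ^ (σ - 1 - 2 * α * θ) := by
  obtain ⟨D, hD, hcoeff⟩ := weightedSq_jacobiCoeff_relaxCont_le hα₀ hα hT
  have key : ∃ C : ℝ, 0 < C ∧ ∀ θ ∈ S, -1 ≤ θ → θ ≤ 1 → σ < 1 + 2 * α * θ → ∀ lam : ℝ, 0 < lam →
      ∀ M N : ℕ, 1 ≤ M → ∑ k ∈ Finset.Ico (M + 1) (N + 1), (k : ℝ) ^ (2 * σ) *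
          (jacobiCoeff T (-α) 0 (relaxCont α lam) k ^ 2 * jacobiNormSq T (-α) 0 k) ≤
        C * ((lam * T ^ α) ^ (2 * θ) * (M : ℝ) ^ (-(2 - 2 * σ + 4 * α * θ))) := by
    rcases hS with hne | hsub
    · obtain ⟨C, hC, h⟩ := exists_sum_tail_le hα₀ hσ hne
      refine ⟨C * D, by positivity, fun θ _ h1 h2 h3 lam hl M N hM => ?_⟩
      refine h D (lam * T ^ α) _ hD.le (by positivity) (fun k => ?_)
        (fun k hk θ' h1' h2' => hcoeff σ lam hl k hk θ' h1' h2') θ h1 h2 (by linarith) M N hM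
      have := (jacobiNormSq_pos hα hT k).le
      positivity
    -- With at most one `θ` in play the nonuniform bound suffices; if it is not admissible, any
    -- constant will do.
    · by_cases hne : ∃ θ ∈ S, -1 ≤ θ ∧ θ ≤ 1 ∧ σ < 1 + 2 * α * θ
      · obtain ⟨θ₀, hθ₀, h1, h2, h3⟩ := hne
        refine ⟨D / (2 - 2 * σ + 4 * α * θ₀), div_pos hD (by linarith),
          fun θ hθ _ _ _ lam hl M N hM => ?_⟩
        obtain rfl := hsub hθ hθ₀
        exact sum_tail_le hM (fun k hk => hcoeff σ lam hl k hk θ h1 h2) (by linarith) hD.le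
          (by positivity)
      · exact ⟨1, one_pos, fun θ hθ h1 h2 h3 => absurd ⟨θ, hθ, h1, h2, h3⟩ hne⟩
  obtain ⟨C, hC, h⟩ := key
  refine ⟨√C * max (T ^ α) (T ^ (-α)), by positivity, fun θ hθ h1 h2 h3 lam hl M hM =>
    ⟨_, fun N => h θ hθ h1 h2 h3 lam hl M N hM, ?_⟩⟩
  have hM0 : (0 : ℝ) < M := by exact_mod_cast hM
  have hΛ : 0 < lam * T ^ α := by positivity
  have e : (lam * T ^ α) ^ (2 * θ) * (M : ℝ) ^ (-(2 - 2 * σ + 4 * α * θ)) =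
      ((lam * T ^ α) ^ θ * (M : ℝ) ^ (σ - 1 - 2 * α * θ)) ^ 2 := by
    rw [mul_pow, ← Real.rpow_natCast, ← Real.rpow_natCast, ← Real.rpow_mul hΛ.le,
      ← Real.rpow_mul hM0.le]
    push_cast
    ring_nf
  -- This removes the dependence on `θ` from the power of `T`.
  have hTθ : (T ^ α) ^ θ ≤ max (T ^ α) (T ^ (-α)) := by
    rw [← Real.rpow_mul hT.le]
    rcases le_total 1 T with h' | h'
    · exact le_max_of_le_left (Real.rpow_le_rpow_of_exponent_le h' (by nlinarith))
    · exact le_max_of_le_right (Real.rpow_le_rpow_of_exponent_ge hT h' (by nlinarith))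
  rw [e, Real.sqrt_mul hC.le, Real.sqrt_sq (by positivity), Real.mul_rpow hl.le (by positivity)]
  calc √C * (lam ^ θ * (T ^ α) ^ θ * (M : ℝ) ^ (σ - 1 - 2 * α * θ))
      ≤ √C * (lam ^ θ * max (T ^ α) (T ^ (-α)) * (M : ℝ) ^ (σ - 1 - 2 * α * θ)) := by gcongr
    _ = _ := by ring

lemma relaxation_sub_jacobiProj_ae_eq (hα₀ : 0 < α) (hα : α < 1) {lam : ℝ} (hl : 0 < lam) (y₀ : ℝ)
    (M : ℕ) : ∀ᵐ t ∂(volume.restrict (Ioo 0 T)),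
      relaxation α lam y₀ t - jacobiProj T (-α) 0 M (relaxation α lam y₀) t =
        y₀ * (relaxCont α lam t - jacobiExpansion α T M (relaxCont α lam) t) := by
  have hae := relaxation_ae_eq (T := T) hα₀ hα hl y₀
  have hcoeff : ∀ k, jacobiCoeff T (-α) 0 (relaxation α lam y₀) k =
      y₀ * jacobiCoeff T (-α) 0 (relaxCont α lam) k := by
    intro k
    rw [jacobiCoeff, jacobiCoeff, ← mul_div_assoc, ← integral_const_mul]
    congr 1
    refine integral_congr_ae ?_
    filter_upwards [hae] with t ht
    rw [ht]; ring
  filter_upwards [hae, ae_restrict_mem measurableSet_Ioo] with t ht ht'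
  rw [ht, jacobiProj_eq _ _ ht', jacobiExpansion, jacobiExpansion, mul_sub, Finset.mul_sum]
  congr 1
  exact Finset.sum_congr rfl fun k _ => by rw [hcoeff, mul_assoc]

lemma sobolevSeminorm_const_mul_of_ae_eq {γ c : ℝ} {u w : ℝ → ℝ}
    (h : ∀ᵐ t ∂(volume.restrict (Ioo 0 T)), u t = c * w t) :
    sobolevSeminorm T γ u = ENNReal.ofReal |c| * sobolevSeminorm T γ w := by
  have hF : ∀ ξ, fourierZeroExt T u ξ = c * fourierZeroExt T w ξ := by
    intro ξ
    rw [fourierZeroExt, fourierZeroExt, mul_left_comm]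
    congr 1
    simp_rw [Real.fourier_real_eq]
    rw [← integral_const_mul]
    refine integral_congr_ae ?_
    filter_upwards [(ae_restrict_iff' measurableSet_Ioo).1 h] with t ht
    by_cases ht' : t ∈ Ioo 0 T
    · rw [indicator_of_mem ht', indicator_of_mem ht', ht ht', Circle.smul_def, Circle.smul_def]
      push_cast
      simp only [smul_eq_mul]
      ring
    · rw [indicator_of_notMem ht', indicator_of_notMem ht']
      simp
  rw [sobolevSeminorm, sobolevSeminorm]
  have e : ∀ ξ : ℝ, ENNReal.ofReal (|ξ| ^ (2 * γ) * ‖fourierZeroExt T u ξ‖ ^ 2) =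
      ENNReal.ofReal (|c| ^ 2) * ENNReal.ofReal (|ξ| ^ (2 * γ) * ‖fourierZeroExt T w ξ‖ ^ 2) := by
    intro ξ
    rw [← ENNReal.ofReal_mul (by positivity), hF, norm_mul, Complex.norm_real, Real.norm_eq_abs]
    ring_nf
  simp_rw [e]
  rw [lintegral_const_mul' _ _ ENNReal.ofReal_ne_top, ENNReal.mul_rpow_of_nonneg _ _ (by norm_num),
    ENNReal.ofReal_pow (abs_nonneg _), ← ENNReal.rpow_natCast, ← ENNReal.rpow_mul]
  norm_num

lemma weightedL2Norm_const_mul_of_ae_eq {a b c : ℝ} {u w : ℝ → ℝ}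
    (h : ∀ᵐ t ∂(volume.restrict (Ioo 0 T)), u t = c * w t) :
    weightedL2Norm T a b u = ENNReal.ofReal |c| * weightedL2Norm T a b w := by
  have h' : u =ᵐ[jacobiMeasure T a b] c • w :=
    (jacobiMeasure_absolutelyContinuous a b).ae_le h
  rw [weightedL2Norm, eLpNorm_congr_ae h', eLpNorm_const_smul, Real.enorm_eq_ofReal_abs,
    weightedL2Norm]

/-- Tail weight `σ = α`, for which the critical relation `1 - σ = 2α` means `α = 1/3`. -/
lemma exists_sobolevSeminorm_relaxation_le (hα₀ : 0 < α) (hα : α < 1) (hT : 0 < T) (S : Set ℝ)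
    (hS : α ≠ 1 / 3 ∨ S.Subsingleton) :
    ∃ C : ℝ, ∀ θ ∈ S, -1 ≤ θ → θ ≤ 1 → α < 1 + 2 * α * θ →
      ∀ lam y₀ : ℝ, 0 < lam → ∀ M : ℕ, 1 ≤ M →
        sobolevSeminorm T (α / 2) (fun t =>
            relaxation α lam y₀ t - jacobiProj T (-α) 0 M (relaxation α lam y₀) t) ≤
          ENNReal.ofReal (C * |y₀| * lam ^ θ * (M : ℝ) ^ (α - 1 - 2 * α * θ)) := by
  obtain ⟨K, hK, hB⟩ := exists_sqrt_tail_le hα₀ hα hT hα S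
    (hS.imp_left fun h h' => h (by linarith))
  obtain ⟨C, hC, h⟩ := exists_sobolevSeminorm_sub_le hα₀ hα hT
  refine ⟨C * K, fun θ hθ h1 h2 h3 lam y₀ hl M hM => ?_⟩
  obtain ⟨B, hB1, hB2⟩ := hB θ hθ h1 h2 h3 lam hl M hM
  rw [sobolevSeminorm_const_mul_of_ae_eq (relaxation_sub_jacobiProj_ae_eq hα₀ hα hl y₀ M)]
  refine (mul_le_mul' le_rfl (h _ (continuous_relaxCont hα₀ hα hl) M B hB1)).trans ?_
  rw [← ENNReal.ofReal_mul (abs_nonneg _)]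
  refine ENNReal.ofReal_le_ofReal ?_
  calc |y₀| * (C * √B) ≤ |y₀| * (C * (K * lam ^ θ * (M : ℝ) ^ (α - 1 - 2 * α * θ))) := by gcongr
    _ = _ := by ring

/-- Tail weight `σ = 0`, for which the critical relation means `α = 1/2`. -/
lemma exists_weightedL2Norm_relaxation_le (hα₀ : 0 < α) (hα : α < 1) (hT : 0 < T) (S : Set ℝ)
    (hS : α ≠ 1 / 2 ∨ S.Subsingleton) :
    ∃ C : ℝ, ∀ θ ∈ S, -1 ≤ θ → θ ≤ 1 → 0 < 1 + 2 * α * θ →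
      ∀ lam y₀ : ℝ, 0 < lam → ∀ M : ℕ, 1 ≤ M →
        weightedL2Norm T (-α) 0 (fun t =>
            relaxation α lam y₀ t - jacobiProj T (-α) 0 M (relaxation α lam y₀) t) ≤
          ENNReal.ofReal (C * |y₀| * lam ^ θ * (M : ℝ) ^ (-1 - 2 * α * θ)) := by
  obtain ⟨K, hK, hB⟩ := exists_sqrt_tail_le hα₀ hα hT (σ := 0) one_pos S
    (hS.imp_left fun h h' => h (by linarith))
  refine ⟨K, fun θ hθ h1 h2 h3 lam y₀ hl M hM => ?_⟩
  obtain ⟨B, hB1, hB2⟩ := hB θ hθ h1 h2 h3 lam hl M hM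
  simp only [mul_zero, Real.rpow_zero, one_mul] at hB1
  rw [weightedL2Norm_const_mul_of_ae_eq (relaxation_sub_jacobiProj_ae_eq hα₀ hα hl y₀ M)]
  refine (mul_le_mul' le_rfl
    (eLpNorm_sub_jacobiExpansion_le hα hT (continuous_relaxCont hα₀ hα hl) M hB1)).trans ?_
  rw [← ENNReal.ofReal_mul (abs_nonneg _)]
  refine ENNReal.ofReal_le_ofReal ?_
  rw [zero_sub] at hB2
  calc |y₀| * √B ≤ |y₀| * (K * lam ^ θ * (M : ℝ) ^ (-1 - 2 * α * θ)) := by gcongr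
    _ = _ := by ring

end

theorem mainTheorem7 (α T : ℝ) (hα₀ : 0 < α) (hα₁ : α < 1) (hT : 0 < T) :
    ((α ≠ 1 / 3 →
        ∃ C : ℝ, ∀ θ : ℝ, -1 ≤ θ → θ ≤ 1 → α < 1 + 2 * α * θ →
          ∀ lam y₀ : ℝ, 0 < lam → ∀ M : ℕ, 1 ≤ M →
            sobolevSeminorm T (α / 2) (fun t =>
                relaxation α lam y₀ t - jacobiProj T (-α) 0 M (relaxation α lam y₀) t) ≤
              ENNReal.ofReal
                (C * |y₀| * lam ^ θ * (M : ℝ) ^ (α - 1 - 2 * α * θ))) ∧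
      (α = 1 / 3 →
        ∀ θ : ℝ, -1 ≤ θ → θ ≤ 1 → α < 1 + 2 * α * θ →
          ∃ C : ℝ, ∀ lam y₀ : ℝ, 0 < lam → ∀ M : ℕ, 1 ≤ M →
            sobolevSeminorm T (α / 2) (fun t =>
                relaxation α lam y₀ t - jacobiProj T (-α) 0 M (relaxation α lam y₀) t) ≤
              ENNReal.ofReal
                (C * |y₀| * lam ^ θ * (M : ℝ) ^ (α - 1 - 2 * α * θ)))) ∧
    ((α ≠ 1 / 2 →
        ∃ C : ℝ, ∀ θ : ℝ, -1 ≤ θ → θ ≤ 1 → 0 < 1 + 2 * α * θ →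
          ∀ lam y₀ : ℝ, 0 < lam → ∀ M : ℕ, 1 ≤ M →
            weightedL2Norm T (-α) 0 (fun t =>
                relaxation α lam y₀ t - jacobiProj T (-α) 0 M (relaxation α lam y₀) t) ≤
              ENNReal.ofReal
                (C * |y₀| * lam ^ θ * (M : ℝ) ^ (-1 - 2 * α * θ))) ∧
      (α = 1 / 2 →
        ∀ θ : ℝ, -1 ≤ θ → θ ≤ 1 → 0 < 1 + 2 * α * θ →
          ∃ C : ℝ, ∀ lam y₀ : ℝ, 0 < lam → ∀ M : ℕ, 1 ≤ M →
            weightedL2Norm T (-α) 0 (fun t =>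
                relaxation α lam y₀ t - jacobiProj T (-α) 0 M (relaxation α lam y₀) t) ≤
              ENNReal.ofReal
                (C * |y₀| * lam ^ θ * (M : ℝ) ^ (-1 - 2 * α * θ)))) := by

  refine ⟨⟨fun h => ?_, fun _ θ h1 h2 h3 => ?_⟩, ⟨fun h => ?_, fun _ θ h1 h2 h3 => ?_⟩⟩
  -- Taking all `θ` at once gives the uniform constant; a singleton gives the constant that may
  -- depend on `θ`.
  · obtain ⟨C, hC⟩ := exists_sobolevSeminorm_relaxation_le hα₀ hα₁ hT Set.univ (Or.inl h)
    exact ⟨C, fun θ => hC θ (Set.mem_univ θ)⟩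
  · obtain ⟨C, hC⟩ := exists_sobolevSeminorm_relaxation_le hα₀ hα₁ hT {θ}
      (Or.inr Set.subsingleton_singleton)
    exact ⟨C, hC θ rfl h1 h2 h3⟩
  · obtain ⟨C, hC⟩ := exists_weightedL2Norm_relaxation_le hα₀ hα₁ hT Set.univ (Or.inl h)
    exact ⟨C, fun θ => hC θ (Set.mem_univ θ)⟩
  · obtain ⟨C, hC⟩ := exists_weightedL2Norm_relaxation_le hα₀ hα₁ hT {θ}
      (Or.inr Set.subsingleton_singleton)
    exact ⟨C, hC θ rfl h1 h2 h3⟩
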